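/- Model: a randomized word RAM with read-only access to a simple undirected graph $G$ with node set $\{0,\dots,n-1\}$, $m$ edges, and two distinguished nodes $s,t$. Every node $v$ has a local ordering of its neighbours given by an arbitrary bijection $\mathrm{PORT}_v:\Gamma(v)\to\{0,\dots,\deg(v)-1\}$. Memory words have $w=\kappa\cdot\ell(n)$ bits, where $\ell(n)$ is the binary length of $n$ and $\kappa$ is a constant of the program. With space $S$ (in bits) the machine has $\lfloor S/w\rfloor$ memory cells, initially $0$. Each of the following takes one time step: an arithmetic operation or comparison on words, an indirect memory access, a control step, the computation of $\deg(v)$, of $\mathrm{PORT}_v(u)$ for $u\in\Gamma(v)$, or of $\mathrm{PORT}_v^{-1}(i)$ for $i<\deg(v)$ (graph queries outside these ranges return $0$), the drawing of a fresh uniformly random integer from $\{0,\dots,a\}$ where $a$ is the content of a cell, and the reading of one of the parameters $n$, $s$, $t$ and the number of available cells (cut off at the largest word). Theorem. There are a single program $P$ (with its word-length constant $\kappa$), a constant $c>0$ and a number $k\in\mathbb N$ such that for every $\alpha>0$ there is a constant $C$ with the following property. For every $n\ge 2$, every space bound $S\ge c\log n$, every simple undirected, not necessarily connected, graph $G$ with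 $n$ nodes and $m\ge\alpha n$ edges, every choice of port orderings and all nodes $s,t$ of $G$, the program $P$, run with space $S$, always halts within $$C\cdot\max\Big\{\frac{n^2}{S},\,m\Big\}\cdot(\log n)^k$$ steps, i.e. in time $\tilde O(\max\{n^2/S,m\})$, and decides whether $s$ and $t$ lie in the same connected component of $G$ with one-sided error at most $1/n$: if they do not, it never answers "connected"; if they do, it answers "connected" with probability at least $1-\frac1n$. -/

import Mathlib

/-! A randomized word RAM with a fixed amount of read-write memory, and read-only access to an
undirected graph. -/

/-- An instance of undirected `s`-`t` connectivity on `n` nodes: a simple graph, a local ordering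
of the neighbours of every node (its ports `0, …, deg v - 1`), and two distinguished nodes. -/
structure USTCON (n : ℕ) where
  graph : SimpleGraph (Fin n)
  [decAdj : DecidableRel graph.Adj]
  port : (v : Fin n) → graph.neighborSet v ≃ Fin (graph.degree v)
  s : Fin n
  t : Fin n

attribute [instance] USTCON.decAdj

namespace USTCON

variable {n : ℕ}

/-- The number of edges. -/
def numEdges (x : USTCON n) : ℕ := x.graph.edgeFinset.card

/-- `s` and `t` lie in the same connected component. -/
def Connected (x : USTCON n) : Prop := x.graph.Reachable x.s x.t

/-- Answer to the query `deg v` (`0` if `v` is not a node). -/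
def degQuery (x : USTCON n) (v : ℕ) : ℕ :=
  if hv : v < n then x.graph.degree ⟨v, hv⟩ else 0

/-- Answer to the query `PORT_v(u)`: the port at `v` that leads to `u`
(`0` if `u` is not a neighbour of `v`). -/
def portQuery (x : USTCON n) (v u : ℕ) : ℕ :=
  if h : ∃ (hv : v < n) (hu : u < n), x.graph.Adj ⟨v, hv⟩ ⟨u, hu⟩ then
    (x.port ⟨v, h.1⟩ ⟨⟨u, h.2.1⟩, h.2.2⟩ : ℕ)
  else 0

/-- Answer to the query `PORT_v⁻¹(i)`: the neighbour of `v` behind port `i`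
(`0` if `v` has no such port). -/
def nbrQuery (x : USTCON n) (v i : ℕ) : ℕ :=
  if h : ∃ hv : v < n, i < x.graph.degree ⟨v, hv⟩ then
    (((x.port ⟨v, h.1⟩).symm ⟨i, h.2⟩ : Fin n) : ℕ)
  else 0

end USTCON

namespace WordRAM

/-- Binary operations on words. -/
inductive BinOp where
  | add | sub | mul | div | mod | lt | eq

/-- Subtraction is truncated at `0`, division is rounded down; comparisons return `1` or `0`.
Results are reduced to the word length when they are written to memory. -/
def BinOp.eval : BinOp → ℕ → ℕ → ℕ
  | .add, a, b => a + b
  | .sub, a, b => a - b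
  | .mul, a, b => a * b
  | .div, a, b => a / b
  | .mod, a, b => a % b
  | .lt, a, b => if a < b then 1 else 0
  | .eq, a, b => if a = b then 1 else 0

/-- The read-only parameters of a run: the number of nodes, the two distinguished nodes, and the
number of available memory cells. -/
inductive Param where
  | nodes | source | target | cells

/-- Elementary instructions. The arguments `d`, `a`, `b` are fixed memory addresses; write `[a]`
for the content of the cell with address `a`. -/
inductive Instr where
  /-- `[d] ← k` -/
  | const (d k : ℕ)
  /-- `[d] ← [a] op [b]` -/
  | arith (op : BinOp) (d a b : ℕ)
  /-- `[d] ← [[a]]` -/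
  | load (d a : ℕ)
  /-- `[[d]] ← [a]` -/
  | store (d a : ℕ)
  /-- `[d] ←` a parameter of the run -/
  | param (d : ℕ) (q : Param)
  /-- `[d] ← deg [a]` -/
  | deg (d a : ℕ)
  /-- `[d] ←` the port at node `[a]` that leads to node `[b]` -/
  | port (d a b : ℕ)
  /-- `[d] ←` the neighbour of node `[a]` behind its port `[b]` -/
  | nbr (d a b : ℕ)
  /-- `[d] ←` a fresh uniformly random element of `{0, 1, …, [a]}` -/
  | rand (d a : ℕ)

/-- Programs: finite control built from elementary instructions. -/
inductive Program where
  | skip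
  | instr (i : Instr)
  | seq (p q : Program)
  /-- run `p` if `[a] ≠ 0`, otherwise `q` -/
  | ite (a : ℕ) (p q : Program)
  /-- repeat `p` as long as `[a] ≠ 0` -/
  | while (a : ℕ) (p : Program)

/-- Memory contents. A machine has `M` cells, with addresses `0, …, M - 1`, each of which holds a
word of `w` bits; all other addresses read as `0` forever (see `write`). -/
abbrev Mem := ℕ → ℕ

/-- Write the `w` low-order bits of `v` to the cell with address `a`; a write to an address outside
the `M` existing cells is lost. -/
def write (w M : ℕ) (m : Mem) (a v : ℕ) : Mem :=
  if a < M then Function.update m a (v % 2 ^ w) else m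

/-- The value of a parameter. The number of cells is cut off at the largest word. -/
def Param.value {n : ℕ} (w M : ℕ) (x : USTCON n) : Param → ℕ
  | .nodes => n
  | .source => x.s
  | .target => x.t
  | .cells => min M (2 ^ w - 1)

/-- The distribution of the memory after an elementary instruction. -/
noncomputable def Instr.exec {n : ℕ} (w M : ℕ) (x : USTCON n) (m : Mem) : Instr → PMF Mem
  | .const d k => PMF.pure (write w M m d k)
  | .arith op d a b => PMF.pure (write w M m d (op.eval (m a) (m b)))
  | .load d a => PMF.pure (write w M m d (m (m a)))
  | .store d a => PMF.pure (write w M m (m d) (m a))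
  | .param d q => PMF.pure (write w M m d (q.value w M x))
  | .deg d a => PMF.pure (write w M m d (x.degQuery (m a)))
  | .port d a b => PMF.pure (write w M m d (x.portQuery (m a) (m b)))
  | .nbr d a b => PMF.pure (write w M m d (x.nbrQuery (m a) (m b)))
  | .rand d a =>
    (PMF.uniformOfFintype (Fin (m a + 1))).map
      fun r : Fin (m a + 1) => write w M m d r.val

/-- A configuration: the parts of the program that remain to be run, in order, and the memory.
For a fixed program only finitely many first components are reachable (they are positions of
the program counter), and the machine has halted when nothing remains to be run. -/
abbrev Config := List Program × Mem

/-- One time step. -/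
noncomputable def step {n : ℕ} (w M : ℕ) (x : USTCON n) : Config → PMF Config
  | ([], m) => PMF.pure ([], m)
  | (.skip :: k, m) => PMF.pure (k, m)
  | (.instr i :: k, m) => (i.exec w M x m).map fun m' => (k, m')
  | (.seq p q :: k, m) => PMF.pure (p :: q :: k, m)
  | (.ite a p q :: k, m) => PMF.pure (if m a ≠ 0 then p :: k else q :: k, m)
  | (.while a p :: k, m) => PMF.pure (if m a ≠ 0 then p :: .while a p :: k else k, m)

/-- The distribution of the configuration after `T` time steps, starting from `z`. -/
noncomputable def run {n : ℕ} (w M : ℕ) (x : USTCON n) : ℕ → Config → PMF Config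
  | 0, z => PMF.pure z
  | T + 1, z => (step w M x z).bind (run w M x T)

/-- The distribution of the configuration after `T` steps of the program `P`, started with empty
memory on a machine that has words of `w` bits and, in total, `S` bits of memory, that is,
`⌊S / w⌋` cells. -/
noncomputable def Program.runOn {n : ℕ} (P : Program) (w S T : ℕ) (x : USTCON n) : PMF Config :=
  run w (S / w) x T ([P], fun _ => 0)

/-- The machine has halted. -/
def Halted (z : Config) : Prop := z.1 = []

/-- The answer is "connected"; it is read from the cell with address `0`. -/
def Accepting (z : Config) : Prop := z.2 0 ≠ 0

/-- On the instance `x`, with words of `w` bits and `S` bits of memory, the program `P` always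
halts within `T` steps and decides whether `s` and `t` are connected with one-sided error at most
`ε`: the answer "connected" is never given if they are not connected, and it is given with
probability at least `1 - ε` if they are. -/
def Program.Solves {n : ℕ} (P : Program) (w S T : ℕ) (x : USTCON n) (ε : ENNReal) : Prop :=
  (∀ z ∈ (P.runOn w S T x).support, Halted z) ∧
  (¬ x.Connected → ∀ z ∈ (P.runOn w S T x).support, ¬ Accepting z) ∧
  (x.Connected → 1 - ε ≤ (P.runOn w S T x).toOuterMeasure {z | Accepting z})

end WordRAM

/-!
# Undirected connectivity in time `Õ(max (n² / S) m)` with space `S`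

The program searches the component of `s` by random walks between random landmarks. The memory
holds one landmark for each of `q ≈ min (S / log n) n` blocks of `g = n / q + 1` nodes,
chosen at random in the block; `s` and `t` count as landmarks, too. From every landmark `a` that has been reached,
about `K * (1 + deg a / d)` excursions are made, each of which ends at the first landmark that it
meets; newly met landmarks are queued. Here `d` is about the average degree, and the walk is the
Metropolis walk for the degrees cut off at `d`: it is the walk of a reversible network with
conductances `1 / max (min d (deg v)) (min d (deg u))` and node weights `max 1 (deg v / d)`. The
search is given up after `T = 16 K n` steps, and the program makes `l` rounds of this kind, where
`l` is the binary length of `n`. An answer is positive only if the walk from `s` has arrived at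
`t`, so there is nothing to prove about wrong positive answers beyond the invariants.

**Time.** By Kac's formula (`Network.sum_wt_return`), the expected lengths of the excursions,
weighted by the node weights, add up to the total weight, which is at most `2 n`. Hence all
excursions together take `4 K n` steps in expectation, and a round is cut off with probability at
most `1 / 4`.

**Success.** If a search ends without having met `t`, then there is a set `B` of landmarks that
contains `t` and was missed by all excursions from the other landmarks of the component of `s`. For
a given `B` this has probability at most `exp (-K * W)`, where `W` is the weight of the cut between
`B` and the other landmarks in the network that the walk induces on the landmarks
(`Network.trace`). Every cut has weight at least `1 / (24 l g + 10 d)`: with high probability every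
ball of `4 l g` nodes contains a landmark, so a shortest path between the two sides passes, apart
from five nodes, through the interior of a ball with fewer nodes, and since a shortest path meets
every neighbourhood in at most three nodes, its resistance is small
(`SimpleGraph.exists_path_of_balls`, `Network.inv_le_sum_wt_avg_hit`). A minimum weight for all cuts
alone does not suffice for the union bound over the sets `B`, but there are few light cuts: by
contraction of random edges, as in Karger's algorithm, the terms `exp (-K * W)` add up to at most
`1 / 8` when `K` is `12 l` times the inverse of the minimum weight (`sum_cuts_le`).

**The random process.** The independence of the excursions is not used as such. Both bounds are
parts of one potential of the state of the search (`Search.pot`), made of solutions of Dirichlet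
problems: a sum over the sets `B` of the probabilities that all remaining excursions miss `B`, plus
the expected total time divided by `T`. It does not increase in expectation, it is at most `3 / 8`
at the start, and at least `1` when the search fails. In the same way the probability that the
landmarks miss a large ball does not increase in expectation while they are chosen
(`avg_missProb_le`). So a round fails with probability at most `1 / 2`, and all `l` rounds with probability at most
`2 ^ (-l) ≤ 1 / n`.

**The machine.** Programs are verified with quantitative Hoare triples (`WordRAM.Tri`): the
assertions have values in `[0, ∞]`, the expectation of the postcondition is bounded by the
precondition, and the value `∞` stands for a violated assertion, as well as for a machine that is
still running. Thus the potential is the loop invariant of the search, and termination, soundness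
and the error probability are read off from the same triple. The loop-free parts of the program are
written in a small language of expressions and commands (`WordRAM.Ex`, `WordRAM.Cmd`) with a
weakest-precondition rule; the words are long enough for all intermediate results.
-/

open scoped ENNReal

namespace WordRAM

/-! ### Expectations -/

/-- The expectation of `f` under `p`. -/
noncomputable def expect {β : Type*} (p : PMF β) (f : β → ℝ≥0∞) : ℝ≥0∞ := ∑' b, p b * f b

section expect

variable {β γ : Type*}

theorem expect_pure (b : β) (f : β → ℝ≥0∞) : expect (PMF.pure b) f = f b := by
  classical
  unfold expect
  rw [tsum_eq_single b]
  · simp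
  · intro b' hb'
    simp [PMF.pure_apply, hb']

theorem expect_bind (p : PMF β) (q : β → PMF γ) (f : γ → ℝ≥0∞) :
    expect (p.bind q) f = expect p fun b => expect (q b) f := by
  unfold expect
  simp only [PMF.bind_apply, ← ENNReal.tsum_mul_right, ← ENNReal.tsum_mul_left]
  rw [ENNReal.tsum_comm]
  simp only [mul_assoc]

theorem expect_map (p : PMF β) (u : β → γ) (f : γ → ℝ≥0∞) :
    expect (p.map u) f = expect p fun b => f (u b) := by
  rw [PMF.map, expect_bind]
  simp only [Function.comp, expect_pure]

theorem expect_mono (p : PMF β) {f g : β → ℝ≥0∞} (h : ∀ b, f b ≤ g b) :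
    expect p f ≤ expect p g :=
  ENNReal.tsum_le_tsum fun b => mul_le_mul_right (h b) _

theorem expect_uniform (a : ℕ) (f : ℕ → ℝ≥0∞) :
    expect (PMF.uniformOfFintype (Fin (a + 1))) (fun r => f r.val) =
      (∑ r ∈ Finset.range (a + 1), f r) / (a + 1 : ℕ) := by
  unfold expect
  rw [tsum_fintype]
  simp only [PMF.uniformOfFintype_apply, Fintype.card_fin]
  rw [← Finset.mul_sum, Finset.sum_range (n := a + 1), mul_comm, ENNReal.div_eq_inv_mul, mul_comm]

theorem expect_ne_top {p : PMF β} {f : β → ℝ≥0∞} (h : expect p f ≠ ⊤) {b : β}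
    (hb : b ∈ p.support) : f b ≠ ⊤ := by
  intro hf
  apply h
  rw [eq_top_iff]
  refine le_trans ?_ (ENNReal.le_tsum b)
  rw [hf, ENNReal.mul_top ((PMF.mem_support_iff _ _).1 hb)]

theorem expect_indicator (p : PMF β) (s : Set β) [DecidablePred (· ∈ s)] :
    expect p (fun b => if b ∈ s then 1 else 0) = p.toOuterMeasure s := by
  rw [PMF.toOuterMeasure_apply]
  unfold expect
  congr 1
  funext b
  by_cases hb : b ∈ s <;> simp [hb]

end expect

/-! ### Values of configurations and quantitative Hoare triples -/

section triples

variable {n : ℕ} (w M : ℕ) (x : USTCON n)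

/-- The expectation of `F` of the final memory when the machine runs for `T` steps from `z`; it is
infinite as soon as the machine may fail to halt within `T` steps. -/
noncomputable def val (F : Mem → ℝ≥0∞) : ℕ → Config → ℝ≥0∞
  | 0, z => if z.1 = [] then F z.2 else ⊤
  | T + 1, z => expect (step w M x z) (val F T)

theorem val_eq_expect_run (F : Mem → ℝ≥0∞) (T : ℕ) (z : Config) :
    val w M x F T z = expect (run w M x T z) fun z => if z.1 = [] then F z.2 else ⊤ := by
  induction T generalizing z with
  | zero => simp only [val, run, expect_pure]
  | succ T ih =>
    simp only [val, run, expect_bind]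
    congr 1
    funext z'
    exact ih z'

theorem val_nil (F : Mem → ℝ≥0∞) (T : ℕ) (m : Mem) : val w M x F T ([], m) = F m := by
  induction T with
  | zero => simp [val]
  | succ T ih => simp only [val, step, expect_pure, ih]

theorem val_succ_le (F : Mem → ℝ≥0∞) (T : ℕ) (z : Config) :
    val w M x F (T + 1) z ≤ val w M x F T z := by
  induction T generalizing z with
  | zero =>
    obtain ⟨k, m⟩ := z
    by_cases hk : k = []
    · subst hk
      rw [val_nil, val_nil]
    · simp [val, hk]
  | succ T ih => exact expect_mono _ fun z' => ih z'

theorem val_antitone (F : Mem → ℝ≥0∞) (z : Config) : Antitone fun T => val w M x F T z :=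
  antitone_nat_of_succ_le fun T => val_succ_le w M x F T z

/-- Addresses `1, …, 15` are scratch cells: expressions are evaluated there. -/
def Visible (a : ℕ) : Prop := a = 0 ∨ 16 ≤ a

/-- Two memories that differ in scratch cells only. -/
def Sim (m a : Mem) : Prop := ∀ i, Visible i → m i = a i

/-- A quantitative Hoare triple: `p` takes at most `t` steps and, from every memory `a`, the
expectation of `g` of the memory that it leaves is at most `f a`. All memories are taken up to
scratch cells, and the value `⊤` of `f` stands for a violated precondition. It is stated in
continuation-passing style, for every program that is run afterwards. -/
def Tri (p : Program) (t : ℕ) (f g : Mem → ℝ≥0∞) : Prop :=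
  ∀ (k : List Program) (T : ℕ) (F : Mem → ℝ≥0∞),
    (∀ a m, Sim m a → val w M x F T (k, m) ≤ g a) →
      ∀ a m, Sim m a → val w M x F (T + t) (p :: k, m) ≤ f a

variable {w M x}

theorem Tri.mono {p : Program} {t t' : ℕ} {f f' g g' : Mem → ℝ≥0∞} (h : Tri w M x p t f g)
    (ht : t ≤ t') (hf : ∀ a, f a ≤ f' a) (hg : ∀ a, g' a ≤ g a) : Tri w M x p t' f' g' := by
  intro k T F hk a m hm
  refine le_trans (val_antitone w M x F _ (Nat.add_le_add_left ht T)) ?_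
  exact le_trans (h k T F (fun a m hm => (hk a m hm).trans (hg a)) a m hm) (hf a)

theorem Tri.seq {p q : Program} {t u : ℕ} {f g h : Mem → ℝ≥0∞} (hp : Tri w M x p t f g)
    (hq : Tri w M x q u g h) : Tri w M x (.seq p q) (t + u + 1) f h := by
  intro k T F hk a m hm
  have := hp (q :: k) (T + u) F (hq k T F hk) a m hm
  rw [show T + (t + u + 1) = (T + u + t) + 1 by ring]
  simpa only [val, step, expect_pure] using this

theorem Tri.while {r : ℕ} (hr : Visible r) {p : Program} {t : ℕ} {g : Mem → ℝ≥0∞}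
    (I : ℕ → Mem → ℝ≥0∞) (hexit : ∀ j a, a r = 0 → g a ≤ I j a)
    (hzero : ∀ a, a r ≠ 0 → I 0 a = ⊤)
    (hbody : ∀ j, Tri w M x p t (fun a => if a r = 0 then ⊤ else I (j + 1) a) (I j)) (j : ℕ) :
    Tri w M x (.while r p) (j * (t + 1) + 1) (I j) g := by
  induction j with
  | zero =>
    intro k T F hk a m hm
    by_cases h0 : a r = 0
    · have h0' : m r = 0 := by rw [hm r hr, h0]
      simp only [Nat.zero_mul, val, step, h0', expect_pure]
      simpa using (hk a m hm).trans (hexit 0 a h0)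
    · simp [hzero a h0]
  | succ j ih =>
    intro k T F hk a m hm
    by_cases h0 : a r = 0
    · have h0' : m r = 0 := by rw [hm r hr, h0]
      refine le_trans (val_antitone w M x F _ (show T + 1 ≤ _ by nlinarith)) ?_
      simp only [val, step, h0', expect_pure]
      simpa using (hk a m hm).trans (hexit (j + 1) a h0)
    · have h0' : m r ≠ 0 := by rwa [hm r hr]
      have := hbody j (.while r p :: k) (T + (j * (t + 1) + 1)) F (ih k T F hk) a m hm
      rw [show T + ((j + 1) * (t + 1) + 1) = (T + (j * (t + 1) + 1) + t) + 1 by ring]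
      simp only [val, step, expect_pure, if_pos h0']
      simpa [h0] using this

theorem not_visible_scratch {i : ℕ} (hi : i < 15) : ¬ Visible (i + 1) := by
  unfold Visible; omega

theorem Sim.update_scratch {m a : Mem} (h : Sim m a) {i : ℕ} (hi : i < 15) (v : ℕ) :
    Sim (Function.update m (i + 1) v) a := by
  intro j hj
  have : j ≠ i + 1 := by rintro rfl; exact not_visible_scratch hi hj
  rw [Function.update_of_ne this]
  exact h j hj

theorem write_of_lt {m : Mem} {a v : ℕ} (ha : a < M) (hv : v < 2 ^ w) :
    write w M m a v = Function.update m a v := by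
  rw [write, if_pos ha, Nat.mod_eq_of_lt hv]

theorem Sim.update_visible {m a : Mem} (h : Sim m a) (d v : ℕ) :
    Sim (Function.update m d v) (Function.update a d v) := by
  intro j hj
  by_cases hjd : j = d
  · subst hjd; simp
  · rw [Function.update_of_ne hjd, Function.update_of_ne hjd]
    exact h j hj

end triples

/-! ### A small imperative language -/

/-- Expressions: constants, contents of cells with a fixed address, operations, parameters of the
run, degrees, neighbours behind a port, and contents of cells with a computed address. -/
inductive Ex where
  | lit (k : ℕ)
  | reg (a : ℕ)
  | op (o : BinOp) (e f : Ex)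
  | par (q : Param)
  | deg (e : Ex)
  | nbr (e f : Ex)
  | ld (e : Ex)

namespace Ex

/-- Code that leaves the value of an expression in the cell `i + 1`, and changes only scratch
cells behind it. A cell is copied by adding `0` to it. -/
def code : Ex → ℕ → Program
  | lit k, i => .instr (.const (i + 1) k)
  | reg a, i => .seq (.instr (.const (i + 1) 0)) (.instr (.arith .add (i + 1) a (i + 1)))
  | op o e f, i =>
    .seq (e.code i) (.seq (f.code (i + 1)) (.instr (.arith o (i + 1) (i + 1) (i + 2))))
  | par q, i => .instr (.param (i + 1) q)
  | deg e, i => .seq (e.code i) (.instr (.deg (i + 1) (i + 1)))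
  | nbr e f, i => .seq (e.code i) (.seq (f.code (i + 1)) (.instr (.nbr (i + 1) (i + 1) (i + 2))))
  | ld e, i => .seq (e.code i) (.instr (.load (i + 1) (i + 1)))

/-- The number of steps taken by `code`. -/
def cost : Ex → ℕ
  | lit _ => 1
  | reg _ => 3
  | op _ e f => e.cost + (f.cost + 1 + 1) + 1
  | par _ => 1
  | deg e => e.cost + 1 + 1
  | nbr e f => e.cost + (f.cost + 1 + 1) + 1
  | ld e => e.cost + 1 + 1

/-- The number of scratch cells used by `code`. -/
def depth : Ex → ℕ
  | lit _ => 1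
  | reg _ => 1
  | op _ e f => max e.depth (f.depth + 1)
  | par _ => 1
  | deg e => e.depth
  | nbr e f => max e.depth (f.depth + 1)
  | ld e => e.depth

variable {n : ℕ} (w M : ℕ) (x : USTCON n)

/-- The value of an expression, in unbounded arithmetic. -/
def ev (a : Mem) : Ex → ℕ
  | lit k => k
  | reg r => a r
  | op o e f => o.eval (e.ev a) (f.ev a)
  | par q => q.value w M x
  | deg e => x.degQuery (e.ev a)
  | nbr e f => x.nbrQuery (e.ev a) (f.ev a)
  | ld e => a (e.ev a)

/-- No overflow occurs in the evaluation, and no scratch cell is addressed. -/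
def Safe (a : Mem) : Ex → Prop
  | lit k => k < 2 ^ w
  | reg r => Visible r ∧ a r < 2 ^ w
  | op o e f => e.Safe a ∧ f.Safe a ∧ o.eval (e.ev w M x a) (f.ev w M x a) < 2 ^ w
  | par q => q.value w M x < 2 ^ w
  | deg e => e.Safe a ∧ x.degQuery (e.ev w M x a) < 2 ^ w
  | nbr e f => e.Safe a ∧ f.Safe a ∧ x.nbrQuery (e.ev w M x a) (f.ev w M x a) < 2 ^ w
  | ld e => e.Safe a ∧ Visible (e.ev w M x a) ∧ a (e.ev w M x a) < 2 ^ w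

variable {w M x}

theorem depth_pos (e : Ex) : 0 < e.depth := by
  induction e <;> simp only [depth] <;> omega

/-- After the code of an expression, the memory is the old one with scratch cells beyond `i`
changed and the value of the expression in the cell `i + 1`. -/
theorem val_code (hM : 16 ≤ M) (a : Mem) (e : Ex) (hs : e.Safe w M x a) :
    ∀ (i : ℕ), i + e.depth ≤ 15 → ∀ (k : List Program) (T : ℕ) (F : Mem → ℝ≥0∞) (V : ℝ≥0∞)
      (m : Mem), Sim m a →
      (∀ m', Sim m' a → m' (i + 1) = e.ev w M x a → (∀ j ≤ i, m' j = m j) →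
        val w M x F T (k, m') ≤ V) →
      val w M x F (T + e.cost) (e.code i :: k, m) ≤ V := by
  induction e with
  | lit c =>
    intro i hi k T F V m hm h
    simp only [depth] at hi
    simp only [cost, code, val, step, Instr.exec, expect_map, expect_pure]
    rw [write_of_lt (by omega) hs]
    refine h _ (hm.update_scratch (by omega) _) (by simp [ev]) fun j hj => ?_
    rw [Function.update_of_ne (by omega)]
  | reg r =>
    intro i hi k T F V m hm h
    simp only [depth] at hi
    obtain ⟨hv, hr⟩ := hs
    have hri : r ≠ i + 1 := by rintro rfl; exact not_visible_scratch (by omega) hv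
    simp only [cost, code, val, step, Instr.exec, expect_map, expect_pure]
    rw [write_of_lt (v := 0) (by omega) (by positivity)]
    simp only [Function.update_self, Function.update_of_ne hri, BinOp.eval, add_zero]
    rw [write_of_lt (by omega) (by rwa [hm r hv])]
    refine h _ ((hm.update_scratch (by omega) _).update_scratch (by omega) _)
      (by simp [ev, hm r hv]) fun j hj => ?_
    rw [Function.update_of_ne (by omega), Function.update_of_ne (by omega)]
  | par q =>
    intro i hi k T F V m hm h
    simp only [depth] at hi
    simp only [cost, code, val, step, Instr.exec, expect_map, expect_pure]
    rw [write_of_lt (by omega) hs]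
    refine h _ (hm.update_scratch (by omega) _) (by simp [ev]) fun j hj => ?_
    rw [Function.update_of_ne (by omega)]
  | op o e f ihe ihf =>
    intro i hi k T F V m hm h
    simp only [depth] at hi
    obtain ⟨he, hf, ho⟩ := hs
    rw [show T + (op o e f).cost = (T + (f.cost + 1 + 1) + e.cost) + 1 by simp only [cost]; ring]
    simp only [code, val, step, expect_pure]
    refine ihe he i (by omega) _ _ F V m hm fun m₁ h₁ v₁ p₁ => ?_
    rw [show T + (f.cost + 1 + 1) = (T + 1 + f.cost) + 1 by ring]
    simp only [val, step, expect_pure]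
    refine ihf hf (i + 1) (by omega) _ _ F V m₁ h₁ fun m₂ h₂ v₂ p₂ => ?_
    simp only [val, step, Instr.exec, expect_map, expect_pure]
    rw [p₂ (i + 1) le_rfl, v₁, v₂, write_of_lt (by omega) ho]
    refine h _ (h₂.update_scratch (by omega) _) (by simp [ev]) fun j hj => ?_
    rw [Function.update_of_ne (by omega), p₂ j (by omega), p₁ j hj]
  | nbr e f ihe ihf =>
    intro i hi k T F V m hm h
    simp only [depth] at hi
    obtain ⟨he, hf, ho⟩ := hs
    rw [show T + (nbr e f).cost = (T + (f.cost + 1 + 1) + e.cost) + 1 by simp only [cost]; ring]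
    simp only [code, val, step, expect_pure]
    refine ihe he i (by omega) _ _ F V m hm fun m₁ h₁ v₁ p₁ => ?_
    rw [show T + (f.cost + 1 + 1) = (T + 1 + f.cost) + 1 by ring]
    simp only [val, step, expect_pure]
    refine ihf hf (i + 1) (by omega) _ _ F V m₁ h₁ fun m₂ h₂ v₂ p₂ => ?_
    simp only [val, step, Instr.exec, expect_map, expect_pure]
    rw [p₂ (i + 1) le_rfl, v₁, v₂, write_of_lt (by omega) ho]
    refine h _ (h₂.update_scratch (by omega) _) (by simp [ev]) fun j hj => ?_
    rw [Function.update_of_ne (by omega), p₂ j (by omega), p₁ j hj]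
  | deg e ihe =>
    intro i hi k T F V m hm h
    simp only [depth] at hi
    have hpos := e.depth_pos
    obtain ⟨he, ho⟩ := hs
    rw [show T + (deg e).cost = (T + 1 + e.cost) + 1 by simp only [cost]; ring]
    simp only [code, val, step, expect_pure]
    refine ihe he i (by omega) _ _ F V m hm fun m₁ h₁ v₁ p₁ => ?_
    simp only [val, step, Instr.exec, expect_map, expect_pure]
    rw [v₁, write_of_lt (by omega) ho]
    refine h _ (h₁.update_scratch (by omega) _) (by simp [ev]) fun j hj => ?_
    rw [Function.update_of_ne (by omega), p₁ j hj]
  | ld e ihe =>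
    intro i hi k T F V m hm h
    simp only [depth] at hi
    have hpos := e.depth_pos
    obtain ⟨he, hv, ho⟩ := hs
    rw [show T + (ld e).cost = (T + 1 + e.cost) + 1 by simp only [cost]; ring]
    simp only [code, val, step, expect_pure]
    refine ihe he i (by omega) _ _ F V m hm fun m₁ h₁ v₁ p₁ => ?_
    simp only [val, step, Instr.exec, expect_map, expect_pure]
    rw [v₁, h₁ _ hv, write_of_lt (by omega) ho]
    refine h _ (h₁.update_scratch (by omega) _) (by simp [ev]) fun j hj => ?_
    rw [Function.update_of_ne (by omega), p₁ j hj]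

end Ex

/-- Loop-free commands: no operation, `[d] ← e`, `[e] ← f`, `[d] ←` a random element of
`{0, …, e}`, composition, and case distinction on whether `e` is nonzero. -/
inductive Cmd where
  | nop
  | set (d : ℕ) (e : Ex)
  | put (e f : Ex)
  | rnd (d : ℕ) (e : Ex)
  | seq (c d : Cmd)
  | ite (e : Ex) (c d : Cmd)

namespace Cmd

def code : Cmd → Program
  | nop => .skip
  | set d e => .seq (e.code 0) (.seq (.instr (.const 2 0)) (.instr (.arith .add d 1 2)))
  | put e f => .seq (e.code 0) (.seq (f.code 1) (.instr (.store 1 2)))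
  | rnd d e => .seq (e.code 0) (.instr (.rand d 1))
  | seq c d => .seq c.code d.code
  | ite e c d => .seq (e.code 0) (.ite 1 c.code d.code)

/-- The number of steps taken by `code`, at most. -/
def cost : Cmd → ℕ
  | nop => 1
  | set _ e => e.cost + (1 + 1 + 1) + 1
  | put e f => e.cost + (f.cost + 1 + 1) + 1
  | rnd _ e => e.cost + 1 + 1
  | seq c d => c.cost + d.cost + 1
  | ite e c d => e.cost + (max c.cost d.cost + 1) + 1

variable {n : ℕ} (w M : ℕ) (x : USTCON n)

open Classical in
/-- The weakest pre-expectation of a command: the expectation of `g` of the memory that the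
command leaves, or `⊤` if the command is not safe to execute. -/
noncomputable def wp : Cmd → (Mem → ℝ≥0∞) → Mem → ℝ≥0∞
  | nop, g, a => g a
  | set d e, g, a =>
    if e.depth ≤ 15 ∧ Visible d ∧ d < M ∧ e.Safe w M x a
    then g (Function.update a d (e.ev w M x a)) else ⊤
  | put e f, g, a =>
    if e.depth ≤ 15 ∧ f.depth ≤ 14 ∧ e.Safe w M x a ∧ f.Safe w M x a ∧
      Visible (e.ev w M x a) ∧ e.ev w M x a < M
    then g (Function.update a (e.ev w M x a) (f.ev w M x a)) else ⊤
  | rnd d e, g, a =>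
    if e.depth ≤ 15 ∧ Visible d ∧ d < M ∧ e.Safe w M x a ∧ e.ev w M x a < 2 ^ w
    then (∑ r ∈ Finset.range (e.ev w M x a + 1), g (Function.update a d r)) /
      (e.ev w M x a + 1 : ℕ) else ⊤
  | seq c d, g, a => wp c (wp d g) a
  | ite e c d, g, a =>
    if e.depth ≤ 15 ∧ e.Safe w M x a
    then (if e.ev w M x a ≠ 0 then wp c g a else wp d g a) else ⊤

variable {w M x}

theorem _root_.WordRAM.Ex.ev_lt {e : Ex} {a : Mem} (h : e.Safe w M x a) : e.ev w M x a < 2 ^ w := by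
  cases e <;> simp only [Ex.Safe, Ex.ev] at h ⊢ <;> tauto

theorem tri (hM : 16 ≤ M) (c : Cmd) (g : Mem → ℝ≥0∞) :
    Tri w M x c.code c.cost (c.wp w M x g) g := by
  induction c generalizing g with
  | nop =>
    intro k T F hk a m hm
    simpa only [code, cost, val, step, expect_pure, wp] using hk a m hm
  | set d e =>
    intro k T F hk a m hm
    simp only [wp]
    split_ifs with hs
    swap
    · exact le_top
    obtain ⟨hdep, hv, hd, hs⟩ := hs
    rw [show T + (set d e).cost = (T + (1 + 1 + 1) + e.cost) + 1 by simp only [cost]; ring]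
    simp only [code, val, step, expect_pure]
    refine Ex.val_code hM a e hs 0 (by omega) _ _ F _ m hm fun m₁ h₁ v₁ p₁ => ?_
    simp only [val, step, Instr.exec, expect_map, expect_pure]
    rw [write_of_lt (a := 2) (v := 0) (by omega) (by positivity)]
    simp only [Function.update_self, BinOp.eval, add_zero]
    rw [Function.update_of_ne (by decide), v₁, write_of_lt hd (Ex.ev_lt hs)]
    exact hk _ _ (Sim.update_visible (h₁.update_scratch (i := 1) (by omega) _) _ _)
  | put e f =>
    intro k T F hk a m hm
    simp only [wp]
    split_ifs with hs
    swap
    · exact le_top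
    obtain ⟨hdep, hdf, hs, hf, hv, hd⟩ := hs
    rw [show T + (put e f).cost = (T + (f.cost + 1 + 1) + e.cost) + 1 by simp only [cost]; ring]
    simp only [code, val, step, expect_pure]
    refine Ex.val_code hM a e hs 0 (by omega) _ _ F _ m hm fun m₁ h₁ v₁ p₁ => ?_
    rw [show T + (f.cost + 1 + 1) = (T + 1 + f.cost) + 1 by ring]
    simp only [val, step, expect_pure]
    refine Ex.val_code hM a f hf 1 (by omega) _ _ F _ m₁ h₁ fun m₂ h₂ v₂ p₂ => ?_
    simp only [val, step, Instr.exec, expect_map, expect_pure]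
    simp only [zero_add] at v₁
    rw [p₂ 1 le_rfl, v₁, v₂, write_of_lt hd (Ex.ev_lt hf)]
    exact hk _ _ (Sim.update_visible h₂ _ _)
  | rnd d e =>
    intro k T F hk a m hm
    simp only [wp]
    split_ifs with hs
    swap
    · exact le_top
    obtain ⟨hdep, hv, hd, hs, hlt⟩ := hs
    rw [show T + (rnd d e).cost = (T + 1 + e.cost) + 1 by simp only [cost]; ring]
    simp only [code, val, step, expect_pure]
    refine Ex.val_code hM a e hs 0 (by omega) _ _ F _ m hm fun m₁ h₁ v₁ p₁ => ?_
    simp only [val, step, Instr.exec, expect_map]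
    simp only [zero_add] at v₁
    rw [expect_uniform (m₁ 1) fun r => val w M x F T (k, write w M m₁ d r), v₁]
    gcongr with r hr
    rw [write_of_lt hd (by rw [Finset.mem_range] at hr; omega)]
    exact hk _ _ (Sim.update_visible h₁ _ _)
  | seq c d ihc ihd => exact (ihc _).seq (ihd _)
  | ite e c d ihc ihd =>
    intro k T F hk a m hm
    simp only [wp]
    split_ifs with hs hc
    swap
    · rw [show T + (ite e c d).cost = (T + max c.cost d.cost + 1 + e.cost) + 1 by
        simp only [cost]; ring]
      simp only [code, val, step, expect_pure]
      refine Ex.val_code hM a e hs.2 0 (by omega) _ _ F _ m hm fun m₁ h₁ v₁ p₁ => ?_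
      simp only [zero_add] at v₁
      have : m₁ 1 = 0 := by rw [v₁]; simpa using hc
      simp only [val, step, expect_pure, this]
      exact ((ihd g).mono (le_max_right _ _) (fun _ => le_rfl) fun _ => le_rfl) k T F hk a m₁ h₁
    · rw [show T + (ite e c d).cost = (T + max c.cost d.cost + 1 + e.cost) + 1 by
        simp only [cost]; ring]
      simp only [code, val, step, expect_pure]
      refine Ex.val_code hM a e hs.2 0 (by omega) _ _ F _ m hm fun m₁ h₁ v₁ p₁ => ?_
      simp only [zero_add] at v₁
      have : m₁ 1 ≠ 0 := by rw [v₁]; exact hc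
      simp only [val, step, expect_pure, if_pos this]
      exact ((ihc g).mono (le_max_left _ _) (fun _ => le_rfl) fun _ => le_rfl) k T F hk a m₁ h₁
    · exact le_top

theorem wp_mono (c : Cmd) {g g' : Mem → ℝ≥0∞} (h : ∀ a, g a ≤ g' a) (a : Mem) :
    c.wp w M x g a ≤ c.wp w M x g' a := by
  induction c generalizing g g' a with
  | nop => exact h a
  | set d e => simp only [wp]; split_ifs <;> simp [h]
  | put e f => simp only [wp]; split_ifs <;> simp [h]
  | rnd d e =>
    simp only [wp]
    split_ifs
    · gcongr with r hr
      exact h _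
    · exact le_rfl
  | seq c d ihc ihd => exact ihc (fun a => ihd h a) a
  | ite e c d ihc ihd => simp only [wp]; split_ifs <;> simp [ihc h a, ihd h a]

end Cmd

/-- A loop whose counter `r` decreases in every iteration and starts at most at `N`. -/
theorem Tri.whileCounter {n w M : ℕ} {x : USTCON n} {r : ℕ} (hr : Visible r) {p : Program} {t : ℕ}
    {g : Mem → ℝ≥0∞} (I : Mem → ℝ≥0∞) (hexit : ∀ a, a r = 0 → g a ≤ I a)
    (hbody : ∀ j, Tri w M x p t (fun a => if a r = j + 1 then I a else ⊤)
      (fun a => if a r ≤ j then I a else ⊤)) (N : ℕ) :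
    Tri w M x (.while r p) (N * (t + 1) + 1) (fun a => if a r ≤ N then I a else ⊤) g := by
  refine Tri.while hr (fun j a => if a r ≤ j then I a else ⊤) ?_ ?_ ?_ N
  · intro j a ha
    simpa [ha] using hexit a ha
  · intro a ha
    simp [ha]
  · intro j k T F hk a m hm
    by_cases h0 : a r = 0
    · simp [h0]
    · by_cases hj : a r ≤ j + 1
      · obtain ⟨i, hi⟩ := Nat.exists_eq_succ_of_ne_zero h0
        have := hbody i k T F (fun a m hm => (hk a m hm).trans ?_) a m hm
        · simpa [h0, hi, show i ≤ j by omega] using this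
        · dsimp only
          by_cases h : a r ≤ i
          · rw [if_pos h, if_pos (by omega)]
          · rw [if_neg h]
            exact le_top
      · simp [h0, hj]

end WordRAM

section

open Finset

/-! ### Reversible networks and the Dirichlet problem -/

/-- A finite reversible network: symmetric conductances `c`, and node weights `wt`. The associated
random walk moves from `v` to `u` with probability `c v u / wt v`, and stays at `v` otherwise. -/
structure Network (V : Type*) [Fintype V] where
  c : V → V → ℝ
  wt : V → ℝ
  c_symm : ∀ v u, c v u = c u v
  c_nonneg : ∀ v u, 0 ≤ c v u
  wt_pos : ∀ v, 0 < wt v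
  sum_c_le : ∀ v, ∑ u, c v u ≤ wt v

namespace Network

variable {V : Type*} [Fintype V] (N : Network V)

/-- The expectation of `f` after one step of the walk from `v`. -/
noncomputable def avg (v : V) (f : V → ℝ) : ℝ := f v + (∑ u, N.c v u * (f u - f v)) / N.wt v

theorem avg_add (v : V) (f g : V → ℝ) : N.avg v (f + g) = N.avg v f + N.avg v g := by
  have : ∑ u, N.c v u * ((f + g) u - (f + g) v) =
      ∑ u, N.c v u * (f u - f v) + ∑ u, N.c v u * (g u - g v) := by
    rw [← sum_add_distrib]
    exact sum_congr rfl fun u _ => by simp only [Pi.add_apply]; ring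
  unfold avg
  rw [this]
  simp only [Pi.add_apply]
  ring

theorem avg_smul (v : V) (r : ℝ) (f : V → ℝ) : N.avg v (r • f) = r * N.avg v f := by
  have : ∑ u, N.c v u * ((r • f) u - (r • f) v) = r * ∑ u, N.c v u * (f u - f v) := by
    rw [mul_sum]
    exact sum_congr rfl fun u _ => by simp only [Pi.smul_apply, smul_eq_mul]; ring
  unfold avg
  rw [this]
  simp only [Pi.smul_apply, smul_eq_mul]
  ring

theorem avg_const (v : V) (r : ℝ) : N.avg v (fun _ => r) = r := by simp [avg]

theorem avg_sub (v : V) (f g : V → ℝ) : N.avg v (f - g) = N.avg v f - N.avg v g := by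
  have : f - g = f + (-1 : ℝ) • g := by funext; simp; ring
  rw [this, avg_add, avg_smul]
  ring

theorem avg_sum {ι : Type*} (s : Finset ι) (v : V) (f : ι → V → ℝ) :
    N.avg v (fun u => ∑ i ∈ s, f i u) = ∑ i ∈ s, N.avg v (f i) := by
  classical
  induction s using Finset.induction_on with
  | empty => simp [avg]
  | insert i s hi ih =>
    rw [sum_insert hi, ← ih, ← avg_add]
    congr 1
    funext u
    simp [sum_insert hi]

theorem avg_nonneg (v : V) {f : V → ℝ} (hf : ∀ u, 0 ≤ f u) : 0 ≤ N.avg v f := by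
  have h : ∑ u, N.c v u * (f u - f v) ≥ - (N.wt v * f v) := by
    calc ∑ u, N.c v u * (f u - f v) ≥ ∑ u, -(N.c v u * f v) :=
          sum_le_sum fun u _ => by nlinarith [mul_nonneg (N.c_nonneg v u) (hf u)]
      _ = - ((∑ u, N.c v u) * f v) := by rw [sum_neg_distrib, sum_mul]
      _ ≥ _ := neg_le_neg (mul_le_mul_of_nonneg_right (N.sum_c_le v) (hf v))
  have hw := N.wt_pos v
  have : avg N v f = (N.wt v * f v + ∑ u, N.c v u * (f u - f v)) / N.wt v := by
    unfold avg; field_simp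
  rw [this]
  exact div_nonneg (by linarith) hw.le

theorem avg_mono (v : V) {f g : V → ℝ} (h : ∀ u, f u ≤ g u) : N.avg v f ≤ N.avg v g := by
  have := N.avg_nonneg v (f := g - f) fun u => sub_nonneg.2 (h u)
  rw [avg_sub] at this
  linarith

theorem avg_affine (v : V) (f : V → ℝ) (r c : ℝ) :
    N.avg v (fun u => (r + f u) * c) = (r + N.avg v f) * c := by
  have : (fun u => (r + f u) * c) = c • ((fun _ => r) + f) := by
    funext u
    simp only [Pi.smul_apply, Pi.add_apply, smul_eq_mul]
    ring
  rw [this, N.avg_smul, N.avg_add, N.avg_const, mul_comm]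

/-- The set `bd` of nodes meets every closed class of the walk. -/
def Exits (bd : Finset V) : Prop :=
  ∀ Z : Set V, Z.Nonempty → (∀ v ∈ Z, v ∉ bd) → ∃ v ∈ Z, ∃ u ∉ Z, 0 < N.c v u

open Classical in
/-- The operator of the Dirichlet problem: `f` itself on the boundary, `f - avg f` inside. -/
noncomputable def dirichlet (bd : Finset V) : (V → ℝ) →ₗ[ℝ] V → ℝ where
  toFun f v := if v ∈ bd then f v else f v - N.avg v f
  map_add' f g := by
    funext v
    by_cases hv : v ∈ bd <;> simp only [hv, if_true, if_false, Pi.add_apply, avg_add]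
    ring
  map_smul' r f := by
    funext v
    by_cases hv : v ∈ bd <;>
      simp only [hv, if_true, if_false, Pi.smul_apply, avg_smul, RingHom.id_apply, smul_eq_mul]
    ring

variable {N} {bd : Finset V}

/-- The minimum principle. -/
theorem nonneg_of_dirichlet_nonneg (hbd : N.Exits bd) {f : V → ℝ}
    (h : ∀ v, 0 ≤ N.dirichlet bd f v) (v : V) : 0 ≤ f v := by
  have : Nonempty V := ⟨v⟩
  obtain ⟨z, hz⟩ := Finite.exists_min f
  by_contra! hv
  have hneg : f z < 0 := (hz v).trans_lt hv
  obtain ⟨y, hy, u, hu, hc⟩ := hbd {y | f y = f z} ⟨z, rfl⟩ (by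
    intro y hy hyb
    have := h y
    simp only [dirichlet, LinearMap.coe_mk, AddHom.coe_mk, if_pos hyb] at this
    have hy' : f y = f z := hy
    linarith)
  have hy' : f y = f z := hy
  have hu' : f y < f u := lt_of_le_of_ne (hy' ▸ hz u) fun e => hu (e.symm.trans hy')
  have hnb : y ∉ bd := by
    intro hyb
    have := h y
    simp only [dirichlet, LinearMap.coe_mk, AddHom.coe_mk, if_pos hyb] at this
    linarith
  have h1 := h y
  simp only [dirichlet, LinearMap.coe_mk, AddHom.coe_mk, if_neg hnb, avg] at h1
  have h2 : 0 < (∑ u, N.c y u * (f u - f y)) / N.wt y := by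
    refine div_pos (sum_pos' (fun i _ => ?_) ⟨u, mem_univ _, ?_⟩) (N.wt_pos y)
    · exact mul_nonneg (N.c_nonneg _ _) (by rw [hy']; linarith [hz i])
    · exact mul_pos hc (by linarith)
  linarith

theorem dirichlet_injective (hbd : N.Exits bd) : Function.Injective (N.dirichlet bd) := by
  rw [← LinearMap.ker_eq_bot, LinearMap.ker_eq_bot']
  intro f hf
  have h1 := nonneg_of_dirichlet_nonneg hbd (f := f) fun v => by rw [hf]; rfl
  have h2 := nonneg_of_dirichlet_nonneg hbd (f := -f) fun v => by rw [map_neg, hf]; simp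
  funext v
  have := h1 v
  have := h2 v
  simp only [Pi.neg_apply, Pi.zero_apply] at *
  linarith

theorem exists_dirichlet_eq (hbd : N.Exits bd) (g : V → ℝ) : ∃ f, N.dirichlet bd f = g :=
  LinearMap.surjective_of_injective (dirichlet_injective hbd) g

open Classical in
variable (N bd) in
/-- The solution of the Dirichlet problem with right-hand side `g` (a junk value if the boundary
does not meet every closed class). -/
noncomputable def solve (g : V → ℝ) : V → ℝ :=
  if h : ∃ f, N.dirichlet bd f = g then h.choose else 0

theorem dirichlet_solve (hbd : N.Exits bd) (g : V → ℝ) : N.dirichlet bd (N.solve bd g) = g := by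
  rw [solve, dif_pos (exists_dirichlet_eq hbd g)]
  exact (exists_dirichlet_eq hbd g).choose_spec

theorem solve_apply_of_mem (hbd : N.Exits bd) (g : V → ℝ) {v : V} (hv : v ∈ bd) :
    N.solve bd g v = g v := by
  have := congrFun (dirichlet_solve hbd g) v
  simpa only [dirichlet, LinearMap.coe_mk, AddHom.coe_mk, if_pos hv] using this

theorem solve_sub_avg (hbd : N.Exits bd) (g : V → ℝ) {v : V} (hv : v ∉ bd) :
    N.solve bd g v - N.avg v (N.solve bd g) = g v := by
  have := congrFun (dirichlet_solve hbd g) v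
  simpa only [dirichlet, LinearMap.coe_mk, AddHom.coe_mk, if_neg hv] using this

theorem solve_nonneg (hbd : N.Exits bd) {g : V → ℝ} (hg : ∀ v, 0 ≤ g v) (v : V) :
    0 ≤ N.solve bd g v :=
  nonneg_of_dirichlet_nonneg hbd (fun v => by rw [dirichlet_solve hbd]; exact hg v) v

theorem solve_eq (hbd : N.Exits bd) {g f : V → ℝ} (h : N.dirichlet bd f = g) :
    N.solve bd g = f :=
  dirichlet_injective hbd (by rw [dirichlet_solve hbd, h])

variable (N bd)

open Classical in
/-- The probability that the walk from `v` enters the boundary in `B`. -/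
noncomputable def hit (B : Finset V) : V → ℝ := N.solve bd fun v => if v ∈ B then 1 else 0

open Classical in
/-- The expected time after which the walk from `v` enters the boundary. -/
noncomputable def time : V → ℝ := N.solve bd fun v => if v ∈ bd then 0 else 1

variable {N bd} {B : Finset V}

theorem hit_of_mem (hbd : N.Exits bd) (hB : B ⊆ bd) {v : V} (hv : v ∈ B) : N.hit bd B v = 1 := by
  rw [hit, solve_apply_of_mem hbd _ (hB hv), if_pos hv]

theorem hit_of_notMem (hbd : N.Exits bd) {v : V} (hv : v ∈ bd) (hvB : v ∉ B) :
    N.hit bd B v = 0 := by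
  rw [hit, solve_apply_of_mem hbd _ hv, if_neg hvB]

theorem avg_hit (hbd : N.Exits bd) (hB : B ⊆ bd) {v : V} (hv : v ∉ bd) :
    N.avg v (N.hit bd B) = N.hit bd B v := by
  classical
  have := solve_sub_avg hbd (fun v => if v ∈ B then 1 else 0) hv
  rw [if_neg fun h => hv (hB h)] at this
  unfold hit
  linarith

theorem hit_nonneg (hbd : N.Exits bd) (v : V) : 0 ≤ N.hit bd B v :=
  solve_nonneg hbd (fun v => by split_ifs <;> norm_num) v

theorem hit_le_one (hbd : N.Exits bd) (hB : B ⊆ bd) (v : V) : N.hit bd B v ≤ 1 := by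
  have := nonneg_of_dirichlet_nonneg hbd (f := (fun _ => 1) - N.hit bd B) (fun v => ?_) v
  · simpa using this
  · simp only [dirichlet, LinearMap.coe_mk, AddHom.coe_mk, avg_sub, avg_const, Pi.sub_apply]
    split_ifs with hv
    · by_cases hvB : v ∈ B
      · rw [hit_of_mem hbd hB hvB, sub_self]
      · rw [hit_of_notMem hbd hv hvB, sub_zero]; exact zero_le_one
    · rw [avg_hit hbd hB hv, sub_self]

theorem hit_eq_sum (hbd : N.Exits bd) (hB : B ⊆ bd) (v : V) :
    N.hit bd B v = ∑ b ∈ B, N.hit bd {b} v := by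
  have : N.hit bd B = fun v => ∑ b ∈ B, N.hit bd {b} v := by
    refine solve_eq hbd ?_
    funext v
    simp only [dirichlet, LinearMap.coe_mk, AddHom.coe_mk]
    by_cases hv : v ∈ bd
    · rw [if_pos hv]
      by_cases hvB : v ∈ B
      · rw [if_pos hvB, sum_eq_single v]
        · exact hit_of_mem hbd (by simpa using hv) (mem_singleton_self v)
        · exact fun b _ hb => hit_of_notMem hbd hv (by simpa using hb.symm)
        · exact fun h => absurd hvB h
      · rw [if_neg hvB]
        exact sum_eq_zero fun b hb => hit_of_notMem hbd hv (by
          rw [mem_singleton]; rintro rfl; exact hvB hb)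
    · rw [if_neg hv, if_neg fun h => hv (hB h), avg_sum, ← sum_sub_distrib]
      exact sum_eq_zero fun b hb => by
        rw [avg_hit hbd (by simpa using hB hb) hv, sub_self]
  rw [this]

theorem time_of_mem (hbd : N.Exits bd) {v : V} (hv : v ∈ bd) : N.time bd v = 0 := by
  rw [time, solve_apply_of_mem hbd _ hv, if_pos hv]

theorem avg_time (hbd : N.Exits bd) {v : V} (hv : v ∉ bd) :
    N.avg v (N.time bd) = N.time bd v - 1 := by
  classical
  have := solve_sub_avg hbd (fun v => if v ∈ bd then (0 : ℝ) else 1) hv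
  rw [if_neg hv] at this
  unfold time
  linarith

theorem time_nonneg (hbd : N.Exits bd) (v : V) : 0 ≤ N.time bd v :=
  solve_nonneg hbd (fun v => by split_ifs <;> norm_num) v

theorem avg_hit_nonneg (hbd : N.Exits bd) (B : Finset V) (v : V) : 0 ≤ N.avg v (N.hit bd B) :=
  N.avg_nonneg v fun u => hit_nonneg hbd u

theorem avg_hit_le_one (hbd : N.Exits bd) {B : Finset V} (hB : B ⊆ bd) (v : V) :
    N.avg v (N.hit bd B) ≤ 1 := by
  have := N.avg_mono v (g := fun _ => 1) fun u => hit_le_one hbd hB u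
  rwa [N.avg_const] at this

theorem avg_time_nonneg (hbd : N.Exits bd) (v : V) : 0 ≤ N.avg v (N.time bd) :=
  N.avg_nonneg v fun u => time_nonneg hbd u

/-! ### Reversibility: Green's formula, return times, energy -/

theorem sum_wt_mul_sub_avg (f g : V → ℝ) :
    ∑ v, N.wt v * (g v * (f v - N.avg v f)) = ∑ v, ∑ u, N.c v u * (g v * (f v - f u)) := by
  refine sum_congr rfl fun v _ => ?_
  have hw := (N.wt_pos v).ne'
  have h1 : N.wt v * (g v * (f v - N.avg v f)) = - (g v * ∑ u, N.c v u * (f u - f v)) := by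
    unfold avg; field_simp; ring
  rw [h1, mul_sum, ← sum_neg_distrib]
  exact sum_congr rfl fun u _ => by ring

/-- Green's formula. -/
theorem two_mul_sum_wt (f g : V → ℝ) :
    2 * ∑ v, N.wt v * (g v * (f v - N.avg v f)) =
      ∑ v, ∑ u, N.c v u * ((g v - g u) * (f v - f u)) := by
  have h : ∑ v, ∑ u, N.c v u * (g v * (f v - f u)) = ∑ v, ∑ u, N.c v u * (g u * (f u - f v)) := by
    rw [sum_comm]
    exact sum_congr rfl fun v _ => sum_congr rfl fun u _ => by rw [N.c_symm]
  rw [sum_wt_mul_sub_avg, two_mul]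
  nth_rewrite 2 [h]
  rw [← sum_add_distrib]
  refine sum_congr rfl fun v _ => ?_
  rw [← sum_add_distrib]
  exact sum_congr rfl fun u _ => by ring

theorem sum_wt_sub_avg (f : V → ℝ) : ∑ v, N.wt v * (f v - N.avg v f) = 0 := by
  have := N.two_mul_sum_wt f fun _ => 1
  simpa using this

theorem green_symm (f g : V → ℝ) :
    ∑ v, N.wt v * (g v * (f v - N.avg v f)) = ∑ v, N.wt v * (f v * (g v - N.avg v g)) := by
  have h1 := N.two_mul_sum_wt f g
  have h2 := N.two_mul_sum_wt g f
  have : ∑ v, ∑ u, N.c v u * ((g v - g u) * (f v - f u)) =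
      ∑ v, ∑ u, N.c v u * ((f v - f u) * (g v - g u)) :=
    sum_congr rfl fun v _ => sum_congr rfl fun u _ => by ring
  linarith

/-- Kac's formula: the return times to the boundary, weighted by the node weights, add up to the
total weight. -/
theorem sum_wt_return (hbd : N.Exits bd) :
    ∑ a ∈ bd, N.wt a * (1 + N.avg a (N.time bd)) = ∑ v, N.wt v := by
  classical
  have h := N.sum_wt_sub_avg (N.time bd)
  rw [← sum_add_sum_compl bd] at h
  have h1 : ∑ v ∈ bd, N.wt v * (N.time bd v - N.avg v (N.time bd)) =
      - ∑ v ∈ bd, N.wt v * N.avg v (N.time bd) := by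
    rw [← sum_neg_distrib]
    exact sum_congr rfl fun v hv => by rw [time_of_mem hbd hv]; ring
  have h2 : ∑ v ∈ bdᶜ, N.wt v * (N.time bd v - N.avg v (N.time bd)) = ∑ v ∈ bdᶜ, N.wt v :=
    sum_congr rfl fun v hv => by rw [avg_time hbd (by simpa using hv)]; ring
  rw [h1, h2] at h
  have h3 : ∑ a ∈ bd, N.wt a * (1 + N.avg a (N.time bd)) =
      ∑ a ∈ bd, N.wt a + ∑ a ∈ bd, N.wt a * N.avg a (N.time bd) := by
    rw [← sum_add_distrib]
    exact sum_congr rfl fun v _ => by ring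
  rw [h3, ← sum_add_sum_compl bd N.wt]
  linarith

variable (N bd) in
/-- The conductance between two boundary nodes of the walk observed on the boundary. -/
noncomputable def trace (a b : V) : ℝ := N.wt a * N.avg a (N.hit bd {b})

theorem trace_nonneg (hbd : N.Exits bd) (a b : V) : 0 ≤ N.trace bd a b :=
  mul_nonneg (N.wt_pos a).le (N.avg_nonneg a fun u => hit_nonneg hbd u)

/-- Green's formula for the voltage function of `B` and a function that is harmonic inside: only
the terms at `B` remain. -/
theorem sum_wt_hit (hbd : N.Exits bd) (f : V → ℝ) (hB : B ⊆ bd)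
    (hf : ∀ v ∉ bd, N.avg v f = f v) :
    ∑ v, N.wt v * (N.hit bd B v * (f v - N.avg v f)) = ∑ b ∈ B, N.wt b * (f b - N.avg b f) := by
  classical
  rw [← sum_subset (subset_univ B)]
  · exact sum_congr rfl fun v hv => by rw [hit_of_mem hbd hB hv, one_mul]
  · intro v _ hv
    by_cases hvb : v ∈ bd
    · rw [hit_of_notMem hbd hvb hv]; ring
    · rw [hf v hvb]; ring

/-- The walk observed on the boundary is reversible. -/
theorem trace_symm (hbd : N.Exits bd) {a b : V} (ha : a ∈ bd) (hb : b ∈ bd) :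
    N.trace bd a b = N.trace bd b a := by
  rcases eq_or_ne a b with rfl | hab
  · rfl
  have ha' : {a} ⊆ bd := by simpa using ha
  have hb' : {b} ⊆ bd := by simpa using hb
  have h1 := sum_wt_hit hbd (N.hit bd {b}) ha' fun v hv => avg_hit hbd hb' hv
  have h2 := sum_wt_hit hbd (N.hit bd {a}) hb' fun v hv => avg_hit hbd ha' hv
  rw [green_symm, h2, sum_singleton, sum_singleton,
    hit_of_notMem hbd hb (by simpa using hab.symm), hit_of_notMem hbd ha (by simpa using hab)] at h1
  unfold trace
  linarith

theorem wt_mul_avg_hit (hbd : N.Exits bd) (hB : B ⊆ bd) (a : V) :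
    N.wt a * N.avg a (N.hit bd B) = ∑ b ∈ B, N.trace bd a b := by
  have : N.hit bd B = fun v => ∑ b ∈ B, N.hit bd {b} v := funext (hit_eq_sum hbd hB)
  rw [this, avg_sum, mul_sum]
  rfl

open Classical in
/-- The energy of the voltage function of `B` is the current out of the rest of the boundary. -/
theorem two_mul_sum_wt_avg_hit (hbd : N.Exits bd) (hB : B ⊆ bd) :
    2 * ∑ a ∈ bd \ B, N.wt a * N.avg a (N.hit bd B) =
      ∑ v, ∑ u, N.c v u * (N.hit bd B v - N.hit bd B u) ^ 2 := by
  have h1 := N.two_mul_sum_wt (N.hit bd B) (N.hit bd B)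
  rw [sum_wt_hit hbd _ hB fun v hv => avg_hit hbd hB hv] at h1
  have h2 := N.sum_wt_sub_avg (N.hit bd B)
  rw [← sum_subset (subset_univ bd), ← sum_sdiff hB] at h2
  · have h3 : ∑ v ∈ bd \ B, N.wt v * (N.hit bd B v - N.avg v (N.hit bd B)) =
        - ∑ v ∈ bd \ B, N.wt v * N.avg v (N.hit bd B) := by
      rw [← sum_neg_distrib]
      refine sum_congr rfl fun v hv => ?_
      rw [mem_sdiff] at hv
      rw [hit_of_notMem hbd hv.1 hv.2]; ring
    simp only [sq]
    linarith
  · intro v _ hv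
    rw [avg_hit hbd hB hv]; ring

/-- Thomson's principle for a path: if nodes `p 0` and `p k` are in different parts of the
boundary, then the energy is at least the inverse of the resistance of the path. -/
theorem inv_le_sum_wt_avg_hit [DecidableEq V] (hbd : N.Exits bd) (hB : B ⊆ bd) {k : ℕ} {p : ℕ → V}
    (hinj : Set.InjOn p (Set.Iic k)) (h0 : p 0 ∈ bd \ B) (hk : p k ∈ B)
    (hc : ∀ i < k, 0 < N.c (p i) (p (i + 1))) {ρ : ℝ}
    (hρ : ∑ i ∈ range k, (N.c (p i) (p (i + 1)))⁻¹ ≤ ρ) (hρ0 : 0 < ρ) :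
    ρ⁻¹ ≤ ∑ a ∈ bd \ B, N.wt a * N.avg a (N.hit bd B) := by
  set h := N.hit bd B with hh
  set E := ∑ i ∈ range k, N.c (p i) (p (i + 1)) * (h (p i) - h (p (i + 1))) ^ 2 with hE
  have h1 : (∑ i ∈ range k, (h (p (i + 1)) - h (p i))) = 1 := by
    rw [sum_range_sub (fun i => h (p i)), hh, hit_of_mem hbd hB hk,
      hit_of_notMem hbd (mem_sdiff.1 h0).1 (mem_sdiff.1 h0).2, sub_zero]
  have hE0 : 0 ≤ E := sum_nonneg fun i _ => mul_nonneg (N.c_nonneg _ _) (sq_nonneg _)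
  -- the Cauchy–Schwarz inequality, with resistances and conductances as weights
  have h2 : (∑ i ∈ range k, (h (p (i + 1)) - h (p i))) ^ 2 ≤
      (∑ i ∈ range k, (N.c (p i) (p (i + 1)))⁻¹) * E := by
    refine sum_sq_le_sum_mul_sum_of_sq_le_mul _ (fun i hi => inv_nonneg.2 (N.c_nonneg _ _))
      (fun i _ => mul_nonneg (N.c_nonneg _ _) (sq_nonneg _)) fun i hi => le_of_eq ?_
    have := (hc i (mem_range.1 hi)).ne'
    field_simp
    ring
  -- the path uses every edge at most once, and the double sum counts every edge twice
  have h3 : 2 * E ≤ ∑ v, ∑ u, N.c v u * (h v - h u) ^ 2 := by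
    rw [← sum_product' univ univ fun v u => N.c v u * (h v - h u) ^ 2]
    set s := (range k).image fun i => (p i, p (i + 1)) with hs
    set s' := (range k).image fun i => (p (i + 1), p i) with hs'
    have hd : Disjoint s s' := by
      rw [disjoint_left]
      intro z hz hz'
      rw [hs, mem_image] at hz
      rw [hs', mem_image] at hz'
      obtain ⟨i, hi, rfl⟩ := hz
      obtain ⟨j, hj, hij⟩ := hz'
      rw [mem_range] at hi hj
      have e1 := hinj (Set.mem_Iic.2 (by omega)) (Set.mem_Iic.2 (by omega)) (congrArg Prod.fst hij)
      have e2 := hinj (Set.mem_Iic.2 (by omega)) (Set.mem_Iic.2 (by omega)) (congrArg Prod.snd hij)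
      omega
    have e1 : ∑ z ∈ s, N.c z.1 z.2 * (h z.1 - h z.2) ^ 2 = E := by
      rw [hs, sum_image]
      intro i hi j hj hij
      exact hinj (Set.mem_Iic.2 (mem_range.1 hi).le) (Set.mem_Iic.2 (mem_range.1 hj).le)
        (congrArg Prod.fst hij)
    have e2 : ∑ z ∈ s', N.c z.1 z.2 * (h z.1 - h z.2) ^ 2 = E := by
      rw [hs', sum_image]
      · refine sum_congr rfl fun i _ => ?_
        rw [N.c_symm]; ring
      intro i hi j hj hij
      exact hinj (Set.mem_Iic.2 (mem_range.1 hi).le) (Set.mem_Iic.2 (mem_range.1 hj).le)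
        (congrArg Prod.snd hij)
    calc 2 * E = ∑ z ∈ s ∪ s', N.c z.1 z.2 * (h z.1 - h z.2) ^ 2 := by
          rw [sum_union hd, e1, e2, two_mul]
      _ ≤ _ := sum_le_sum_of_subset_of_nonneg (by intro; simp)
          fun z _ _ => mul_nonneg (N.c_nonneg _ _) (sq_nonneg _)
  have h4 := two_mul_sum_wt_avg_hit hbd hB
  rw [← hh] at h4
  rw [h1, one_pow] at h2
  have h5 : 1 ≤ ρ * E := h2.trans (mul_le_mul_of_nonneg_right hρ hE0)
  rw [inv_le_iff_one_le_mul₀' hρ0]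
  refine h5.trans (mul_le_mul_of_nonneg_left ?_ hρ0.le)
  have : ∑ a ∈ bd \ B, N.wt a * N.avg a h = (∑ v, ∑ u, N.c v u * (h v - h u) ^ 2) / 2 := by
    rw [← h4]
    have : ∀ s : Finset V, (∑ a ∈ s, N.wt a * N.avg a h) = 2 * (∑ a ∈ s, N.wt a * N.avg a h) / 2 :=
      fun s => by ring
    convert this _
  rw [this]
  linarith

end Network

/-! ### Counting cuts -/

section cuts

variable {V : Type*} [DecidableEq V]

/-- The weight of the edges between `A` and the rest of `Λ`. -/
def cutWeight (W : V → V → ℝ) (Λ A : Finset V) : ℝ := ∑ a ∈ A, ∑ b ∈ Λ \ A, W a b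

open Classical in
/-- The nonempty proper subsets of `Λ` that are unions of classes of the colouring `f`. -/
noncomputable def satCuts (Λ : Finset V) (f : V → V) : Finset (Finset V) :=
  {A ∈ Λ.powerset | A.Nonempty ∧ A ≠ Λ ∧ ∀ x ∈ Λ, ∀ y ∈ Λ, f x = f y → (x ∈ A ↔ y ∈ A)}

theorem mem_satCuts {Λ : Finset V} {f : V → V} {A : Finset V} :
    A ∈ satCuts Λ f ↔ A ⊆ Λ ∧ A.Nonempty ∧ A ≠ Λ ∧
      ∀ x ∈ Λ, ∀ y ∈ Λ, f x = f y → (x ∈ A ↔ y ∈ A) := by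
  simp [satCuts]

theorem card_satCuts_le (Λ : Finset V) (f : V → V) :
    (satCuts Λ f).card ≤ 2 ^ (Λ.image f).card := by
  rw [← card_powerset]
  refine card_le_card_of_injOn (fun A => A.image f) ?_ ?_
  · intro A hA
    rw [mem_coe, mem_satCuts] at hA
    exact mem_coe.2 (mem_powerset.2 (image_subset_image hA.1))
  · intro A hA B hB hAB
    rw [mem_coe, mem_satCuts] at hA hB
    have key : ∀ A B : Finset V, A ∈ satCuts Λ f → B ∈ satCuts Λ f → A.image f = B.image f →
        A ⊆ B := by
      intro A B hA hB hAB x hx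
      rw [mem_satCuts] at hA hB
      have : f x ∈ B.image f := hAB ▸ mem_image_of_mem f hx
      obtain ⟨y, hy, hyx⟩ := mem_image.1 this
      exact (hB.2.2.2 y (hB.1 hy) x (hA.1 hx) hyx).1 hy
    exact subset_antisymm (key A B (mem_satCuts.2 hA) (mem_satCuts.2 hB) hAB)
      (key B A (mem_satCuts.2 hB) (mem_satCuts.2 hA) hAB.symm)

variable {W : V → V → ℝ} {Λ : Finset V}

theorem cutWeight_eq_filter (A : Finset V) (hA : A ⊆ Λ) :
    cutWeight W Λ A = ∑ z ∈ Λ ×ˢ Λ, if z.1 ∈ A ∧ z.2 ∉ A then W z.1 z.2 else 0 := by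
  rw [cutWeight, ← sum_product', ← sum_filter]
  refine sum_congr ?_ fun _ _ => rfl
  ext z
  simp only [mem_product, mem_sdiff, mem_filter]
  constructor
  · exact fun h => ⟨⟨hA h.1, h.2.1⟩, h.1, h.2.2⟩
  · exact fun h => ⟨h.2.1, h.1.2, h.2.2⟩

/-- Recolour the class of `y` with the colour of `x`. -/
def mergeColour (f : V → V) (x y : V) (v : V) : V := if f v = f y then f x else f v

theorem card_image_mergeColour (f : V → V) {x y : V} (hx : x ∈ Λ) (hy : y ∈ Λ) (hxy : f x ≠ f y) :
    (Λ.image (mergeColour f x y)).card + 1 = (Λ.image f).card := by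
  have : Λ.image (mergeColour f x y) = (Λ.image f).erase (f y) := by
    ext c
    simp only [mem_image, mem_erase, mergeColour]
    constructor
    · rintro ⟨v, hv, rfl⟩
      split_ifs with h
      · exact ⟨hxy, x, hx, rfl⟩
      · exact ⟨h, v, hv, rfl⟩
    · rintro ⟨hc, v, hv, rfl⟩
      exact ⟨v, hv, if_neg hc⟩
  rw [this, card_erase_of_mem (mem_image_of_mem f hy)]
  have : 0 < (Λ.image f).card := card_pos.2 ⟨_, mem_image_of_mem f hy⟩
  omega

theorem satCuts_mergeColour (f : V → V) {x y : V} (hx : x ∈ Λ) (hy : y ∈ Λ) {A : Finset V} :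
    A ∈ satCuts Λ (mergeColour f x y) ↔ A ∈ satCuts Λ f ∧ (x ∈ A ↔ y ∈ A) := by
  simp only [mem_satCuts]
  constructor
  · rintro ⟨h1, h2, h3, h4⟩
    refine ⟨⟨h1, h2, h3, fun u hu v hv huv => h4 u hu v hv (by simp [mergeColour, huv])⟩, ?_⟩
    exact h4 x hx y hy (by simp [mergeColour])
  · rintro ⟨⟨h1, h2, h3, h4⟩, h5⟩
    refine ⟨h1, h2, h3, fun u hu v hv huv => ?_⟩
    unfold mergeColour at huv
    split_ifs at huv with hu' hv' hv'
    · rw [h4 u hu y hy hu', h4 v hv y hy hv']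
    · rw [h4 u hu y hy hu', ← h5, h4 x hx v hv huv]
    · rw [h4 v hv y hy hv', ← h5, h4 u hu x hx huv]
    · exact h4 u hu v hv huv

/-- If every cut has weight at least `mu`, then the classes of a colouring with several classes are
joined by edges of total weight at least half of the number of classes times `mu`. -/
theorem card_mul_le_sum (f : V → V) {mu : ℝ}
    (hcut : ∀ A ⊆ Λ, A.Nonempty → A ≠ Λ → mu ≤ cutWeight W Λ A) (h2 : 1 < (Λ.image f).card) :
    (Λ.image f).card * mu ≤ ∑ z ∈ Λ ×ˢ Λ, if f z.1 ≠ f z.2 then W z.1 z.2 else 0 := by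
  calc ((Λ.image f).card : ℝ) * mu = ∑ c ∈ Λ.image f, mu := by rw [sum_const, nsmul_eq_mul]
    _ ≤ ∑ c ∈ Λ.image f, cutWeight W Λ {v ∈ Λ | f v = c} := by
      refine sum_le_sum fun c hc => hcut _ (filter_subset _ _) ?_ ?_
      · obtain ⟨v, hv, hvc⟩ := mem_image.1 hc
        exact ⟨v, mem_filter.2 ⟨hv, hvc⟩⟩
      · intro h
        obtain ⟨c', hc', hne⟩ := exists_mem_ne h2 c
        obtain ⟨v, hv, hvc⟩ := mem_image.1 hc'
        rw [← h] at hv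
        exact hne (hvc.symm.trans (mem_filter.1 hv).2)
    _ = ∑ z ∈ Λ ×ˢ Λ, ∑ c ∈ Λ.image f,
          if z.1 ∈ {v ∈ Λ | f v = c} ∧ z.2 ∉ {v ∈ Λ | f v = c} then W z.1 z.2 else 0 := by
      rw [sum_comm]
      exact sum_congr rfl fun c _ => cutWeight_eq_filter _ (filter_subset _ _)
    _ = _ := by
      refine sum_congr rfl fun z hz => ?_
      rw [mem_product] at hz
      rw [sum_eq_single (f z.1)]
      · simp [hz.1, hz.2, eq_comm]
      · intro c _ hc
        rw [if_neg]
        simp [hz.1, hc.symm]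
      · intro h
        exact absurd (mem_image_of_mem f hz.1) h

theorem one_sub_ge_exp {y : ℝ} (h0 : 0 ≤ y) (h : y ≤ 1 / 2) : Real.exp (-(2 * y)) ≤ 1 - y := by
  have h1 : 1 + 2 * y ≤ Real.exp (2 * y) := by linarith [Real.add_one_le_exp (2 * y)]
  rw [Real.exp_neg, inv_le_comm₀ (Real.exp_pos _) (by linarith)]
  refine le_trans ?_ h1
  rw [inv_le_comm₀ (by linarith) (by linarith), inv_le_iff_one_le_mul₀ (by linarith)]
  nlinarith

/-- The sum of `exp (-K * weight)` over all cuts is small as soon as `K` exceeds a logarithmic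
multiple of the inverse of the minimum weight. The induction contracts a random edge: a cut of
small weight is likely to survive, and there are too few cuts overall for the heavy ones to
matter. -/
theorem sum_satCuts_le {mu : ℝ} (hmu : 0 < mu) (hW : ∀ a b, 0 ≤ W a b)
    (hsymm : ∀ a ∈ Λ, ∀ b ∈ Λ, W a b = W b a)
    (hcut : ∀ A ⊆ Λ, A.Nonempty → A ≠ Λ → mu ≤ cutWeight W Λ A) (k : ℕ) :
    ∀ f : V → V, (Λ.image f).card = k + 1 → ∀ K : ℝ, 4 * (3 + harmonic (k + 1)) ≤ K * mu →
      ∑ A ∈ satCuts Λ f, Real.exp (-(K * cutWeight W Λ A)) ≤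
        ∑ i ∈ range k, (2 * Real.exp (-3)) ^ (i + 2) := by
  induction k with
  | zero =>
    intro f hf K _
    have : satCuts Λ f = ∅ := by
      rw [eq_empty_iff_forall_notMem]
      intro A hA
      rw [mem_satCuts] at hA
      obtain ⟨h1, ⟨a, ha⟩, h3, h4⟩ := hA
      refine h3 (subset_antisymm h1 fun x hx => ?_)
      obtain ⟨c, hc⟩ := card_eq_one.1 hf
      have e1 : f x = c := by
        have := mem_image_of_mem f hx
        rwa [hc, mem_singleton] at this
      have e2 : f a = c := by
        have := mem_image_of_mem f (h1 ha)
        rwa [hc, mem_singleton] at this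
      exact (h4 a (h1 ha) x hx (e2.trans e1.symm)).1 ha
    simp [this]
  | succ k ih =>
    intro f hf K hK
    set N : ℝ := ((k + 2 : ℕ) : ℝ) with hN
    have hNpos : 0 < N := by positivity
    set φ := cutWeight W Λ with hφ
    -- the reciprocals of the numbers of classes add up to the harmonic number
    set K' := K - 4 / (N * mu) with hK'
    have hharm : (harmonic (k + 1 + 1) : ℝ) = harmonic (k + 1) + 1 / N := by
      rw [harmonic_succ, hN]; push_cast; ring
    have hKK : 4 * (3 + harmonic (k + 1)) ≤ K' * mu := by
      have : K' * mu = K * mu - 4 * (1 / N) := by rw [hK']; field_simp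
      rw [this]
      rw [hharm] at hK
      linarith
    have hφ0 : ∀ A, 0 ≤ φ A := fun A => sum_nonneg fun a _ => sum_nonneg fun b _ => hW a b
    have hharm0 : (0 : ℝ) ≤ harmonic (k + 1) := by
      exact_mod_cast (harmonic_pos (Nat.succ_ne_zero k)).le
    set D := ∑ z ∈ Λ ×ˢ Λ, if f z.1 ≠ f z.2 then W z.1 z.2 else 0 with hD
    have hDN : N * mu ≤ D := by
      have := card_mul_le_sum f hcut (by omega)
      rwa [hf] at this
    have hDpos : 0 < D := lt_of_lt_of_le (by positivity) hDN
    set β := ∑ i ∈ range k, (2 * Real.exp (-3)) ^ (i + 2) with hβ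
    -- the edges that a cut does not separate; every cut edge is counted twice in `D`
    have hcutsym : ∀ A ∈ satCuts Λ f,
        ∑ z ∈ Λ ×ˢ Λ, (if f z.1 ≠ f z.2 ∧ (z.1 ∈ A ↔ z.2 ∈ A) then W z.1 z.2 else 0) =
          D - 2 * φ A := by
      intro A hA
      rw [mem_satCuts] at hA
      have e1 : φ A = ∑ z ∈ Λ ×ˢ Λ, if z.1 ∈ A ∧ z.2 ∉ A then W z.1 z.2 else 0 :=
        cutWeight_eq_filter A hA.1
      have e2 : φ A = ∑ z ∈ Λ ×ˢ Λ, if z.2 ∈ A ∧ z.1 ∉ A then W z.1 z.2 else 0 := by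
        rw [e1, sum_product, sum_product_right]
        refine sum_congr rfl fun a ha => sum_congr rfl fun b hb => ?_
        rw [hsymm a ha b hb]
      rw [two_mul, sub_add_eq_sub_sub]
      nth_rewrite 1 [e1]
      rw [e2, hD, ← sum_sub_distrib, ← sum_sub_distrib]
      refine sum_congr rfl fun z hz => ?_
      rw [mem_product] at hz
      by_cases hfz : f z.1 = f z.2
      · have := hA.2.2.2 _ hz.1 _ hz.2 hfz
        by_cases h1 : z.1 ∈ A <;> by_cases h2 : z.2 ∈ A <;> simp_all
      · by_cases h1 : z.1 ∈ A <;> by_cases h2 : z.2 ∈ A <;> simp [h1, h2, hfz]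
    -- the average over the edges of the bounds for the contracted graphs
    have havg : ∑ A ∈ satCuts Λ f, Real.exp (-(K' * φ A)) * (D - 2 * φ A) ≤ D * β := by
      calc ∑ A ∈ satCuts Λ f, Real.exp (-(K' * φ A)) * (D - 2 * φ A)
          = ∑ A ∈ satCuts Λ f, ∑ z ∈ Λ ×ˢ Λ, Real.exp (-(K' * φ A)) *
              (if f z.1 ≠ f z.2 ∧ (z.1 ∈ A ↔ z.2 ∈ A) then W z.1 z.2 else 0) :=
            sum_congr rfl fun A hA => by rw [← hcutsym A hA, mul_sum]
        _ = ∑ z ∈ Λ ×ˢ Λ, ∑ A ∈ satCuts Λ f, Real.exp (-(K' * φ A)) *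
              (if f z.1 ≠ f z.2 ∧ (z.1 ∈ A ↔ z.2 ∈ A) then W z.1 z.2 else 0) := sum_comm
        _ ≤ ∑ z ∈ Λ ×ˢ Λ, (if f z.1 ≠ f z.2 then W z.1 z.2 else 0) * β := by
            refine sum_le_sum fun z hz => ?_
            rw [mem_product] at hz
            by_cases hfz : f z.1 = f z.2
            · simp [hfz]
            have h1 := ih (mergeColour f z.1 z.2)
              (by have := card_image_mergeColour f hz.1 hz.2 hfz; omega) K' hKK
            have h2 : ∑ A ∈ satCuts Λ f, Real.exp (-(K' * φ A)) *
                (if f z.1 ≠ f z.2 ∧ (z.1 ∈ A ↔ z.2 ∈ A) then W z.1 z.2 else 0) =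
                W z.1 z.2 * ∑ A ∈ satCuts Λ (mergeColour f z.1 z.2), Real.exp (-(K' * φ A)) := by
              have : satCuts Λ (mergeColour f z.1 z.2) =
                  {A ∈ satCuts Λ f | (z.1 ∈ A ↔ z.2 ∈ A)} := by
                ext A
                rw [mem_filter, satCuts_mergeColour f hz.1 hz.2]
              rw [this, sum_filter, mul_sum]
              refine sum_congr rfl fun A _ => ?_
              by_cases h : z.1 ∈ A ↔ z.2 ∈ A <;> simp [h, hfz]
              ring
            rw [h2, if_pos hfz]
            exact mul_le_mul_of_nonneg_left h1 (hW _ _)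
        _ = D * β := by rw [← sum_mul]
    have hlow : ∀ A ∈ satCuts Λ f, Real.exp (-(K * φ A)) ≤
        Real.exp (-(K' * φ A)) * (D - 2 * φ A) / D + (Real.exp (-3)) ^ (k + 2) := by
      intro A hA
      have hA' := mem_satCuts.1 hA
      have hφA := hcut A hA'.1 hA'.2.1 hA'.2.2.1
      have hpow : (Real.exp (-3)) ^ (k + 2) = Real.exp (-(3 * N)) := by
        rw [← Real.exp_nat_mul]; congr 1; rw [hN]; ring
      -- a light cut survives a random contraction with a good chance; a heavy one is negligible
      by_cases hbig : 4 * φ A ≤ N * mu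
      · have h1 : Real.exp (-(K * φ A)) = Real.exp (-(K' * φ A)) *
            Real.exp (-(2 * (2 * φ A / (N * mu)))) := by
          rw [← Real.exp_add]; congr 1; rw [hK']; ring
        have h2 : Real.exp (-(2 * (2 * φ A / (N * mu)))) ≤ 1 - 2 * φ A / (N * mu) := by
          refine one_sub_ge_exp (div_nonneg (by linarith [hφ0 A]) (by positivity)) ?_
          rw [div_le_iff₀ (by positivity)]
          linarith
        have h3 : 1 - 2 * φ A / (N * mu) ≤ (D - 2 * φ A) / D := by
          rw [sub_div, div_self hDpos.ne']
          have := div_le_div_of_nonneg_left (show 0 ≤ 2 * φ A by linarith [hφ0 A])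
            (by positivity) hDN
          linarith
        refine (h1.le.trans
          (mul_le_mul_of_nonneg_left (h2.trans h3) (Real.exp_pos (-(K' * φ A))).le)).trans ?_
        rw [← mul_div_assoc]
        exact le_add_of_nonneg_right (pow_pos (Real.exp_pos (-3)) (k + 2)).le
      · push Not at hbig
        have hD2 : 0 ≤ D - 2 * φ A := by
          rw [← hcutsym A hA]
          refine sum_nonneg fun z _ => ?_
          split_ifs
          exacts [hW _ _, le_rfl]
        have h1 : Real.exp (-(K * φ A)) ≤ (Real.exp (-3)) ^ (k + 2) := by
          rw [hpow]
          apply Real.exp_le_exp.2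
          have hK12 : 12 ≤ K * mu := by
            have : 0 ≤ 1 / N := by positivity
            rw [hharm] at hK
            linarith
          have hKpos : 0 < K := by
            by_contra! h
            have := mul_nonpos_of_nonpos_of_nonneg h hmu.le
            linarith
          have : K * (N * mu) ≤ K * (4 * φ A) := mul_le_mul_of_nonneg_left hbig.le hKpos.le
          nlinarith
        have : 0 ≤ Real.exp (-(K' * φ A)) * (D - 2 * φ A) / D :=
          div_nonneg (mul_nonneg (Real.exp_pos _).le hD2) hDpos.le
        linarith
    calc ∑ A ∈ satCuts Λ f, Real.exp (-(K * φ A))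
        ≤ ∑ A ∈ satCuts Λ f, (Real.exp (-(K' * φ A)) * (D - 2 * φ A) / D +
            (Real.exp (-3)) ^ (k + 2)) := sum_le_sum hlow
      _ = (∑ A ∈ satCuts Λ f, Real.exp (-(K' * φ A)) * (D - 2 * φ A)) / D +
            (satCuts Λ f).card * (Real.exp (-3)) ^ (k + 2) := by
          rw [sum_add_distrib, sum_const, nsmul_eq_mul, sum_div]
      _ ≤ β + 2 ^ (k + 2) * (Real.exp (-3)) ^ (k + 2) := by
          gcongr
          · rw [div_le_iff₀ hDpos]; linarith
          · have := card_satCuts_le Λ f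
            rw [hf] at this
            exact_mod_cast this
      _ = _ := by rw [sum_range_succ, ← mul_pow]

/-- A network in which every cut has weight at least `mu` has few light cuts: the terms
`exp (-K * weight)` add up to at most `1 / 8`. -/
theorem sum_cuts_le {mu : ℝ} (hmu : 0 < mu) (hW : ∀ a b, 0 ≤ W a b)
    (hsymm : ∀ a ∈ Λ, ∀ b ∈ Λ, W a b = W b a)
    (hcut : ∀ A ⊆ Λ, A.Nonempty → A ≠ Λ → mu ≤ cutWeight W Λ A) {l : ℕ} (hl : 2 ≤ l)
    (hΛ : Λ.card ≤ 2 ^ l) {K : ℝ} (hK : 12 * l ≤ K * mu) (𝒜 : Finset (Finset V))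
    (h𝒜 : ∀ A ∈ 𝒜, A ⊆ Λ ∧ A.Nonempty ∧ A ≠ Λ) :
    ∑ A ∈ 𝒜, Real.exp (-(K * cutWeight W Λ A)) ≤ 1 / 8 := by
  have hsub : 𝒜 ⊆ satCuts Λ id := fun A hA => by
    obtain ⟨h1, h2, h3⟩ := h𝒜 A hA
    exact mem_satCuts.2 ⟨h1, h2, h3, fun x _ y _ hxy => by rw [show x = y from hxy]⟩
  refine (sum_le_sum_of_subset_of_nonneg hsub fun _ _ _ => (Real.exp_pos _).le).trans ?_
  rcases Nat.eq_zero_or_pos Λ.card with h0 | hpos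
  · have : satCuts Λ id = ∅ := by
      rw [eq_empty_iff_forall_notMem]
      intro A hA
      rw [mem_satCuts] at hA
      rw [card_eq_zero.1 h0, subset_empty] at hA
      exact hA.2.1.ne_empty hA.1
    rw [this, sum_empty]
    norm_num
  obtain ⟨k, hk⟩ := Nat.exists_eq_succ_of_ne_zero hpos.ne'
  have hlog : Real.log (k + 1 : ℕ) ≤ l := by
    have h1 : Real.log (k + 1 : ℕ) ≤ Real.log ((2 : ℝ) ^ l) := by
      apply Real.log_le_log (by positivity)
      rw [hk] at hΛ
      exact_mod_cast hΛ
    rw [Real.log_pow] at h1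
    have := Real.log_two_lt_d9
    have : (l : ℝ) * Real.log 2 ≤ l * 1 := by gcongr; linarith
    linarith
  have hharm := harmonic_le_one_add_log (k + 1)
  have hl' : (2 : ℝ) ≤ l := by exact_mod_cast hl
  refine (sum_satCuts_le hmu hW hsymm hcut k id (by rw [image_id, hk]) K (by linarith)).trans ?_
  set r := 2 * Real.exp (-3) with hr
  have hr0 : 0 ≤ r := by positivity
  have hr1 : r ≤ 1 / 4 := by
    have : (8 : ℝ) ≤ Real.exp 3 := by
      have h1 : (2 : ℝ) ≤ Real.exp 1 := by linarith [Real.add_one_le_exp (1 : ℝ)]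
      have h2 : Real.exp 3 = Real.exp 1 ^ 3 := by rw [← Real.exp_nat_mul]; norm_num
      rw [h2]
      calc (8 : ℝ) = 2 ^ 3 := by norm_num
        _ ≤ _ := by gcongr
    rw [hr, Real.exp_neg]
    have : (Real.exp 3)⁻¹ ≤ 8⁻¹ := inv_anti₀ (by norm_num) this
    linarith
  have hgeom : ∑ i ∈ range k, r ^ i ≤ (1 - r)⁻¹ := by
    have := sum_geometric_two_le k
    have h2 := geom_sum_eq (show r ≠ 1 by linarith) k
    rw [h2, ← neg_div_neg_eq, neg_sub, neg_sub, inv_eq_one_div]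
    gcongr
    · linarith
    · linarith [pow_nonneg hr0 k]
  calc ∑ i ∈ range k, r ^ (i + 2) = r ^ 2 * ∑ i ∈ range k, r ^ i := by
        rw [mul_sum]; exact sum_congr rfl fun i _ => by ring
    _ ≤ (1 / 4) ^ 2 * (1 - 1 / 4)⁻¹ := by
        refine mul_le_mul (by gcongr) (hgeom.trans ?_) (sum_nonneg fun i _ => by positivity)
          (by norm_num)
        exact inv_anti₀ (by norm_num) (by linarith)
    _ ≤ 1 / 8 := by norm_num

end cuts

/-! ### The Metropolis network of a graph -/

namespace SimpleGraph

variable {V : Type*}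

/-- A shortest path meets every neighbourhood in at most three nodes. -/
theorem card_adj_le_three (G : SimpleGraph V) {k : ℕ} {p : ℕ → V}
    (hdist : ∀ i j, i ≤ j → j ≤ k → G.dist (p i) (p j) = j - i) (u : V) (s : Finset ℕ)
    (hs : ∀ i ∈ s, i ≤ k ∧ G.Adj (p i) u) : #s ≤ 3 := by
  rcases s.eq_empty_or_nonempty with rfl | hne
  · simp
  have hsub : s ⊆ Finset.Icc (s.min' hne) (s.min' hne + 2) := by
    intro i hi
    have h1 := s.min'_le i hi
    have h2 := hs _ (s.min'_mem hne)
    have h3 := hs i hi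
    have h4 := hdist _ _ h1 h3.1
    have h5 : G.dist (p (s.min' hne)) (p i) ≤ 2 := by
      have := dist_le (Walk.cons h2.2 (Walk.cons h3.2.symm Walk.nil))
      simpa using this
    rw [Finset.mem_Icc]
    omega
  have := card_le_card hsub
  rw [Nat.card_Icc] at this
  omega

variable [Fintype V]

open Classical in
/-- The nodes at distance at most `j` from `v`; nodes of other components have distance `0` in
Mathlib and are excluded. -/
noncomputable def distBall (G : SimpleGraph V) (v : V) (j : ℕ) : Finset V :=
  {u | G.Reachable v u ∧ G.dist v u ≤ j}

theorem mem_distBall (G : SimpleGraph V) {v u : V} {j : ℕ} :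
    u ∈ G.distBall v j ↔ G.Reachable v u ∧ G.dist v u ≤ j := by
  simp [distBall]

variable (G : SimpleGraph V) [DecidableRel G.Adj] (d : ℕ)

/-- The degree, cut off at `d`. -/
def cutDeg (v : V) : ℕ := min d (G.degree v)

theorem cutDeg_pos_of_adj (hd : 0 < d) {v u : V} (h : G.Adj v u) : 0 < G.cutDeg d v :=
  lt_min hd ((G.degree_pos_iff_exists_adj v).2 ⟨u, h⟩)

/-- The conductance of the edge from `v` to `u` is the inverse of the larger one of the two
degrees, cut off at `d`. -/
noncomputable def cond (v u : V) : ℝ :=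
  if G.Adj v u then ((max (G.cutDeg d v) (G.cutDeg d u) : ℕ) : ℝ)⁻¹ else 0

theorem sum_cond_le (hd : 0 < d) (v : V) :
    ∑ u, G.cond d v u ≤ max 1 ((G.degree v : ℝ) / d) := by
  by_cases hv : G.degree v = 0
  · refine le_trans (le_of_eq (sum_eq_zero fun u _ => ?_)) (zero_le_one.trans (le_max_left _ _))
    rw [cond, if_neg]
    intro h
    have := (G.degree_pos_iff_exists_adj v).2 ⟨u, h⟩
    omega
  have hpos : 0 < G.cutDeg d v := lt_min hd (Nat.pos_of_ne_zero hv)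
  have h1 : ∀ u, G.cond d v u ≤ if G.Adj v u then ((G.cutDeg d v : ℕ) : ℝ)⁻¹ else 0 := by
    intro u
    unfold cond
    split_ifs
    · apply inv_anti₀ (by exact_mod_cast hpos)
      exact_mod_cast le_max_left _ _
    · exact le_rfl
  refine (sum_le_sum fun u _ => h1 u).trans ?_
  rw [← sum_filter, sum_const, nsmul_eq_mul]
  have h2 : (#{u | G.Adj v u} : ℕ) = G.degree v := by
    rw [← G.card_neighborFinset_eq_degree]
    congr 1
    ext u
    simp
  rw [h2]
  unfold cutDeg at *
  rcases le_total d (G.degree v) with h | h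
  · rw [min_eq_left h, ← div_eq_mul_inv]
    exact le_max_right _ _
  · rw [min_eq_right h, mul_inv_cancel₀ (by exact_mod_cast hv)]
    exact le_max_left _ _

/-- The network of the Metropolis walk on a graph: every node of degree at most `d` has weight
`1`, and larger degrees count in proportion to `d`. -/
noncomputable def metropolis (hd : 0 < d) : Network V where
  c := G.cond d
  wt v := max 1 ((G.degree v : ℝ) / d)
  c_symm v u := by simp only [cond, G.adj_comm v u, max_comm]
  c_nonneg v u := by unfold cond; split_ifs <;> positivity
  wt_pos v := lt_of_lt_of_le one_pos (le_max_left _ _)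
  sum_c_le := G.sum_cond_le d hd

theorem cond_pos_iff (hd : 0 < d) (v u : V) : 0 < (G.metropolis d hd).c v u ↔ G.Adj v u := by
  change 0 < G.cond d v u ↔ _
  unfold cond
  split_ifs with h
  · simp only [inv_pos, Nat.cast_pos, h, iff_true]
    exact lt_max_of_lt_left (G.cutDeg_pos_of_adj d hd h)
  · simp [h]

theorem sum_wt_metropolis_le (hd : 0 < d) (h : 2 * #G.edgeFinset ≤ d * Fintype.card V) :
    ∑ v, (G.metropolis d hd).wt v ≤ 2 * Fintype.card V := by
  have hd' : (0 : ℝ) < d := by exact_mod_cast hd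
  calc ∑ v, (G.metropolis d hd).wt v ≤ ∑ v, (1 + (G.degree v : ℝ) / d) :=
        sum_le_sum fun v _ => max_le (le_add_of_nonneg_right (by positivity))
          (le_add_of_nonneg_left zero_le_one)
    _ = Fintype.card V + (∑ v, G.degree v : ℕ) / d := by
        rw [sum_add_distrib, ← sum_div]; simp
    _ ≤ Fintype.card V + Fintype.card V := by
        gcongr
        rw [G.sum_degrees_eq_twice_card_edges, div_le_iff₀ hd']
        rw [mul_comm d] at h
        exact_mod_cast h
    _ = _ := by ring

theorem exits_metropolis (hd : 0 < d) {bd : Finset V}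
    (h : ∀ v, ∃ b ∈ bd, G.Reachable v b) : (G.metropolis d hd).Exits bd := by
  rintro Z ⟨v, hv⟩ hZ
  by_contra! hcon
  obtain ⟨b, hb, ⟨p⟩⟩ := h v
  have key : ∀ {x y : V}, G.Walk x y → x ∈ Z → y ∈ Z := by
    intro x y p
    induction p with
    | nil => exact id
    | cons hadj _ ih =>
      intro hx
      refine ih ?_
      by_contra hy
      exact absurd ((G.cond_pos_iff d hd _ _).2 hadj) (not_lt.2 (hcon _ hx _ hy))
  exact hZ b (key p hv) hb

/-! ### Short paths between classes of landmarks -/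

/-- The degrees along a piece of a shortest path whose neighbourhoods lie in a set `B` add up to
at most `3 * #B`. -/
theorem sum_degree_le {k : ℕ} {p : ℕ → V}
    (hdist : ∀ i j, i ≤ j → j ≤ k → G.dist (p i) (p j) = j - i) (s : Finset ℕ)
    (hs : ∀ i ∈ s, i ≤ k) (B : Finset V) (hB : ∀ i ∈ s, ∀ u, G.Adj (p i) u → u ∈ B) :
    ∑ i ∈ s, G.degree (p i) ≤ 3 * #B := by
  calc ∑ i ∈ s, G.degree (p i) = ∑ i ∈ s, ∑ u ∈ B, if G.Adj (p i) u then 1 else 0 := by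
        refine sum_congr rfl fun i hi => ?_
        rw [← G.card_neighborFinset_eq_degree, ← card_filter]
        congr 1
        ext u
        simp only [mem_neighborFinset, mem_filter]
        exact ⟨fun h => ⟨hB i hi u h, h⟩, fun h => h.2⟩
    _ = ∑ u ∈ B, #{i ∈ s | G.Adj (p i) u} := by
        rw [sum_comm]
        exact sum_congr rfl fun u _ => (card_filter _ _).symm
    _ ≤ ∑ u ∈ B, 3 := sum_le_sum fun u _ => G.card_adj_le_three hdist u _ fun i hi => by
        rw [mem_filter] at hi
        exact ⟨hs i hi.1, hi.2⟩
    _ = _ := by rw [sum_const, smul_eq_mul, mul_comm]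

/-- Let `A` and `B` be nonempty parts of a set of landmarks that meets every ball of at least `r`
nodes. Two closest nodes of `A` and `B` are joined by a path of resistance `O(r + d)`: the ball
about the midpoint of a shortest path contains no landmarks, hence has fewer than `r` nodes, and it
contains the neighbourhoods of all but five nodes of the path. -/
theorem exists_path_of_balls (hd : 0 < d) {A B : Finset V} (hA : A.Nonempty) (hB : B.Nonempty)
    (hreach : ∀ a ∈ A, ∀ b ∈ B, G.Reachable a b) {r : ℕ}
    (hball : ∀ v j, j < Fintype.card V → (∃ a ∈ A, G.Reachable v a) → r ≤ #(G.distBall v j) →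
      ∃ u ∈ G.distBall v j, u ∈ A ∨ u ∈ B) :
    ∃ (k : ℕ) (p : ℕ → V), Set.InjOn p (Set.Iic k) ∧ p 0 ∈ A ∧ p k ∈ B ∧
      (∀ i < k, 0 < (G.metropolis d hd).c (p i) (p (i + 1))) ∧
      ∑ i ∈ range k, ((G.metropolis d hd).c (p i) (p (i + 1)))⁻¹ ≤ 6 * r + 10 * d := by
  obtain ⟨⟨a, b⟩, hab, hmin⟩ := exists_min_image (A ×ˢ B) (fun z => G.dist z.1 z.2)
    (hA.product hB)
  rw [mem_product] at hab
  obtain ⟨P, hP, hPk⟩ := (hreach a hab.1 b hab.2).exists_path_of_dist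
  set k := P.length with hk
  set p : ℕ → V := P.getVert with hp
  have hpa : p 0 = a := P.getVert_zero
  have hpb : p k = b := P.getVert_length
  have hadj : ∀ i < k, G.Adj (p i) (p (i + 1)) := fun i hi => P.adj_getVert_succ hi
  have hup : ∀ i j, i ≤ j → j ≤ k → G.Reachable (p i) (p j) ∧ G.dist (p i) (p j) ≤ j - i := by
    intro i j hij
    induction j, hij using Nat.le_induction with
    | base => intro _; simp
    | succ j hij ih =>
      intro hj
      obtain ⟨h1, h2⟩ := ih (by omega)
      have h3 := hadj j (by omega)
      refine ⟨h1.trans h3.reachable, ?_⟩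
      obtain ⟨q, hq⟩ := h1.exists_walk_length_eq_dist
      have := dist_le (q.concat h3)
      rw [Walk.length_concat] at this
      omega
  have tri : ∀ {x y z : V}, G.Reachable x y → G.Reachable y z →
      G.dist x z ≤ G.dist x y + G.dist y z := by
    intro x y z h1 h2
    obtain ⟨q, hq⟩ := h1.exists_walk_length_eq_dist
    obtain ⟨q', hq'⟩ := h2.exists_walk_length_eq_dist
    have := dist_le (q.append q')
    rw [Walk.length_append] at this
    omega
  have hdist : ∀ i j, i ≤ j → j ≤ k → G.dist (p i) (p j) = j - i := by
    intro i j hij hj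
    obtain ⟨r1, h1⟩ := hup 0 i (by omega) (by omega)
    obtain ⟨r2, h2⟩ := hup i j hij hj
    obtain ⟨r3, h3⟩ := hup j k hj le_rfl
    have h4 := tri r1 (r2.trans r3)
    have h5 := tri r2 r3
    rw [hpa, hpb, ← hPk] at h4
    rw [hpa] at h1
    rw [hpb] at h5 h3
    omega
  have hinj : Set.InjOn p (Set.Iic k) := by
    have key : ∀ i j, i ≤ j → j ≤ k → p i = p j → i = j := by
      intro i j hij hj h
      have := hdist i j hij hj
      rw [h, dist_self] at this
      omega
    intro i hi j hj hij
    rcases le_total i j with h | h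
    · exact key i j h hj hij
    · exact (key j i h hi hij.symm).symm
  have hkcard : k < Fintype.card V := hP.length_lt
  refine ⟨k, p, hinj, hpa ▸ hab.1, hpb ▸ hab.2,
    fun i hi => (G.cond_pos_iff d hd _ _).2 (hadj i hi), ?_⟩
  have hc : ∀ i < k, ((G.metropolis d hd).c (p i) (p (i + 1)))⁻¹ ≤
      ((G.cutDeg d (p i) + G.cutDeg d (p (i + 1)) : ℕ) : ℝ) := by
    intro i hi
    change (G.cond d (p i) (p (i + 1)))⁻¹ ≤ _
    rw [cond, if_pos (hadj i hi), inv_inv]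
    exact_mod_cast max_le (Nat.le_add_right _ _) (Nat.le_add_left _ _)
  -- the nodes of the path near its midpoint `p (k / 2)`
  set s : Finset ℕ := {i ∈ range (k + 1) | 2 ≤ i ∧ i + 3 ≤ k} with hs
  have hgood : ∑ i ∈ s, G.degree (p i) ≤ 3 * r := by
    rcases s.eq_empty_or_nonempty with he | ⟨i0, hi0⟩
    · simp [he]
    have hk5 : 5 ≤ k := by
      rw [hs, mem_filter] at hi0
      omega
    obtain ⟨c, hcdef⟩ : ∃ c, p (k / 2) = c := ⟨_, rfl⟩
    set j := k / 2 - 1 with hj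
    have hac := hup 0 (k / 2) (by omega) (by omega)
    have hcb := hup (k / 2) k (by omega) (by omega)
    rw [hpa, hcdef] at hac
    rw [hpb, hcdef] at hcb
    -- a landmark in this ball would be closer to `a` or `b` than these are to each other
    have hsmall : #(G.distBall c j) < r := by
      by_contra! hbig
      obtain ⟨u, hu, huAB⟩ := hball c j (by omega) ⟨a, hab.1, hac.1.symm⟩ hbig
      rw [mem_distBall] at hu
      rcases huAB with huA | huB
      · have h1 := hmin (u, b) (mem_product.2 ⟨huA, hab.2⟩)
        have h2 := tri hu.1.symm hcb.1
        rw [dist_comm] at hu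
        dsimp only at h1
        rw [← hPk] at h1
        omega
      · have h1 := hmin (a, u) (mem_product.2 ⟨hab.1, huB⟩)
        have h2 := tri hac.1 hu.1
        dsimp only at h1
        rw [← hPk] at h1
        omega
    refine (G.sum_degree_le hdist s (fun i hi => ?_) (G.distBall c j) fun i hi u hu => ?_).trans
      (by omega)
    · rw [hs, mem_filter, Finset.mem_range] at hi
      omega
    · rw [hs, mem_filter, Finset.mem_range] at hi
      have hci : G.Reachable c (p i) ∧ G.dist c (p i) ≤ j - 1 := by
        rcases le_total i (k / 2) with h | h
        · have := hup i (k / 2) h (by omega)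
          rw [hcdef] at this
          refine ⟨this.1.symm, ?_⟩
          rw [dist_comm]
          omega
        · have := hup (k / 2) i h (by omega)
          rw [hcdef] at this
          exact ⟨this.1, by omega⟩
      rw [mem_distBall]
      refine ⟨hci.1.trans hu.reachable, ?_⟩
      have h1 := tri hci.1 hu.reachable
      have h2 : G.dist (p i) u ≤ 1 := by
        have := dist_le (Walk.cons hu Walk.nil)
        simpa using this
      omega
  have hall : ∑ i ∈ range (k + 1), G.cutDeg d (p i) ≤ 3 * r + 5 * d := by
    rw [← sum_filter_add_sum_filter_not (range (k + 1)) (fun i => 2 ≤ i ∧ i + 3 ≤ k)]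
    refine add_le_add ((sum_le_sum fun i _ => min_le_right _ _).trans hgood) ?_
    refine (sum_le_card_nsmul _ _ d fun i _ => min_le_left _ _).trans ?_
    rw [smul_eq_mul]
    refine Nat.mul_le_mul_right d ?_
    have hsub : ({i ∈ range (k + 1) | ¬ (2 ≤ i ∧ i + 3 ≤ k)} : Finset ℕ) ⊆
        range 2 ∪ Finset.Icc (k - 2) k := by
      intro i hi
      rw [mem_filter, Finset.mem_range] at hi
      rw [mem_union, Finset.mem_range, Finset.mem_Icc]
      omega
    refine (card_le_card hsub).trans ((card_union_le _ _).trans ?_)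
    rw [card_range, Nat.card_Icc]
    omega
  calc ∑ i ∈ range k, ((G.metropolis d hd).c (p i) (p (i + 1)))⁻¹
      ≤ ∑ i ∈ range k, ((G.cutDeg d (p i) + G.cutDeg d (p (i + 1)) : ℕ) : ℝ) :=
        sum_le_sum fun i hi => hc i (mem_range.1 hi)
    _ = ((∑ i ∈ range k, G.cutDeg d (p i) + ∑ i ∈ range k, G.cutDeg d (p (i + 1)) : ℕ) : ℝ) := by
        rw [← sum_add_distrib, Nat.cast_sum]
    _ ≤ ((2 * (3 * r + 5 * d) : ℕ) : ℝ) := by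
        have h1 := sum_range_succ (fun i => G.cutDeg d (p i)) k
        have h2 := sum_range_succ' (fun i => G.cutDeg d (p i)) k
        exact_mod_cast (by omega)
    _ = 6 * r + 10 * d := by push_cast; ring

end SimpleGraph

/-! ### The search process and its potential -/

/-- A state of the search: the walk is at `cur`, on one of `rem` remaining excursions from the
landmark `src`; the landmarks in `seen` have been reached, and those in `idle` have not yet been
started from. -/
structure Search (V : Type*) where
  cur : V
  src : V
  rem : ℕ
  seen : Finset V
  idle : Finset V

namespace Search

variable {V : Type*} [DecidableEq V]

/-- Sets of landmarks that may still remain unseen although they contain `t`. -/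
def avoided (Λ : Finset V) (t : V) (seen : Finset V) : Finset (Finset V) :=
  {B ∈ Λ.powerset | t ∈ B ∧ Disjoint B seen}

theorem mem_avoided {Λ : Finset V} {t : V} {seen B : Finset V} :
    B ∈ avoided Λ t seen ↔ B ⊆ Λ ∧ t ∈ B ∧ Disjoint B seen := by
  simp [avoided]

theorem avoided_anti {Λ : Finset V} {t : V} {S T : Finset V} (h : S ⊆ T) :
    avoided Λ t T ⊆ avoided Λ t S := fun B hB => by
  rw [mem_avoided] at hB ⊢
  exact ⟨hB.1, hB.2.1, hB.2.2.mono_right h⟩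

variable [Fintype V] (N : Network V) (bd Λ : Finset V) (t : V) (K : V → ℕ) (T : ℕ)

/-- The probability that all excursions that are still to be started avoid `B`. -/
noncomputable def idleFactor (B idle : Finset V) : ℝ :=
  ∏ a ∈ idle \ B, (1 - N.avg a (N.hit bd B)) ^ K a

/-- The probability that all excursions after the present one avoid `B`. -/
noncomputable def restFactor (B : Finset V) (σ : Search V) : ℝ :=
  (1 - N.avg σ.src (N.hit bd B)) ^ (σ.rem - 1) * idleFactor N bd K B σ.idle

/-- The expected duration of all excursions after the present one. -/
noncomputable def restTime (σ : Search V) : ℝ :=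
  (σ.rem - 1 : ℕ) * (1 + N.avg σ.src (N.time bd)) +
    ∑ a ∈ σ.idle, K a * (1 + N.avg a (N.time bd))

/-- A bound for the probability that the search fails from the state `σ`, when `e` of `T` steps
have been made: the expected number of closed sets of landmarks that miss `t` and the union bound
over them, and Markov's inequality for the total time. -/
noncomputable def pot (σ : Search V) (e : ℕ) : ℝ :=
  ∑ B ∈ avoided Λ t σ.seen, (1 - N.avg σ.cur (N.hit bd B)) * restFactor N bd K B σ +
    (1 + N.avg σ.cur (N.time bd) + restTime N bd K σ + e) / T

/-- The same bound after the walk has moved to `u`, and before this move is taken into account. -/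
noncomputable def potAt (σ : Search V) (u : V) (e : ℕ) : ℝ :=
  ∑ B ∈ avoided Λ t σ.seen, (1 - N.hit bd B u) * restFactor N bd K B σ +
    (1 + N.time bd u + restTime N bd K σ + e) / T

theorem avg_potAt (σ : Search V) (e : ℕ) :
    N.avg σ.cur (fun u => potAt N bd Λ t K T σ u e) = pot N bd Λ t K T σ e := by
  have h1 : (fun u => potAt N bd Λ t K T σ u e) =
      (fun u => ∑ B ∈ avoided Λ t σ.seen, (1 + (-1 : ℝ) • N.hit bd B u) * restFactor N bd K B σ) +
      fun u => ((1 + restTime N bd K σ + e) + N.time bd u) * (T : ℝ)⁻¹ := by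
    funext u
    simp only [potAt, Pi.add_apply, smul_eq_mul]
    congr 1
    · exact sum_congr rfl fun B _ => by ring
    · rw [div_eq_mul_inv]; ring
  rw [h1, N.avg_add, N.avg_sum, N.avg_affine, pot]
  congr 1
  · refine sum_congr rfl fun B _ => ?_
    have := N.avg_affine σ.cur ((-1 : ℝ) • N.hit bd B) 1 (restFactor N bd K B σ)
    rw [N.avg_smul] at this
    simp only [Pi.smul_apply] at this
    rw [this]
    ring
  · rw [div_eq_mul_inv]; ring

variable {N bd Λ t K T}

section

variable (hbd : N.Exits bd) (hΛ : Λ ⊆ bd)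

include hbd

theorem idleFactor_nonneg {B : Finset V} (hB : B ⊆ bd) (idle : Finset V) :
    0 ≤ idleFactor N bd K B idle :=
  prod_nonneg fun a _ => pow_nonneg (sub_nonneg.2 (Network.avg_hit_le_one hbd hB a)) _

theorem restFactor_nonneg {B : Finset V} (hB : B ⊆ bd) (σ : Search V) :
    0 ≤ restFactor N bd K B σ :=
  mul_nonneg (pow_nonneg (sub_nonneg.2 (Network.avg_hit_le_one hbd hB _)) _)
    (idleFactor_nonneg hbd hB _)

omit [DecidableEq V] in
theorem restTime_nonneg (σ : Search V) : 0 ≤ restTime N bd K σ := by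
  have h := fun v => Network.avg_time_nonneg hbd v
  refine add_nonneg (mul_nonneg (Nat.cast_nonneg _) (by linarith [h σ.src])) ?_
  exact sum_nonneg fun a _ => mul_nonneg (Nat.cast_nonneg _) (by linarith [h a])

include hΛ

theorem sum_potAt_nonneg (σ : Search V) (u : V) :
    0 ≤ ∑ B ∈ avoided Λ t σ.seen, (1 - N.hit bd B u) * restFactor N bd K B σ :=
  sum_nonneg fun B hB => by
    have hB' := (mem_avoided.1 hB).1.trans hΛ
    exact mul_nonneg (sub_nonneg.2 (Network.hit_le_one hbd hB' u)) (restFactor_nonneg hbd hB' σ)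

theorem potAt_nonneg (σ : Search V) (u : V) (e : ℕ) : 0 ≤ potAt N bd Λ t K T σ u e := by
  refine add_nonneg (sum_potAt_nonneg hbd hΛ σ u) (div_nonneg ?_ (Nat.cast_nonneg _))
  have := restTime_nonneg (K := K) hbd σ
  have := Network.time_nonneg hbd u
  positivity

/-- When the time is over, the potential is at least `1`. -/
theorem one_le_potAt_of_timeout (hT : 0 < T) (σ : Search V) (u : V) {e : ℕ} (he : T ≤ e + 1) :
    1 ≤ potAt N bd Λ t K T σ u e := by
  have h1 := sum_potAt_nonneg (t := t) (K := K) hbd hΛ σ u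
  have h2 := restTime_nonneg (K := K) hbd σ
  have h3 := Network.time_nonneg hbd u
  have h4 : (T : ℝ) ≤ e + 1 := by exact_mod_cast he
  have h5 : 1 ≤ (1 + N.time bd u + restTime N bd K σ + e) / T := by
    rw [le_div_iff₀ (by exact_mod_cast hT)]
    linarith
  unfold potAt
  linarith

/-- When all seen landmarks have been processed and `t` has not been found, the potential is at
least `1`. -/
theorem one_le_potAt_of_finished (σ : Search V) {u : V} (e : ℕ) (hu : u ∈ Λ) (hut : u ≠ t)
    (ht : t ∈ Λ) (hts : t ∉ σ.seen) (hrem : σ.rem = 1) (hidle : σ.idle = Λ \ insert u σ.seen) :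
    1 ≤ potAt N bd Λ t K T σ u e := by
  set B := Λ \ insert u σ.seen with hB
  have hBm : B ∈ avoided Λ t σ.seen := by
    rw [mem_avoided]
    refine ⟨sdiff_subset, ?_, ?_⟩
    · simp [hB, ht, hts, hut.symm]
    · exact disjoint_sdiff_self_left.mono_right (subset_insert _ _)
  have h0 : (1 - N.hit bd B u) * restFactor N bd K B σ = 1 := by
    rw [Network.hit_of_notMem hbd (hΛ hu) (by simp [hB]), restFactor, hrem, hidle, idleFactor]
    simp
  have h1 : (1 - N.hit bd B u) * restFactor N bd K B σ ≤
      ∑ B ∈ avoided Λ t σ.seen, (1 - N.hit bd B u) * restFactor N bd K B σ := by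
    refine single_le_sum (f := fun B => (1 - N.hit bd B u) * restFactor N bd K B σ)
      (fun B hB => ?_) hBm
    have hB' := (mem_avoided.1 hB).1.trans hΛ
    exact mul_nonneg (sub_nonneg.2 (Network.hit_le_one hbd hB' u)) (restFactor_nonneg hbd hB' σ)
  have h2 : 0 ≤ (1 + N.time bd u + restTime N bd K σ + e) / T := by
    refine div_nonneg ?_ (Nat.cast_nonneg _)
    have := restTime_nonneg (K := K) hbd σ
    have := Network.time_nonneg hbd u
    positivity
  unfold potAt
  linarith

/-- The search goes on when the walk has not met a landmark. -/
theorem pot_of_interior (σ : Search V) {u : V} (e : ℕ) (hu : u ∉ bd) :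
    pot N bd Λ t K T { σ with cur := u } (e + 1) = potAt N bd Λ t K T σ u e := by
  unfold pot potAt
  congr 1
  · refine sum_congr rfl fun B hB => ?_
    dsimp only
    rw [Network.avg_hit hbd ((mem_avoided.1 hB).1.trans hΛ) hu]
    rfl
  · dsimp only
    rw [Network.avg_time hbd hu,
      show restTime N bd K { σ with cur := u } = restTime N bd K σ from rfl]
    push_cast
    ring

/-- The next excursion from the same landmark starts: the sets that contain the landmark `u` are
dropped, and for the others the factor `1 - hit` is `1`. -/
theorem pot_of_again (σ : Search V) {u : V} (e : ℕ) (hu : u ∈ Λ) (hrem : 2 ≤ σ.rem) :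
    pot N bd Λ t K T ⟨σ.src, σ.src, σ.rem - 1, insert u σ.seen, σ.idle⟩ (e + 1) ≤
      potAt N bd Λ t K T σ u e := by
  obtain ⟨k, hk⟩ := Nat.exists_eq_add_of_le hrem
  unfold pot potAt
  refine add_le_add ?_ (le_of_eq ?_)
  · refine le_trans (le_of_eq ?_) (sum_le_sum_of_subset_of_nonneg
      (avoided_anti (subset_insert u σ.seen)) fun B hB _ => ?_)
    · refine sum_congr rfl fun B hB => ?_
      have hB := mem_avoided.1 hB
      have huB : u ∉ B := fun h => disjoint_left.1 hB.2.2 h (mem_insert_self _ _)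
      rw [Network.hit_of_notMem hbd (hΛ hu) huB, restFactor, restFactor]
      dsimp only
      rw [hk, show 2 + k - 1 = k + 1 by omega, show k + 1 - 1 = k by omega]
      ring
    · have hB' := (mem_avoided.1 hB).1.trans hΛ
      exact mul_nonneg (sub_nonneg.2 (Network.hit_le_one hbd hB' u)) (restFactor_nonneg hbd hB' σ)
  · rw [Network.time_of_mem hbd (hΛ hu), restTime, restTime]
    dsimp only
    rw [hk, show 2 + k - 1 = k + 1 by omega, show k + 1 - 1 = k by omega]
    push_cast
    ring

/-- The excursions from the next landmark `a` start. -/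
theorem pot_of_next (σ : Search V) {u a : V} (e : ℕ) (hu : u ∈ Λ) (hrem : σ.rem = 1)
    (ha : a ∈ insert u σ.seen) (hai : a ∈ σ.idle) (hK : 0 < K a) :
    pot N bd Λ t K T ⟨a, a, K a, insert u σ.seen, σ.idle.erase a⟩ (e + 1) ≤
      potAt N bd Λ t K T σ u e := by
  obtain ⟨k, hk⟩ := Nat.exists_eq_succ_of_ne_zero hK.ne'
  unfold pot potAt
  refine add_le_add ?_ (le_of_eq ?_)
  · refine le_trans (le_of_eq ?_) (sum_le_sum_of_subset_of_nonneg
      (avoided_anti (subset_insert u σ.seen)) fun B hB _ => ?_)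
    · refine sum_congr rfl fun B hB => ?_
      have hB := mem_avoided.1 hB
      have huB : u ∉ B := fun h => disjoint_left.1 hB.2.2 h (mem_insert_self _ _)
      have haB : a ∉ B := fun h => disjoint_left.1 hB.2.2 h ha
      have hsd : σ.idle \ B = insert a (σ.idle.erase a \ B) := by
        rw [← insert_erase hai, insert_sdiff_of_notMem _ haB]
        simp
      rw [Network.hit_of_notMem hbd (hΛ hu) huB, restFactor, restFactor, idleFactor, idleFactor]
      dsimp only
      rw [hsd, prod_insert (by simp), hrem, hk]
      simp only [Nat.succ_eq_add_one, Nat.add_sub_cancel, Nat.sub_self, pow_zero]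
      ring
    · have hB' := (mem_avoided.1 hB).1.trans hΛ
      exact mul_nonneg (sub_nonneg.2 (Network.hit_le_one hbd hB' u)) (restFactor_nonneg hbd hB' σ)
  · rw [Network.time_of_mem hbd (hΛ hu), restTime, restTime]
    dsimp only
    rw [← add_sum_erase _ _ hai, hrem, hk]
    simp only [Nat.succ_eq_add_one, Nat.add_sub_cancel, Nat.sub_self]
    push_cast
    ring

/-- The potential at the start of the search from `s`. -/
theorem pot_start_le {s : V} (hs : s ∈ Λ) (hK : 0 < K s) :
    pot N bd Λ t K T ⟨s, s, K s, {s}, Λ.erase s⟩ 0 ≤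
      ∑ B ∈ avoided Λ t {s}, Real.exp (-∑ a ∈ Λ \ B, K a * N.avg a (N.hit bd B)) +
        (∑ a ∈ Λ, K a * (1 + N.avg a (N.time bd))) / T := by
  obtain ⟨k, hk⟩ := Nat.exists_eq_succ_of_ne_zero hK.ne'
  unfold pot
  refine add_le_add (sum_le_sum fun B hB => ?_) (le_of_eq ?_)
  · have hB := mem_avoided.1 hB
    have hsB : s ∉ B := fun h => disjoint_left.1 hB.2.2 h (mem_singleton_self s)
    have hsd : Λ \ B = insert s (Λ.erase s \ B) := by
      rw [← insert_erase hs, insert_sdiff_of_notMem _ hsB]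
      simp
    have h1 : (1 - N.avg s (N.hit bd B)) * restFactor N bd K B ⟨s, s, K s, {s}, Λ.erase s⟩ =
        ∏ a ∈ Λ \ B, (1 - N.avg a (N.hit bd B)) ^ K a := by
      rw [hsd, prod_insert (by simp), restFactor, idleFactor]
      dsimp only
      rw [hk]
      simp only [Nat.succ_eq_add_one, Nat.add_sub_cancel]
      ring
    rw [h1, ← sum_neg_distrib, Real.exp_sum]
    refine prod_le_prod (fun a _ => pow_nonneg (sub_nonneg.2
      (Network.avg_hit_le_one hbd (hB.1.trans hΛ) a)) _) fun a _ => ?_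
    rw [← mul_neg, Real.exp_nat_mul]
    refine pow_le_pow_left₀ (sub_nonneg.2 (Network.avg_hit_le_one hbd (hB.1.trans hΛ) a)) ?_ _
    linarith [Real.add_one_le_exp (-N.avg a (N.hit bd B))]
  · rw [restTime, ← add_sum_erase _ _ hs]
    dsimp only
    rw [hk]
    simp only [Nat.succ_eq_add_one, Nat.add_sub_cancel]
    push_cast
    ring

end

/-! ### The search on a graph -/

section graph

variable (G : SimpleGraph V) [DecidableRel G.Adj]

open Classical in
/-- The landmarks in the component of `s`. -/
noncomputable def marks (s : V) (L : Finset V) : Finset V := {v ∈ L | G.Reachable s v}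

open Classical in
/-- The landmarks in the component of `s`, together with everything outside of this component. -/
noncomputable def boundary (s : V) (L : Finset V) : Finset V :=
  marks G s L ∪ univ.filter fun v => ¬ G.Reachable s v

variable {G} {s : V} {L : Finset V}

theorem mem_marks {v : V} : v ∈ marks G s L ↔ v ∈ L ∧ G.Reachable s v := by simp [marks]

theorem mem_boundary {v : V} : v ∈ boundary G s L ↔ v ∈ L ∨ ¬ G.Reachable s v := by
  simp [boundary, mem_marks]
  tauto

theorem marks_subset_boundary : marks G s L ⊆ boundary G s L := fun v hv => by
  rw [mem_marks] at hv
  exact mem_boundary.2 (Or.inl hv.1)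

variable {d : ℕ} (hd : 0 < d)

theorem exits_boundary (hs : s ∈ L) : (G.metropolis d hd).Exits (boundary G s L) := by
  refine G.exits_metropolis d hd fun v => ?_
  by_cases hv : G.Reachable s v
  · exact ⟨s, mem_boundary.2 (Or.inl hs), hv.symm⟩
  · exact ⟨v, mem_boundary.2 (Or.inr hv), SimpleGraph.Reachable.refl v⟩

/-- The set of landmarks meets every ball of at least `r` nodes. -/
def Hits (G : SimpleGraph V) (L : Finset V) (r : ℕ) : Prop :=
  ∀ v j, j < Fintype.card V → r ≤ #(G.distBall v j) → ∃ u ∈ G.distBall v j, u ∈ L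

/-- A cut between landmarks of the component of `s` has a weight of at least `1 / (6 r + 10 d)` in
the walk observed on the landmarks. -/
theorem inv_le_cutWeight (hs : s ∈ L) {r : ℕ} (hL : Hits G L r) {A : Finset V}
    (hA : A ⊆ marks G s L) (hne : A.Nonempty) (hne' : A ≠ marks G s L) :
    ((6 * r + 10 * d : ℕ) : ℝ)⁻¹ ≤
      cutWeight ((G.metropolis d hd).trace (boundary G s L)) (marks G s L) A := by
  have hbd := exits_boundary (G := G) hd hs
  have hAbd := hA.trans (marks_subset_boundary (G := G))
  have hBne : (marks G s L \ A).Nonempty := by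
    rw [sdiff_nonempty]
    exact fun h => hne' (subset_antisymm hA h)
  obtain ⟨k, p, h1, h2, h3, h4, h5⟩ := G.exists_path_of_balls d hd hBne hne
    (fun a ha b hb => (mem_marks.1 (mem_sdiff.1 ha).1).2.symm.trans (mem_marks.1 (hA hb)).2)
    (r := r) (by
      rintro v j hj ⟨a, ha, hva⟩ hr
      obtain ⟨u, hu, huL⟩ := hL v j hj hr
      refine ⟨u, hu, ?_⟩
      have hsu : G.Reachable s u := ((mem_marks.1 (mem_sdiff.1 ha).1).2.trans hva.symm).trans
        ((G.mem_distBall).1 hu).1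
      by_cases huA : u ∈ A
      · exact Or.inr huA
      · exact Or.inl (mem_sdiff.2 ⟨mem_marks.2 ⟨huL, hsu⟩, huA⟩))
  have hsub : marks G s L \ A ⊆ boundary G s L \ A :=
    sdiff_subset_sdiff marks_subset_boundary le_rfl
  have key := Network.inv_le_sum_wt_avg_hit hbd hAbd h1 (hsub h2) h3 h4 h5 (by positivity)
  -- nothing flows outside of the component of `s`
  have hzero : ∑ a ∈ boundary G s L \ A, (G.metropolis d hd).wt a *
      (G.metropolis d hd).avg a ((G.metropolis d hd).hit (boundary G s L) A) =
      ∑ a ∈ marks G s L \ A, (G.metropolis d hd).wt a *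
      (G.metropolis d hd).avg a ((G.metropolis d hd).hit (boundary G s L) A) := by
    refine (sum_subset hsub fun o ho hno => ?_).symm
    rw [mem_sdiff] at ho hno
    have hso : ¬ G.Reachable s o := by
      intro h
      rcases mem_boundary.1 ho.1 with h' | h'
      · exact hno ⟨mem_marks.2 ⟨h', h⟩, ho.2⟩
      · exact h' h
    have hz : ∀ v, ¬ G.Reachable s v → (G.metropolis d hd).hit (boundary G s L) A v = 0 :=
      fun v hv => Network.hit_of_notMem hbd (mem_boundary.2 (Or.inr hv))
        fun hvA => hv (mem_marks.1 (hA hvA)).2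
    rw [Network.avg, hz o hso, sum_eq_zero]
    · simp
    · intro u _
      by_cases hadj : G.Adj o u
      · rw [hz u fun h => hso (h.trans hadj.symm.reachable)]
        simp
      · have : (G.metropolis d hd).c o u = 0 := if_neg hadj
        rw [this, zero_mul]
  rw [hzero] at key
  push_cast
  refine key.trans (le_of_eq ?_)
  unfold cutWeight
  rw [sum_comm]
  refine sum_congr rfl fun a ha => ?_
  rw [Network.wt_mul_avg_hit hbd hAbd]
  refine sum_congr rfl fun b hb => ?_
  exact Network.trace_symm hbd (mem_boundary.2 (Or.inl (mem_marks.1 (mem_sdiff.1 ha).1).1))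
    (hAbd hb)

/-- If the landmarks meet all large balls, then the search from `s` fails with probability at most
`3/8`: at most `1/8` for a closed set of landmarks, at most `1/4` for running out of time. -/
theorem pot_start_le_of_hits (hs : s ∈ L) {l r K₀ : ℕ} (hl : 2 ≤ l)
    (hcard : Fintype.card V ≤ 2 ^ l) (hL : Hits G L r)
    (hK₀ : K₀ = 12 * l * (6 * r + 10 * d)) (hedges : 2 * #G.edgeFinset ≤ d * Fintype.card V)
    (hT : T = 16 * K₀ * Fintype.card V) (hK : ∀ v, K v = K₀ * (G.degree v / d + 1)) :
    pot (G.metropolis d hd) (boundary G s L) (marks G s L) t K T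
      ⟨s, s, K s, {s}, (marks G s L).erase s⟩ 0 ≤ 3 / 8 := by
  set N := G.metropolis d hd with hN
  set bd := boundary G s L with hbddef
  set Λ := marks G s L with hΛdef
  have hbd : N.Exits bd := exits_boundary hd hs
  have hΛ : Λ ⊆ bd := marks_subset_boundary
  have hsΛ : s ∈ Λ := mem_marks.2 ⟨hs, SimpleGraph.Reachable.refl s⟩
  have hK₀pos : 0 < K₀ := by
    rw [hK₀]
    exact Nat.mul_pos (by omega) (by omega)
  have hKpos : ∀ v, 0 < K v := fun v => by rw [hK]; positivity
  have hd' : (0 : ℝ) < d := by exact_mod_cast hd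
  have hwt : ∀ v, N.wt v = max 1 ((G.degree v : ℝ) / d) := fun v => rfl
  have hKlow : ∀ v, K₀ * N.wt v ≤ K v := by
    intro v
    rw [hK, hwt]
    push_cast
    gcongr
    refine max_le (le_add_of_nonneg_left (Nat.cast_nonneg _)) ?_
    exact (Nat.lt_floor_add_one _).le.trans (by rw [Nat.floor_div_eq_div])
  have hKup : ∀ v, (K v : ℝ) ≤ 2 * K₀ * N.wt v := by
    intro v
    rw [hK, hwt]
    push_cast
    have h1 : ((G.degree v / d : ℕ) : ℝ) ≤ (G.degree v : ℝ) / d := Nat.cast_div_le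
    have h2 := le_max_left 1 ((G.degree v : ℝ) / d)
    have h3 := le_max_right 1 ((G.degree v : ℝ) / d)
    have h4 : (0 : ℝ) ≤ K₀ := Nat.cast_nonneg _
    nlinarith
  refine (pot_start_le hbd hΛ hsΛ (hKpos s)).trans ?_
  have hcut : ∑ B ∈ avoided Λ t {s}, Real.exp (-∑ a ∈ Λ \ B, K a * N.avg a (N.hit bd B)) ≤
      1 / 8 := by
    have hρ : (0 : ℝ) < ((6 * r + 10 * d : ℕ) : ℝ) := by positivity
    refine le_trans (sum_le_sum fun B hB => ?_) (sum_cuts_le (Λ := Λ) (W := N.trace bd)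
      (mu := ((6 * r + 10 * d : ℕ) : ℝ)⁻¹) (inv_pos.2 hρ) (Network.trace_nonneg hbd)
      (fun a ha b hb => Network.trace_symm hbd (hΛ ha) (hΛ hb))
      (fun A hA h1 h2 => inv_le_cutWeight hd hs hL hA h1 h2) hl
      ((card_le_univ _).trans hcard) (K := K₀) ?_ (avoided Λ t {s}) fun B hB => ?_)
    · have hB := mem_avoided.1 hB
      apply Real.exp_le_exp.2
      apply neg_le_neg
      unfold cutWeight
      rw [sum_comm, mul_sum]
      refine sum_le_sum fun a ha => ?_
      have h1 : ∑ b ∈ B, N.trace bd b a = N.wt a * N.avg a (N.hit bd B) := by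
        rw [Network.wt_mul_avg_hit hbd (hB.1.trans hΛ)]
        exact sum_congr rfl fun b hb =>
          Network.trace_symm hbd (hΛ (hB.1 hb)) (hΛ (mem_sdiff.1 ha).1)
      rw [h1, ← mul_assoc]
      exact mul_le_mul_of_nonneg_right (hKlow a) (Network.avg_hit_nonneg hbd B a)
    · rw [hK₀, Nat.cast_mul, mul_assoc, mul_inv_cancel₀ hρ.ne']
      push_cast
      linarith
    · have hB := mem_avoided.1 hB
      refine ⟨hB.1, ⟨t, hB.2.1⟩, fun h => ?_⟩
      exact disjoint_left.1 hB.2.2 (h ▸ hsΛ) (mem_singleton_self s)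
  have htime : (∑ a ∈ Λ, K a * (1 + N.avg a (N.time bd))) / T ≤ 1 / 4 := by
    have hn : 0 < Fintype.card V := Fintype.card_pos_iff.2 ⟨s⟩
    have hTpos : (0 : ℝ) < T := by
      rw [hT]
      exact_mod_cast (by positivity)
    rw [div_le_iff₀ hTpos]
    have h0 : ∀ a, 0 ≤ 1 + N.avg a (N.time bd) := fun a => by
      linarith [Network.avg_time_nonneg hbd a]
    calc ∑ a ∈ Λ, K a * (1 + N.avg a (N.time bd))
        ≤ ∑ a ∈ bd, K a * (1 + N.avg a (N.time bd)) :=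
          sum_le_sum_of_subset_of_nonneg hΛ fun a _ _ => mul_nonneg (Nat.cast_nonneg _) (h0 a)
      _ ≤ ∑ a ∈ bd, 2 * K₀ * (N.wt a * (1 + N.avg a (N.time bd))) := by
          refine sum_le_sum fun a _ => ?_
          rw [← mul_assoc]
          exact mul_le_mul_of_nonneg_right (hKup a) (h0 a)
      _ = 2 * K₀ * ∑ v, N.wt v := by rw [← mul_sum, Network.sum_wt_return hbd]
      _ ≤ 2 * K₀ * (2 * Fintype.card V) := by
          gcongr
          exact G.sum_wt_metropolis_le d hd hedges
      _ = 1 / 4 * T := by rw [hT]; push_cast; ring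
  linarith

end graph

end Search

end

/-! ### The program

The registers are cells with addresses below `64`. The array of landmarks starts at the address
`64`; it is followed by an array of marks, and by the queue of the landmarks that have been reached
and not yet been started from. The first two have an entry for every block of nodes. -/

namespace WordRAM

namespace Ex

abbrev add (e f : Ex) : Ex := op .add e f
abbrev sub (e f : Ex) : Ex := op .sub e f
abbrev mul (e f : Ex) : Ex := op .mul e f
abbrev div (e f : Ex) : Ex := op .div e f
abbrev less (e f : Ex) : Ex := op .lt e f
abbrev equal (e f : Ex) : Ex := op .eq e f

end Ex

end WordRAM

namespace Connectivity

open WordRAM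

notation "rAns" => (0 : ℕ)
notation "rNodes" => (16 : ℕ)
notation "rSource" => (17 : ℕ)
notation "rTarget" => (18 : ℕ)
notation "rSize" => (19 : ℕ)
notation "rBlocks" => (20 : ℕ)
notation "rWidth" => (21 : ℕ)
notation "rDeg" => (22 : ℕ)
notation "rMult" => (23 : ℕ)
notation "rTime" => (24 : ℕ)
notation "rRounds" => (25 : ℕ)
notation "rBudget" => (26 : ℕ)
notation "rCur" => (27 : ℕ)
notation "rSrc" => (28 : ℕ)
notation "rRem" => (29 : ℕ)
notation "rHead" => (30 : ℕ)
notation "rTail" => (31 : ℕ)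
notation "rA" => (32 : ℕ)
notation "rB" => (33 : ℕ)
notation "rC" => (34 : ℕ)
notation "rE" => (35 : ℕ)
notation "rI" => (36 : ℕ)
notation "rJ" => (37 : ℕ)

/-- The degree of a node, cut off at the content of `rDeg`. -/
def cutDegEx (e : Ex) : Ex := .sub (.deg e) (.sub (.deg e) (.reg rDeg))

/-- The address of the landmark in the block of the current node. -/
def landmarkAddr : Ex := .add (.lit 64) (.div (.reg rCur) (.reg rWidth))

/-- The address of the mark of the block of the current node. -/
def markAddr : Ex := .add (.add (.lit 64) (.reg rBlocks)) (.div (.reg rCur) (.reg rWidth))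

/-- The address behind the arrays of landmarks and of marks, where the queue starts. -/
def queueStart : Ex := .add (.add (.lit 64) (.reg rBlocks)) (.reg rBlocks)

/-- One step of the Metropolis walk. -/
def walkStep : Cmd :=
  .seq (.set rBudget (.sub (.reg rBudget) (.lit 1))) <|
  .seq (.set rC (cutDegEx (.reg rCur))) <|
  .seq (.rnd rI (.sub (.deg (.reg rCur)) (.lit 1))) <|
  .seq (.set rB (.nbr (.reg rCur) (.reg rI))) <|
  .seq (.set rE (cutDegEx (.reg rB))) <|
  .seq (.rnd rJ (.sub (.add (.reg rC) (.sub (.reg rE) (.reg rC))) (.lit 1))) <|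
  .ite (.less (.reg rJ) (.reg rC)) (.set rCur (.reg rB)) .nop

/-- The end of an excursion: start the next one, from the same landmark or from the next one in the
queue; if there is none, end the search. -/
def endExcursion : Cmd :=
  .ite (.less (.lit 1) (.reg rRem))
    (.seq (.set rRem (.sub (.reg rRem) (.lit 1))) (.set rCur (.reg rSrc))) <|
  .ite (.less (.reg rHead) (.reg rTail))
    (.seq (.set rSrc (.ld (.add queueStart (.reg rHead)))) <|
      .seq (.set rHead (.add (.reg rHead) (.lit 1))) <|
      .seq (.set rRem (.mul (.reg rMult)
        (.add (.div (.deg (.reg rSrc)) (.reg rDeg)) (.lit 1)))) <|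
      .set rCur (.reg rSrc))
    (.set rBudget (.lit 0))

/-- Mark the current landmark and append it to the queue. -/
def push : Cmd :=
  .seq (.put markAddr (.lit 1)) <|
  .seq (.put (.add queueStart (.reg rTail)) (.reg rCur)) <|
  .set rTail (.add (.reg rTail) (.lit 1))

/-- Check whether the current node is the target or a landmark. -/
def inspect : Cmd :=
  .ite (.equal (.reg rCur) (.reg rTarget))
    (.seq (.set rAns (.lit 1)) (.seq (.set rBudget (.lit 0)) (.set rRounds (.lit 0)))) <|
  .ite (.equal (.reg rCur) (.reg rSource)) endExcursion <|
  .ite (.equal (.ld landmarkAddr) (.reg rCur))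
    (.seq (.ite (.ld markAddr) .nop push) endExcursion) .nop

/-- Choose a random landmark in the block `rI - 1`. -/
def chooseLandmark : Cmd :=
  .seq (.set rI (.sub (.reg rI) (.lit 1))) <|
  .seq (.rnd rJ (.sub (.reg rWidth) (.lit 1))) <|
  .seq (.put (.add (.lit 64) (.reg rI)) (.add (.mul (.reg rI) (.reg rWidth)) (.reg rJ))) <|
  .put (.add (.add (.lit 64) (.reg rBlocks)) (.reg rI)) (.lit 0)

/-- Start the search from `s`. -/
def startSearch : Cmd :=
  .seq (.set rSrc (.reg rSource)) <|
  .seq (.set rCur (.reg rSource)) <|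
  .seq (.set rHead (.lit 0)) <|
  .seq (.set rTail (.lit 0)) <|
  .seq (.set rRem (.mul (.reg rMult) (.add (.div (.deg (.reg rSource)) (.reg rDeg)) (.lit 1)))) <|
  .set rBudget (.reg rTime)

/-- One round: random landmarks, and a search from `s`. -/
def round : Program :=
  .seq (Cmd.code (.seq (.set rRounds (.sub (.reg rRounds) (.lit 1))) (.set rI (.reg rBlocks)))) <|
  .seq (.while rI chooseLandmark.code) <|
  .seq startSearch.code <|
  .while rBudget (Cmd.code (.seq walkStep inspect))

/-- One step of the computation of the binary length of a number. -/
def halveSize : Cmd :=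
  .seq (.set rA (.div (.reg rA) (.lit 2))) (.set rSize (.add (.reg rSize) (.lit 1)))

/-- Add the degree of the node `rI - 1`. -/
def sumDegree : Cmd :=
  .seq (.set rI (.sub (.reg rI) (.lit 1))) (.set rA (.add (.reg rA) (.deg (.reg rI))))

/-- Read the input, and prepare the computation of its length. -/
def readInput : Cmd :=
  .seq (.set rNodes (.par .nodes)) <|
  .seq (.set rSource (.par .source)) <|
  .seq (.set rTarget (.par .target)) <|
  .set rA (.reg rNodes)

/-- Compute the number and the width of the blocks, and prepare the summation of the degrees. -/
def computeBlocks : Cmd :=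
  .seq (.set rBlocks (.div (.sub (.par .cells) (.lit 64)) (.lit 3))) <|
  .seq (.ite (.less (.reg rNodes) (.reg rBlocks)) (.set rBlocks (.reg rNodes)) .nop) <|
  .seq (.set rWidth (.add (.div (.reg rNodes) (.reg rBlocks)) (.lit 1))) <|
  .seq (.set rI (.reg rNodes)) <|
  .set rA (.lit 0)

/-- Compute the average degree `d`, the bound `24 l g + 10 d` for resistances, the number of
excursions, the time of one round and the number of rounds. -/
def computeTimes : Cmd :=
  .seq (.set rDeg (.add (.div (.reg rA) (.reg rNodes)) (.lit 1))) <|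
  .seq (.set rA (.add (.mul (.lit 24) (.mul (.reg rSize) (.reg rWidth)))
    (.mul (.lit 10) (.reg rDeg)))) <|
  .seq (.set rMult (.mul (.mul (.lit 12) (.reg rSize)) (.reg rA))) <|
  .seq (.set rTime (.mul (.mul (.lit 16) (.reg rMult)) (.reg rNodes))) <|
  .ite (.equal (.reg rSource) (.reg rTarget))
    (.set rAns (.lit 1)) (.set rRounds (.reg rSize))

/-- The program. A successful round sets the number of remaining rounds to `0`. If `s = t`, then there
are no rounds. -/
def prog : Program :=
  .seq readInput.code <|
  .seq (.while rA halveSize.code) <|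
  .seq computeBlocks.code <|
  .seq (.while rI sumDegree.code) <|
  .seq computeTimes.code <|
  .while rRounds round

/-! ### Rules for commands -/

section rules

variable {n w M : ℕ} {x : USTCON n} {g : Mem → ℝ≥0∞} {a : Mem} {V : ℝ≥0∞}

theorem wp_set_le {d v : ℕ} {e : Ex} (he : e.ev w M x a = v) (hs : e.Safe w M x a)
    (h : g (Function.update a d v) ≤ V) (hdep : e.depth ≤ 15 := by decide)
    (hd : 16 ≤ d := by decide) (hdM : d < 64 := by decide) (hM : 64 ≤ M := by omega) :
    (Cmd.set d e).wp w M x g a ≤ V := by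
  rw [Cmd.wp, if_pos ⟨hdep, Or.inr hd, by omega, hs⟩, he]
  exact h

theorem wp_put_le {r v : ℕ} {e f : Ex} (he : e.ev w M x a = r) (hf : f.ev w M x a = v)
    (hse : e.Safe w M x a) (hsf : f.Safe w M x a) (hr : 16 ≤ r) (hrM : r < M)
    (h : g (Function.update a r v) ≤ V) (hdep : e.depth ≤ 15 := by decide)
    (hdep' : f.depth ≤ 14 := by decide) : (Cmd.put e f).wp w M x g a ≤ V := by
  rw [Cmd.wp, he, if_pos ⟨hdep, hdep', hse, hsf, Or.inr hr, hrM⟩, hf]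
  exact h

theorem wp_rnd_le {d k : ℕ} {e : Ex} {W : ℕ → ℝ≥0∞} (he : e.ev w M x a = k)
    (hs : e.Safe w M x a) (h : ∀ r ≤ k, g (Function.update a d r) ≤ W r)
    (hV : (∑ r ∈ Finset.range (k + 1), W r) / (k + 1 : ℕ) ≤ V) (hdep : e.depth ≤ 15 := by decide)
    (hd : 16 ≤ d := by decide) (hdM : d < 64 := by decide) (hM : 64 ≤ M := by omega) :
    (Cmd.rnd d e).wp w M x g a ≤ V := by
  have hlt := Ex.ev_lt hs
  rw [Cmd.wp, if_pos ⟨hdep, Or.inr hd, by omega, hs, hlt⟩, he]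
  refine le_trans ?_ hV
  gcongr with r hr
  exact h r (by rw [Finset.mem_range] at hr; omega)

theorem wp_ite_le {e : Ex} {c d : Cmd} (hs : e.Safe w M x a)
    (h₁ : e.ev w M x a ≠ 0 → c.wp w M x g a ≤ V) (h₀ : e.ev w M x a = 0 → d.wp w M x g a ≤ V)
    (hdep : e.depth ≤ 15 := by decide) : (Cmd.ite e c d).wp w M x g a ≤ V := by
  rw [Cmd.wp, if_pos ⟨hdep, hs⟩]
  split_ifs with h
  · exact h₁ h
  · exact h₀ (by simpa using h)

theorem wp_ite_less_le {e f : Ex} {c d : Cmd} (he : e.Safe w M x a) (hf : f.Safe w M x a)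
    (hw : 1 < 2 ^ w) (h₁ : e.ev w M x a < f.ev w M x a → c.wp w M x g a ≤ V)
    (h₀ : ¬ e.ev w M x a < f.ev w M x a → d.wp w M x g a ≤ V)
    (hdep : (Ex.less e f).depth ≤ 15 := by decide) :
    (Cmd.ite (.less e f) c d).wp w M x g a ≤ V := by
  have h : (Ex.less e f).ev w M x a = if e.ev w M x a < f.ev w M x a then 1 else 0 := rfl
  refine wp_ite_le ⟨he, hf, ?_⟩ (fun hc => h₁ ?_) (fun hc => h₀ ?_) hdep
  · change (Ex.less e f).ev w M x a < 2 ^ w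
    rw [h]
    split_ifs <;> omega
  · by_contra hn
    rw [h, if_neg hn] at hc
    exact hc rfl
  · intro hn
    rw [h, if_pos hn] at hc
    exact one_ne_zero hc

theorem wp_ite_equal_le {e f : Ex} {c d : Cmd} (he : e.Safe w M x a) (hf : f.Safe w M x a)
    (hw : 1 < 2 ^ w) (h₁ : e.ev w M x a = f.ev w M x a → c.wp w M x g a ≤ V)
    (h₀ : e.ev w M x a ≠ f.ev w M x a → d.wp w M x g a ≤ V)
    (hdep : (Ex.equal e f).depth ≤ 15 := by decide) :
    (Cmd.ite (.equal e f) c d).wp w M x g a ≤ V := by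
  have h : (Ex.equal e f).ev w M x a = if e.ev w M x a = f.ev w M x a then 1 else 0 := rfl
  refine wp_ite_le ⟨he, hf, ?_⟩ (fun hc => h₁ ?_) (fun hc => h₀ ?_) hdep
  · change (Ex.equal e f).ev w M x a < 2 ^ w
    rw [h]
    split_ifs <;> omega
  · by_contra hn
    rw [h, if_neg hn] at hc
    exact hc rfl
  · intro hn
    rw [h, if_pos hn] at hc
    exact one_ne_zero hc

theorem sum_ofReal_div {k : ℕ} (hk : 0 < k) {f : ℕ → ℝ} (hf : ∀ i < k, 0 ≤ f i) :
    (∑ i ∈ Finset.range k, ENNReal.ofReal (f i)) / (k : ℕ) =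
      ENNReal.ofReal ((∑ i ∈ Finset.range k, f i) / k) := by
  rw [← ENNReal.ofReal_sum_of_nonneg fun i hi => hf i (Finset.mem_range.1 hi),
    ENNReal.ofReal_div_of_pos (by exact_mod_cast hk), ENNReal.ofReal_natCast]

end rules

end Connectivity

/-! ### Graph queries and the Metropolis rule -/

namespace USTCON

variable {n : ℕ} (x : USTCON n)

theorem degQuery_val (v : Fin n) : x.degQuery v = x.graph.degree v := by simp [degQuery]

theorem degQuery_lt (hn : 0 < n) (v : ℕ) : x.degQuery v < n := by
  unfold degQuery
  split_ifs with h
  · simpa using x.graph.degree_lt_card_verts ⟨v, h⟩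
  · exact hn

/-- The neighbour behind a port, or node `0`. -/
def nbrNode (hn : 0 < n) (v : Fin n) (i : ℕ) : Fin n :=
  if h : i < x.graph.degree v then (x.port v).symm ⟨i, h⟩ else ⟨0, hn⟩

theorem nbrQuery_val (hn : 0 < n) (v : Fin n) (i : ℕ) : x.nbrQuery v i = x.nbrNode hn v i := by
  unfold nbrQuery nbrNode
  by_cases h : i < x.graph.degree v
  · rw [dif_pos ⟨v.2, h⟩, dif_pos h]
  · rw [dif_neg (fun h' => h h'.2), dif_neg h]

theorem adj_nbrNode (hn : 0 < n) {v : Fin n} {i : ℕ} (h : i < x.graph.degree v) :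
    x.graph.Adj v (x.nbrNode hn v i) := by
  rw [nbrNode, dif_pos h]
  exact ((x.port v).symm ⟨i, h⟩).2

theorem sum_nbrNode (hn : 0 < n) (v : Fin n) (f : Fin n → ℝ) :
    ∑ i ∈ Finset.range (x.graph.degree v), f (x.nbrNode hn v i) =
      ∑ u, if x.graph.Adj v u then f u else 0 := by
  rw [Finset.sum_range fun i => f (x.nbrNode hn v i)]
  have h1 : ∀ i : Fin (x.graph.degree v), f (x.nbrNode hn v i) = f ((x.port v).symm i) := by
    intro i
    rw [nbrNode, dif_pos i.2]
  simp only [h1]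
  rw [Equiv.sum_comp (x.port v).symm fun u => f u, ← Finset.sum_filter]
  exact (Finset.sum_subtype _ (fun u => by simp) f).symm

/-- The Metropolis rule: propose a random neighbour, and accept it with probability
`e v / max (e v) (e u)`, where `e` denotes the degrees cut off at `d`. -/
theorem avg_metropolis (hn : 0 < n) {d : ℕ} (hd : 0 < d) (v : Fin n) (f : Fin n → ℝ) :
    (∑ i ∈ Finset.range (x.graph.degree v - 1 + 1),
      (∑ j ∈ Finset.range (max (x.graph.cutDeg d v) (x.graph.cutDeg d (x.nbrNode hn v i)) - 1 + 1),
        f (if j < x.graph.cutDeg d v then x.nbrNode hn v i else v)) /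
        (max (x.graph.cutDeg d v) (x.graph.cutDeg d (x.nbrNode hn v i)) - 1 + 1 : ℕ)) /
      (x.graph.degree v - 1 + 1 : ℕ) = (x.graph.metropolis d hd).avg v f := by
  rcases Nat.eq_zero_or_pos (x.graph.degree v) with h0 | hpos
  · have hc : x.graph.cutDeg d v = 0 := by rw [SimpleGraph.cutDeg, h0, Nat.min_zero]
    have hnb : ∀ u, ¬ x.graph.Adj v u := fun u h => by
      have := (x.graph.degree_pos_iff_exists_adj v).2 ⟨u, h⟩
      omega
    have hz : ∀ u, (x.graph.metropolis d hd).c v u = 0 := fun u => if_neg (hnb u)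
    rw [Network.avg]
    simp only [hz, h0, hc, not_lt_zero, if_false, Finset.sum_const, Finset.card_range,
      zero_mul, Nat.zero_sub, zero_add, Nat.cast_one, div_one, nsmul_eq_mul]
    rw [Finset.sum_range_one, mul_div_right_comm, div_self (by positivity), one_mul, mul_zero,
      zero_div, add_zero]
  · rw [Nat.sub_add_cancel hpos]
    have hcpos : 0 < x.graph.cutDeg d v := lt_min hd hpos
    set e := x.graph.cutDeg d v with he
    have hinner : ∀ i, (∑ j ∈ Finset.range
        (max e (x.graph.cutDeg d (x.nbrNode hn v i)) - 1 + 1),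
        f (if j < e then x.nbrNode hn v i else v)) /
        (max e (x.graph.cutDeg d (x.nbrNode hn v i)) - 1 + 1 : ℕ) =
        f v + (f (x.nbrNode hn v i) - f v) * e *
          ((max e (x.graph.cutDeg d (x.nbrNode hn v i)) : ℕ) : ℝ)⁻¹ := by
      intro i
      set u := x.nbrNode hn v i
      set m := max e (x.graph.cutDeg d u) with hm
      have hem : e ≤ m := le_max_left _ _
      have hmpos : 0 < m := lt_of_lt_of_le hcpos hem
      rw [Nat.sub_add_cancel hmpos]
      have h1 : ∀ j, f (if j < e then u else v) = f v + if j < e then f u - f v else 0 := by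
        intro j; split_ifs <;> ring
      simp only [h1]
      rw [Finset.sum_add_distrib, ← Finset.sum_filter]
      have h2 : (Finset.range m).filter (fun j => j < e) = Finset.range e := by
        ext j
        simp only [Finset.mem_filter, Finset.mem_range]
        omega
      rw [h2]
      simp only [Finset.sum_const, Finset.card_range, nsmul_eq_mul]
      have : (m : ℝ) ≠ 0 := by exact_mod_cast hmpos.ne'
      field_simp
    simp only [hinner]
    rw [Finset.sum_add_distrib, x.sum_nbrNode hn v fun u => (f u - f v) * e *
      ((max e (x.graph.cutDeg d u) : ℕ) : ℝ)⁻¹]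
    rw [Finset.sum_const, Finset.card_range, nsmul_eq_mul, Network.avg]
    have hD : (x.graph.degree v : ℝ) ≠ 0 := by exact_mod_cast hpos.ne'
    have hE : (e : ℝ) ≠ 0 := by exact_mod_cast hcpos.ne'
    have hd' : (d : ℝ) ≠ 0 := by exact_mod_cast hd.ne'
    have hwt : (x.graph.metropolis d hd).wt v = x.graph.degree v / e := by
      change max 1 ((x.graph.degree v : ℝ) / d) = _
      rw [he, SimpleGraph.cutDeg]
      rcases le_total d (x.graph.degree v) with h | h
      · rw [min_eq_left h, max_eq_right]
        rw [one_le_div (by positivity)]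
        exact_mod_cast h
      · rw [min_eq_right h, div_self hD, max_eq_left]
        rw [div_le_one (by positivity)]
        exact_mod_cast h
    have hsum : ∑ u, (if x.graph.Adj v u then (f u - f v) * e *
        ((max e (x.graph.cutDeg d u) : ℕ) : ℝ)⁻¹ else 0) =
        e * ∑ u, (x.graph.metropolis d hd).c v u * (f u - f v) := by
      rw [Finset.mul_sum]
      refine Finset.sum_congr rfl fun u _ => ?_
      change _ = _ * (x.graph.cond d v u * _)
      unfold SimpleGraph.cond
      split_ifs
      · ring
      · ring
    rw [hsum, hwt]
    field_simp

end USTCON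

namespace Connectivity

open WordRAM

/-! ### The memory during a search -/

/-- The parameters that the program computes: the length `l` of `n`, the number `q` of blocks and
their width `g`, the degree bound `d`, the number `K` of excursions per unit of weight, and the
number `T` of steps of a walk. -/
structure Params where
  l : ℕ
  q : ℕ
  g : ℕ
  d : ℕ
  K : ℕ
  T : ℕ

variable {n : ℕ} (x : USTCON n) (w M : ℕ) (p : Params) (H : ℕ)

/-- The parameters are consistent with the size of the memory, and bounded by a number `H` whose
square does not exceed the largest word. -/
structure Fits : Prop where
  n_pos : 0 < n
  word : H * H ≤ 2 ^ w
  T_lt : p.T < H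
  n_lt : 64 + 3 * n < H
  q_le : p.q ≤ n
  g_le : p.g ≤ n + 1
  g_pos : 0 < p.g
  n_le : n ≤ p.q * p.g
  qg_le : p.q * p.g ≤ 2 * n
  d_pos : 0 < p.d
  d_lt : p.d < H
  K_pos : 0 < p.K
  K_le : p.K * (n + 1) ≤ p.T
  cells : 64 + 3 * p.q ≤ M

variable {x w M p H}

namespace Fits

variable (h : Fits (n := n) w M p H)

include h

theorem H_ge : 64 < H := by have := h.n_lt; omega

theorem two_H_lt : 2 * H < 2 ^ w := by
  have := h.word
  have := h.H_ge
  nlinarith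

theorem div_lt (v : Fin n) : (v : ℕ) / p.g < p.q := by
  rw [Nat.div_lt_iff_lt_mul h.g_pos]
  exact v.2.trans_le h.n_le

theorem K_lt : p.K < H := by
  have := h.K_le
  have := h.T_lt
  nlinarith

end Fits

variable (x p) in
/-- The registers that do not change during the rounds have their values, and a positive answer is
correct and stops the program. -/
structure Base (a : Mem) : Prop where
  nodes : a rNodes = n
  source : a rSource = x.s
  target : a rTarget = x.t
  blocks : a rBlocks = p.q
  width : a rWidth = p.g
  deg : a rDeg = p.d
  mult : a rMult = p.K
  time : a rTime = p.T
  sound : a rAns ≠ 0 → x.Connected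
  rounds_eq : a rAns ≠ 0 → a rRounds = 0

theorem Base.congr {a b : Mem} (h : Base x p a) (hab : ∀ i < 26, b i = a i) : Base x p b where
  nodes := by rw [hab _ (by decide)]; exact h.nodes
  source := by rw [hab _ (by decide)]; exact h.source
  target := by rw [hab _ (by decide)]; exact h.target
  blocks := by rw [hab _ (by decide)]; exact h.blocks
  width := by rw [hab _ (by decide)]; exact h.width
  deg := by rw [hab _ (by decide)]; exact h.deg
  mult := by rw [hab _ (by decide)]; exact h.mult
  time := by rw [hab _ (by decide)]; exact h.time
  sound := by rw [hab _ (by decide)]; exact h.sound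
  rounds_eq := by rw [hab _ (by decide), hab _ (by decide)]; exact h.rounds_eq

variable (x p) in
/-- The landmarks: `s`, `t`, and one entry of the array `A` for every block. An entry that is not a
node of its block does not count. -/
def landmarks (A : ℕ → ℕ) : Finset (Fin n) :=
  Finset.univ.filter fun v => v = x.s ∨ v = x.t ∨ A (v / p.g) = v

theorem mem_landmarks {A : ℕ → ℕ} {v : Fin n} :
    v ∈ landmarks x p A ↔ v = x.s ∨ v = x.t ∨ A (v / p.g) = v := by
  simp [landmarks]

variable (x p) in
/-- The landmarks in the component of `s`. -/
noncomputable abbrev reached (A : ℕ → ℕ) : Finset (Fin n) :=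
  Search.marks x.graph x.s (landmarks x p A)

variable (x p H) in
/-- The memory represents the state `σ` of the search, apart from the position of the walk and the
remaining time: the array of landmarks is `A`, the marks are those of the landmarks that have been
seen, and the queue holds those of them that have not been started from. The landmarks that have
not been seen are idle as well. -/
structure Core (A : ℕ → ℕ) (j : ℕ) (σ : Search (Fin n)) (a : Mem) : Prop where
  base : Base x p a
  ans : a rAns = 0
  rounds : a rRounds = j
  src : a rSrc = σ.src
  rem : a rRem = σ.rem
  rem_pos : 0 < σ.rem
  rem_le : σ.rem ≤ p.T
  src_mem : σ.src ∈ reached x p A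
  arr : ∀ b < p.q, a (64 + b) = A b
  arr_lt : ∀ b < p.q, A b < H
  seen_sub : σ.seen ⊆ reached x p A
  s_mem : x.s ∈ σ.seen
  t_notMem : x.t ∉ σ.seen
  mark : ∀ v : Fin n, v ≠ x.s → A (v / p.g) = v → (a (64 + p.q + v / p.g) ≠ 0 ↔ v ∈ σ.seen)
  mark_lt : ∀ b < p.q, a (64 + p.q + b) < H
  idle_sub : σ.idle ⊆ reached x p A
  idle_sup : reached x p A \ σ.seen ⊆ σ.idle
  head_le : a rHead ≤ a rTail
  tail : a rTail + 1 = σ.seen.card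
  queue : ∀ i, a rHead ≤ i → i < a rTail → ∃ v ∈ σ.seen, v ∈ σ.idle ∧ a (64 + p.q + p.q + i) = v
  queue_inj : ∀ i i', a rHead ≤ i → i < a rTail → a rHead ≤ i' → i' < a rTail →
    a (64 + p.q + p.q + i) = a (64 + p.q + p.q + i') → i = i'
  queue_surj : ∀ v ∈ σ.seen, v ∈ σ.idle →
    ∃ i, a rHead ≤ i ∧ i < a rTail ∧ a (64 + p.q + p.q + i) = v

theorem Core.congr {A : ℕ → ℕ} {j : ℕ} {σ : Search (Fin n)} {a b : Mem} (h : Core x p H A j σ a)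
    (hab : ∀ i, i < 26 ∨ (28 ≤ i ∧ i < 32) ∨ 64 ≤ i → b i = a i) : Core x p H A j σ b where
  base := h.base.congr fun i hi => hab i (Or.inl hi)
  ans := by rw [hab _ (by omega)]; exact h.ans
  rounds := by rw [hab _ (by omega)]; exact h.rounds
  src := by rw [hab _ (by omega)]; exact h.src
  rem := by rw [hab _ (by omega)]; exact h.rem
  rem_pos := h.rem_pos
  rem_le := h.rem_le
  src_mem := h.src_mem
  arr b hb := by rw [hab _ (by omega)]; exact h.arr b hb
  arr_lt := h.arr_lt
  seen_sub := h.seen_sub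
  s_mem := h.s_mem
  t_notMem := h.t_notMem
  mark v hv hA := by
    rw [hab _ (Or.inr (Or.inr (by rw [Nat.add_assoc]; exact Nat.le_add_right _ _)))]
    exact h.mark v hv hA
  mark_lt b hb := by rw [hab _ (by omega)]; exact h.mark_lt b hb
  idle_sub := h.idle_sub
  idle_sup := h.idle_sup
  head_le := by rw [hab _ (by omega), hab _ (by omega)]; exact h.head_le
  tail := by rw [hab _ (by omega)]; exact h.tail
  queue i := by
    rw [hab rHead (by omega), hab rTail (by omega), hab _ (by omega)]
    exact h.queue i
  queue_inj i i' := by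
    rw [hab rHead (by omega), hab rTail (by omega), hab (_ + i) (by omega), hab (_ + i') (by omega)]
    exact h.queue_inj i i'
  queue_surj v hv hv' := by
    obtain ⟨i, hi⟩ := h.queue_surj v hv hv'
    refine ⟨i, ?_⟩
    rw [hab rHead (by omega), hab rTail (by omega), hab _ (by omega)]
    exact hi

variable (x p) in
/-- What the proof of the search uses of its potential: `P` decreases in expectation, `P'` is its
value in the middle of a step, and it is at least `1` if the search fails. -/
structure IsPotential (hd : 0 < p.d) (A : ℕ → ℕ) (P : Search (Fin n) → ℕ → ℝ)
    (P' : Search (Fin n) → Fin n → ℕ → ℝ) : Prop where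
  nonneg : ∀ σ u e, 0 ≤ P' σ u e
  avg : ∀ σ e, (x.graph.metropolis p.d hd).avg σ.cur (fun u => P' σ u e) = P σ e
  timeout : ∀ σ u e, p.T ≤ e + 1 → 1 ≤ P' σ u e
  finished : ∀ (σ : Search (Fin n)) u e, u ∈ reached x p A → u ≠ x.t → x.t ∈ reached x p A →
    x.t ∉ σ.seen → σ.rem = 1 → σ.idle = reached x p A \ insert u σ.seen → 1 ≤ P' σ u e
  interior : ∀ (σ : Search (Fin n)) u e, u ∉ Search.boundary x.graph x.s (landmarks x p A) →
    P { σ with cur := u } (e + 1) ≤ P' σ u e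
  again : ∀ (σ : Search (Fin n)) u e, u ∈ reached x p A → 2 ≤ σ.rem →
    P ⟨σ.src, σ.src, σ.rem - 1, insert u σ.seen, σ.idle⟩ (e + 1) ≤ P' σ u e
  next : ∀ (σ : Search (Fin n)) u a e, u ∈ reached x p A → σ.rem = 1 → a ∈ insert u σ.seen →
    a ∈ σ.idle → P ⟨a, a, p.K * (x.graph.degree a / p.d + 1), insert u σ.seen, σ.idle.erase a⟩
      (e + 1) ≤ P' σ u e

theorem isPotential_one (hd : 0 < p.d) (A : ℕ → ℕ) :
    IsPotential x p hd A (fun _ _ => 1) (fun _ _ _ => 1) where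
  nonneg _ _ _ := zero_le_one
  avg _ _ := Network.avg_const _ _ _
  timeout _ _ _ _ := le_rfl
  finished _ _ _ _ _ _ _ _ _ := le_rfl
  interior _ _ _ _ := le_rfl
  again _ _ _ _ _ := le_rfl
  next _ _ _ _ _ _ _ _ := le_rfl

theorem isPotential_pot (hd : 0 < p.d) (hT : 0 < p.T) (hK : 0 < p.K) (A : ℕ → ℕ) :
    IsPotential x p hd A
      (Search.pot (x.graph.metropolis p.d hd) (Search.boundary x.graph x.s (landmarks x p A))
        (reached x p A) x.t (fun v => p.K * (x.graph.degree v / p.d + 1)) p.T)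
      (Search.potAt (x.graph.metropolis p.d hd) (Search.boundary x.graph x.s (landmarks x p A))
        (reached x p A) x.t (fun v => p.K * (x.graph.degree v / p.d + 1)) p.T) := by
  have hs : x.s ∈ landmarks x p A := mem_landmarks.2 (Or.inl rfl)
  have hbd := Search.exits_boundary (G := x.graph) hd hs
  have hΛ := Search.marks_subset_boundary (G := x.graph) (s := x.s) (L := landmarks x p A)
  exact {
    nonneg := Search.potAt_nonneg hbd hΛ
    avg := Search.avg_potAt _ _ _ _ _ _
    timeout := fun σ u e he => Search.one_le_potAt_of_timeout hbd hΛ hT σ u he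
    finished := fun σ u e hu hut ht hts hrem hidle =>
      Search.one_le_potAt_of_finished hbd hΛ σ e hu hut ht hts hrem hidle
    interior := fun σ u e hu => (Search.pot_of_interior hbd hΛ σ e hu).le
    again := fun σ u e hu hrem => Search.pot_of_again hbd hΛ σ e hu hrem
    next := fun σ u a e hu hrem ha hai =>
      Search.pot_of_next hbd hΛ σ e hu hrem ha hai (by positivity) }

/-! ### One iteration of the search -/

open Classical in
variable (x p) in
/-- The postcondition of a round when `j` rounds remain: `c` if the answer is still negative. -/
noncomputable def roundPost (j : ℕ) (c : ℝ) (a : Mem) : ℝ≥0∞ :=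
  if Base x p a ∧ (a rAns = 0 → a rRounds = j) then (if a rAns = 0 then ENNReal.ofReal c else 0)
  else ⊤

open Classical in
variable (x p H) in
/-- The invariant of the search, when at most `i` iterations remain: `c` times the potential of a
state that the memory represents. -/
noncomputable def searchInv (A : ℕ → ℕ) (P : Search (Fin n) → ℕ → ℝ) (j : ℕ) (c : ℝ) (i : ℕ)
    (a : Mem) : ℝ≥0∞ :=
  if a rBudget = 0 then roundPost x p j c a
  else ⨅ σ : Search (Fin n), if Core x p H A j σ a ∧ a rCur = σ.cur ∧
    x.graph.Reachable x.s σ.cur ∧ a rBudget ≤ p.T ∧ a rBudget ≤ i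
    then ENNReal.ofReal (c * P σ (p.T - a rBudget)) else ⊤

open Classical in
variable (x p H) in
/-- The assertion after the step of the walk. -/
noncomputable def movedInv (A : ℕ → ℕ) (P' : Search (Fin n) → Fin n → ℕ → ℝ) (j : ℕ) (c : ℝ)
    (i : ℕ) (a : Mem) : ℝ≥0∞ :=
  ⨅ z : Search (Fin n) × Fin n, if Core x p H A j z.1 a ∧ a rCur = z.2 ∧
    x.graph.Reachable x.s z.2 ∧ a rBudget < p.T ∧ a rBudget ≤ i
    then ENNReal.ofReal (c * P' z.1 z.2 (p.T - (a rBudget + 1))) else ⊤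

theorem searchInv_le {A : ℕ → ℕ} {P : Search (Fin n) → ℕ → ℝ} {j : ℕ} {c : ℝ} {a : Mem}
    {σ : Search (Fin n)} {V : ℝ} {B : ℕ} (hc : 0 ≤ c) (hcore : Core x p H A j σ a)
    (hcur : a rCur = σ.cur) (hreach : x.graph.Reachable x.s σ.cur) (hB : a rBudget = B)
    (hBT : B ≤ p.T) {i : ℕ} (hBi : B ≤ i) (h0 : B = 0 → 1 ≤ V) (hV : P σ (p.T - B) ≤ V) :
    searchInv x p H A P j c i a ≤ ENNReal.ofReal (c * V) := by
  unfold searchInv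
  split_ifs with hb
  · rw [roundPost, if_pos ⟨hcore.base, fun _ => hcore.rounds⟩, if_pos hcore.ans]
    apply ENNReal.ofReal_le_ofReal
    exact le_mul_of_one_le_right hc (h0 (hB ▸ hb))
  · refine (iInf_le _ σ).trans ?_
    rw [if_pos ⟨hcore, hcur, hreach, hB ▸ hBT, hB ▸ hBi⟩, hB]
    exact ENNReal.ofReal_le_ofReal (mul_le_mul_of_nonneg_left hV hc)

section iteration

variable {A : ℕ → ℕ} {j : ℕ} {σ : Search (Fin n)} {a : Mem} {c : ℝ}
  {P : Search (Fin n) → ℕ → ℝ} {P' : Search (Fin n) → Fin n → ℕ → ℝ}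

/-- Truncated subtraction computes the minimum: `D - (D - d) = min d D`. -/
theorem cutDegEx_ev {e : Ex} {v : Fin n} (he : e.ev w M x a = v) (hd : a rDeg = p.d) :
    (cutDegEx e).ev w M x a = x.graph.cutDeg p.d v := by
  simp only [cutDegEx, Ex.ev, BinOp.eval, he, USTCON.degQuery_val, hd, SimpleGraph.cutDeg]
  omega

theorem cutDegEx_safe (hf : Fits (n := n) w M p H) {e : Ex} (he : e.Safe w M x a)
    (hd : a rDeg = p.d) : (cutDegEx e).Safe w M x a := by
  have h1 := x.degQuery_lt hf.n_pos (e.ev w M x a)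
  have h2 := hf.two_H_lt
  have h3 := hf.n_lt
  have h4 := hf.d_lt
  simp only [cutDegEx, Ex.Safe, Ex.ev, BinOp.eval, he, hd, Visible, true_and]
  omega

/-- The step of the program is the step of the Metropolis walk. -/
theorem walkStep_le (hf : Fits (n := n) w M p H) (hp : IsPotential x p hf.d_pos A P P')
    (hc : 0 ≤ c) (hcore : Core x p H A j σ a) (hcur : a rCur = σ.cur)
    (hreach : x.graph.Reachable x.s σ.cur) {B : ℕ} (hB : a rBudget = B + 1) (hBT : B < p.T)
    {i : ℕ} (hBi : B ≤ i) :
    walkStep.wp w M x (movedInv x p H A P' j c i) a ≤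
      ENNReal.ofReal (c * P σ (p.T - (B + 1))) := by
  have hM : 64 ≤ M := by have := hf.cells; omega
  have h2 := hf.two_H_lt
  have h3 := hf.n_lt
  have h4 := hf.d_lt
  have h5 := hf.T_lt
  have hdeg := hcore.base.deg
  have hcurlt := σ.cur.2
  have hD : x.graph.degree σ.cur < n := by simpa using x.graph.degree_lt_card_verts σ.cur
  set e := x.graph.cutDeg p.d σ.cur with he
  have hedeg : ∀ v, x.graph.cutDeg p.d v ≤ x.graph.degree v := fun v => min_le_right _ _
  have hdeglt : ∀ v, x.graph.degree v < n := fun v => by simpa using x.graph.degree_lt_card_verts v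
  unfold walkStep
  refine wp_set_le (v := B) (by simp [Ex.ev, BinOp.eval, hB])
    (by simp only [Ex.Safe, Ex.ev, BinOp.eval, hB, Visible]; omega) ?_
  refine wp_set_le (v := e) (cutDegEx_ev (by simpa [Ex.ev] using hcur) (by simpa using hdeg))
    (cutDegEx_safe hf (by simp [-Nat.one_lt_two_pow_iff, Ex.Safe, Visible, hcur]; omega)
      (by simpa using hdeg)) ?_
  refine wp_rnd_le (k := x.graph.degree σ.cur - 1)
    (W := fun y => ENNReal.ofReal (c * ((∑ k ∈ Finset.range
      (max e (x.graph.cutDeg p.d (x.nbrNode hf.n_pos σ.cur y)) - 1 + 1),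
        P' σ (if k < e then x.nbrNode hf.n_pos σ.cur y else σ.cur) (p.T - (B + 1))) /
        (max e (x.graph.cutDeg p.d (x.nbrNode hf.n_pos σ.cur y)) - 1 + 1 : ℕ))))
    (by simp [Ex.ev, BinOp.eval, hcur, USTCON.degQuery_val])
    (by
      simp [-Nat.one_lt_two_pow_iff, Ex.Safe, Ex.ev, BinOp.eval, Visible, hcur, USTCON.degQuery_val]
      omega) ?_ ?_
  · intro y hy
    set u := x.nbrNode hf.n_pos σ.cur y with hu
    have hult := u.2
    have hudeg := hdeglt u
    have huc := hedeg u
    have hec := hedeg σ.cur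
    rw [← he] at hec
    refine wp_set_le (v := u) (by simp [Ex.ev, hcur, USTCON.nbrQuery_val x hf.n_pos, hu])
      (by
        simp [-Nat.one_lt_two_pow_iff, Ex.Safe, Ex.ev, Visible, hcur,
          USTCON.nbrQuery_val x hf.n_pos, ← hu]
        omega) ?_
    refine wp_set_le (v := x.graph.cutDeg p.d u)
      (cutDegEx_ev (by simp [Ex.ev]) (by simpa using hdeg))
      (cutDegEx_safe hf (by simp [-Nat.one_lt_two_pow_iff, Ex.Safe, Visible]; omega)
        (by simpa using hdeg)) ?_
    refine wp_rnd_le (k := max e (x.graph.cutDeg p.d u) - 1)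
      (W := fun k => ENNReal.ofReal (c * P' σ (if k < e then u else σ.cur) (p.T - (B + 1))))
      (by simp [Ex.ev, BinOp.eval]; omega)
      (by simp [-Nat.one_lt_two_pow_iff, Ex.Safe, Ex.ev, BinOp.eval, Visible]; omega) ?_ ?_
    · intro k hk
      refine wp_ite_less_le (by simp [Ex.Safe, Visible]; omega) (by simp [Ex.Safe, Visible]; omega)
        (by omega) (fun h => ?_) fun h => ?_
      · have hk : k < e := by simpa [Ex.ev] using h
        refine wp_set_le (v := u) (by simp [Ex.ev])
          (by simp [-Nat.one_lt_two_pow_iff, Ex.Safe, Visible]; omega) ?_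
        refine (iInf_le _ (σ, u)).trans ?_
        have hdpos : 0 < x.graph.degree σ.cur := by omega
        have hadj : x.graph.Adj σ.cur u := x.adj_nbrNode hf.n_pos (by omega)
        rw [if_pos, if_pos hk]
        · simp
        · refine ⟨hcore.congr fun i hi => ?_, by simp, hreach.trans hadj.reachable, by simpa,
            by simpa⟩
          simp only [Function.update_apply]
          repeat rw [if_neg (by omega)]
      · have hk : ¬ k < e := by simpa [Ex.ev] using h
        refine (iInf_le _ (σ, σ.cur)).trans ?_
        rw [if_pos, if_neg hk]
        · simp
        · refine ⟨hcore.congr fun i hi => ?_, by simpa using hcur, hreach, by simpa, by simpa⟩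
          simp only [Function.update_apply]
          repeat rw [if_neg (by omega)]
    · rw [sum_ofReal_div (by omega) fun k _ => mul_nonneg hc (hp.nonneg _ _ _)]
      rw [← Finset.mul_sum, mul_div_assoc]
  · rw [sum_ofReal_div (by omega) fun k _ => mul_nonneg hc (div_nonneg
      (Finset.sum_nonneg fun _ _ => hp.nonneg _ _ _) (Nat.cast_nonneg _))]
    rw [← Finset.mul_sum, mul_div_assoc, ← hp.avg,
      ← x.avg_metropolis hf.n_pos hf.d_pos σ.cur fun u => P' σ u (p.T - (B + 1))]

end iteration

/-! ### Landmarks that the walk meets -/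

section inspection

variable {n : ℕ} {x : USTCON n} {w M : ℕ} {p : Params} {H : ℕ}
  {A : ℕ → ℕ} {j : ℕ} {σ : Search (Fin n)} {a : Mem} {c : ℝ}
  {P : Search (Fin n) → ℕ → ℝ} {P' : Search (Fin n) → Fin n → ℕ → ℝ}

theorem Core.setCur (h : Core x p H A j σ a) (u : Fin n) : Core x p H A j { σ with cur := u } a :=
  { h with }

/-- The memory after the next excursion from the same landmark has been started. -/
theorem Core.again (h : Core x p H A j σ a) (hrem : 2 ≤ σ.rem) {b : Mem}
    (hr : b rRem = σ.rem - 1)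
    (hab : ∀ i, i ≠ rRem → i ≠ rCur → b i = a i) :
    Core x p H A j ⟨σ.src, σ.src, σ.rem - 1, σ.seen, σ.idle⟩ b where
  base := h.base.congr fun i hi => hab i (by omega) (by omega)
  ans := by rw [hab _ (by omega) (by omega)]; exact h.ans
  rounds := by rw [hab _ (by omega) (by omega)]; exact h.rounds
  src := by rw [hab _ (by omega) (by omega)]; exact h.src
  rem := hr
  rem_pos := by dsimp only; omega
  rem_le := (Nat.sub_le _ _).trans h.rem_le
  src_mem := h.src_mem
  arr b hb := by rw [hab _ (by omega) (by omega)]; exact h.arr b hb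
  arr_lt := h.arr_lt
  seen_sub := h.seen_sub
  s_mem := h.s_mem
  t_notMem := h.t_notMem
  mark v := by
    generalize hk : (v : ℕ) / p.g = k
    rw [hab _ (by omega) (by omega), ← hk]
    exact h.mark v
  mark_lt b hb := by rw [hab _ (by omega) (by omega)]; exact h.mark_lt b hb
  idle_sub := h.idle_sub
  idle_sup := h.idle_sup
  head_le := by
    rw [hab _ (by omega) (by omega), hab _ (by omega) (by omega)]; exact h.head_le
  tail := by rw [hab _ (by omega) (by omega)]; exact h.tail
  queue i := by
    rw [hab rHead (by omega) (by omega), hab rTail (by omega) (by omega),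
      hab _ (by omega) (by omega)]
    exact h.queue i
  queue_inj i i' := by
    rw [hab rHead (by omega) (by omega), hab rTail (by omega) (by omega),
      hab (_ + i) (by omega) (by omega), hab (_ + i') (by omega) (by omega)]
    exact h.queue_inj i i'
  queue_surj v hv hv' := by
    obtain ⟨i, hi⟩ := h.queue_surj v hv hv'
    refine ⟨i, ?_⟩
    rw [hab rHead (by omega) (by omega), hab rTail (by omega) (by omega),
      hab _ (by omega) (by omega)]
    exact hi

/-- The memory after the next landmark has been taken from the queue. -/
theorem Core.next (h : Core x p H A j σ a) {v : Fin n} (hv : v ∈ σ.seen) (hvi : v ∈ σ.idle)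
    (hlt : a rHead < a rTail) (hhead : a (64 + p.q + p.q + a rHead) = v) {k : ℕ} (hk : 0 < k)
    (hkT : k ≤ p.T) {b : Mem} (hs : b rSrc = v) (hr : b rRem = k) (hh : b rHead = a rHead + 1)
    (hab : ∀ i, i ≠ rRem → i ≠ rCur → i ≠ rSrc → i ≠ rHead → b i = a i) :
    Core x p H A j ⟨v, v, k, σ.seen, σ.idle.erase v⟩ b where
  base := h.base.congr fun i hi => hab i (by omega) (by omega) (by omega) (by omega)
  ans := by rw [hab _ (by omega) (by omega) (by omega) (by omega)]; exact h.ans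
  rounds := by rw [hab _ (by omega) (by omega) (by omega) (by omega)]; exact h.rounds
  src := hs
  rem := hr
  rem_pos := hk
  rem_le := hkT
  src_mem := h.seen_sub hv
  arr b hb := by rw [hab _ (by omega) (by omega) (by omega) (by omega)]; exact h.arr b hb
  arr_lt := h.arr_lt
  seen_sub := h.seen_sub
  s_mem := h.s_mem
  t_notMem := h.t_notMem
  mark v := by
    generalize hk : (v : ℕ) / p.g = k
    rw [hab _ (by omega) (by omega) (by omega) (by omega), ← hk]
    exact h.mark v
  mark_lt b hb := by rw [hab _ (by omega) (by omega) (by omega) (by omega)]; exact h.mark_lt b hb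
  idle_sub := (Finset.erase_subset _ _).trans h.idle_sub
  idle_sup u hu := by
    refine Finset.mem_erase.2 ⟨?_, h.idle_sup hu⟩
    rintro rfl
    exact (Finset.mem_sdiff.1 hu).2 hv
  head_le := by rw [hh, hab rTail (by omega) (by omega) (by omega) (by omega)]; exact hlt
  tail := by rw [hab _ (by omega) (by omega) (by omega) (by omega)]; exact h.tail
  queue i h1 h2 := by
    rw [hh] at h1
    rw [hab rTail (by omega) (by omega) (by omega) (by omega)] at h2
    obtain ⟨u, hu, hui, hau⟩ := h.queue i (by omega) h2
    refine ⟨u, hu, Finset.mem_erase.2 ⟨?_, hui⟩, ?_⟩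
    · rintro rfl
      have := h.queue_inj i (a rHead) (by omega) h2 le_rfl hlt (hau.trans hhead.symm)
      omega
    · rw [hab _ (by omega) (by omega) (by omega) (by omega)]
      exact hau
  queue_inj i i' h1 h2 h3 h4 h5 := by
    rw [hh] at h1 h3
    rw [hab rTail (by omega) (by omega) (by omega) (by omega)] at h2 h4
    rw [hab _ (by omega) (by omega) (by omega) (by omega),
      hab _ (by omega) (by omega) (by omega) (by omega)] at h5
    exact h.queue_inj i i' (by omega) h2 (by omega) h4 h5
  queue_surj u hu hui := by
    obtain ⟨hne, hui⟩ := Finset.mem_erase.1 hui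
    obtain ⟨i, h1, h2, h3⟩ := h.queue_surj u hu hui
    refine ⟨i, ?_, ?_, ?_⟩
    · rw [hh]
      rcases Nat.eq_or_lt_of_le h1 with h4 | h4
      · rw [← h4, hhead] at h3
        exact absurd (Fin.ext h3).symm hne
      · exact h4
    · rw [hab rTail (by omega) (by omega) (by omega) (by omega)]
      exact h2
    · rw [hab _ (by omega) (by omega) (by omega) (by omega)]
      exact h3

/-- Every block has at most one landmark besides `s` and `t`. Hence the queue fits into `q` cells. -/
theorem card_seen_le (hf : Fits (n := n) w M p H) {S : Finset (Fin n)} (hS : S ⊆ reached x p A)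
    (ht : x.t ∉ S) : S.card ≤ p.q + 1 := by
  have h1 : (S.erase x.s).card ≤ (Finset.range p.q).card := by
    refine Finset.card_le_card_of_injOn (fun v => (v : ℕ) / p.g) ?_ ?_
    · intro v _
      exact Finset.mem_coe.2 (Finset.mem_range.2 (hf.div_lt v))
    · have key : ∀ v ∈ S.erase x.s, A ((v : ℕ) / p.g) = v := by
        intro v hv
        obtain ⟨hvs, hvS⟩ := Finset.mem_erase.1 hv
        rcases mem_landmarks.1 (Search.mem_marks.1 (hS hvS)).1 with h | h | h
        · exact absurd h hvs
        · exact absurd (h ▸ hvS) ht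
        · exact h
      intro v hv u hu huv
      apply Fin.ext
      rw [← key v hv, ← key u hu]
      exact congrArg A huv
  rw [Finset.card_range] at h1
  have := Finset.pred_card_le_card_erase (s := S) (a := x.s)
  omega

/-- The memory after a new landmark has been marked and appended to the queue. -/
theorem Core.push (hf : Fits (n := n) w M p H) (h : Core x p H A j σ a) {u : Fin n}
    (hus : u ≠ x.s) (hut : u ≠ x.t) (hA : A (u / p.g) = u) (hu : u ∈ reached x p A)
    (hun : u ∉ σ.seen) {b : Mem} (hm : b (64 + p.q + u / p.g) = 1)
    (hq : b (64 + p.q + p.q + a rTail) = u) (ht : b rTail = a rTail + 1)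
    (hab : ∀ i, i ≠ 64 + p.q + u / p.g → i ≠ 64 + p.q + p.q + a rTail → i ≠ rTail → b i = a i) :
    Core x p H A j { σ with seen := insert u σ.seen } b := by
  have hlt := hf.div_lt u
  have hdiv : ∀ v : Fin n, v ≠ x.s → A (v / p.g) = v → v ≠ u → (v : ℕ) / p.g ≠ u / p.g := by
    intro v _ hAv hne he
    rw [he, hA] at hAv
    exact hne (Fin.ext hAv).symm
  have hdlt := hf.div_lt
  have hblk : ∃ k, k = (u : ℕ) / p.g := ⟨_, rfl⟩
  obtain ⟨k, hk⟩ := hblk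
  rw [← hk] at hm hab hlt hdiv
  have hcells := hf.cells
  exact {
    base := h.base.congr fun i hi => hab i (by omega) (by omega) (by omega)
    ans := by rw [hab _ (by omega) (by omega) (by omega)]; exact h.ans
    rounds := by rw [hab _ (by omega) (by omega) (by omega)]; exact h.rounds
    src := by rw [hab _ (by omega) (by omega) (by omega)]; exact h.src
    rem := by rw [hab _ (by omega) (by omega) (by omega)]; exact h.rem
    rem_pos := h.rem_pos
    rem_le := h.rem_le
    src_mem := h.src_mem
    arr := fun i hi => by rw [hab _ (by omega) (by omega) (by omega)]; exact h.arr i hi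
    arr_lt := h.arr_lt
    seen_sub := Finset.insert_subset hu h.seen_sub
    s_mem := Finset.mem_insert_of_mem h.s_mem
    t_notMem := by
      rw [Finset.mem_insert, not_or]
      exact ⟨hut.symm, h.t_notMem⟩
    mark := fun v hvs hAv => by
      rcases eq_or_ne v u with rfl | hvu
      · rw [← hk, hm]; simp
      · have h1 := hdiv v hvs hAv hvu
        have h2 := h.mark v hvs hAv
        have h3 := hdlt v
        generalize (v : ℕ) / p.g = i at h1 h2 h3
        rw [hab _ (by omega) (by omega) (by omega), h2, Finset.mem_insert]
        exact ⟨Or.inr, fun h => h.resolve_left hvu⟩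
    mark_lt := fun i hi => by
      rcases eq_or_ne i k with rfl | hik
      · rw [hm]; have := hf.H_ge; omega
      · rw [hab _ (by omega) (by omega) (by omega)]; exact h.mark_lt i hi
    idle_sub := h.idle_sub
    idle_sup := (Finset.sdiff_subset_sdiff le_rfl (Finset.subset_insert _ _)).trans h.idle_sup
    head_le := by
      rw [hab rHead (by omega) (by omega) (by omega), ht]
      exact h.head_le.trans (Nat.le_succ _)
    tail := by rw [ht, Finset.card_insert_of_notMem hun, h.tail]
    queue := fun i h1 h2 => by
      rw [hab rHead (by omega) (by omega) (by omega)] at h1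
      rw [ht] at h2
      rcases Nat.lt_succ_iff_lt_or_eq.1 h2 with h3 | rfl
      · obtain ⟨v, hv, hvi, hav⟩ := h.queue i h1 h3
        refine ⟨v, Finset.mem_insert_of_mem hv, hvi, ?_⟩
        rw [hab _ (by omega) (by omega) (by omega)]
        exact hav
      · exact ⟨u, Finset.mem_insert_self _ _, h.idle_sup (Finset.mem_sdiff.2 ⟨hu, hun⟩), hq⟩
    queue_inj := by
      have key : ∀ i, a rHead ≤ i → i < a rTail →
          b (64 + p.q + p.q + i) ≠ b (64 + p.q + p.q + a rTail) := by
        intro i h1 h2 h3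
        obtain ⟨v, hv, _, hav⟩ := h.queue i h1 h2
        rw [hab _ (by omega) (by omega) (by omega), hav, hq] at h3
        exact hun (Fin.ext h3 ▸ hv)
      intro i i' h1 h2 h3 h4 h5
      rw [hab rHead (by omega) (by omega) (by omega)] at h1 h3
      rw [ht] at h2 h4
      rcases Nat.lt_succ_iff_lt_or_eq.1 h2 with h6 | h6 <;>
        rcases Nat.lt_succ_iff_lt_or_eq.1 h4 with h7 | h7
      · rw [hab _ (by omega) (by omega) (by omega),
          hab _ (by omega) (by omega) (by omega)] at h5
        exact h.queue_inj i i' h1 h6 h3 h7 h5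
      · exact absurd (h7 ▸ h5) (key i h1 h6)
      · exact absurd (h6 ▸ h5).symm (key i' h3 h7)
      · rw [h6, h7]
    queue_surj := fun v hv hvi => by
      rw [hab rHead (by omega) (by omega) (by omega), ht]
      rcases Finset.mem_insert.1 hv with rfl | hv
      · exact ⟨a rTail, h.head_le, Nat.lt_succ_self _, hq⟩
      · obtain ⟨i, h1, h2, h3⟩ := h.queue_surj v hv hvi
        refine ⟨i, h1, by omega, ?_⟩
        rw [hab _ (by omega) (by omega) (by omega)]
        exact h3 }

/-- The end of an excursion at the landmark `u` of the component of `s`. If the queue is empty, then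
the seen landmarks are closed under excursions, and the potential is at least `1` unless `c = 0`. -/
theorem endExcursion_le (hf : Fits (n := n) w M p H) (hp : IsPotential x p hf.d_pos A P P')
    (hc : 0 ≤ c) (hconn : c = 0 ∨ x.Connected) {u : Fin n} (hu : u ∈ reached x p A)
    (hut : u ≠ x.t) (hts : x.t ∉ σ.seen)
    (hcore : Core x p H A j { σ with seen := insert u σ.seen } a) {B : ℕ} (hB : a rBudget = B)
    (hBT : B < p.T) {i : ℕ} (hBi : B ≤ i) :
    endExcursion.wp w M x (searchInv x p H A P j c i) a ≤
      ENNReal.ofReal (c * P' σ u (p.T - (B + 1))) := by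
  have hM : 64 ≤ M := by have := hf.cells; omega
  have h2 := hf.two_H_lt
  have h3 := hf.n_lt
  have h4 := hf.d_lt
  have h5 := hf.T_lt
  have hqn := hf.q_le
  have hB0 : B = 0 → 1 ≤ P' σ u (p.T - (B + 1)) := fun h0 => hp.timeout _ _ _ (by omega)
  have hBe : p.T - B = p.T - (B + 1) + 1 := by omega
  have hrem := hcore.rem
  have hremT := hcore.rem_le
  have hsrc := hcore.src
  have hqq := hcore.base.blocks
  have hKK := hcore.base.mult
  have hdd := hcore.base.deg
  have hcard := card_seen_le hf hcore.seen_sub hcore.t_notMem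
  have htail := hcore.tail
  have hheadle := hcore.head_le
  dsimp only at hrem hremT hsrc hcard htail
  have hsrclt := σ.src.2
  have hreach : ∀ v ∈ reached x p A, x.graph.Reachable x.s v := fun v hv =>
    (Search.mem_marks.1 hv).2
  unfold endExcursion
  refine wp_ite_less_le (by simp [-Nat.one_lt_two_pow_iff, Ex.Safe]; omega)
    (by simp [Ex.Safe, Visible, hrem]; omega) (by omega) (fun hc1 => ?_) fun hc1 => ?_
  · have hrem2 : 2 ≤ σ.rem := by
      have : 1 < σ.rem := by simpa [Ex.ev, hrem] using hc1
      omega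
    refine wp_set_le (v := σ.rem - 1) (by simp [Ex.ev, BinOp.eval, hrem])
      (by simp [-Nat.one_lt_two_pow_iff, Ex.Safe, Ex.ev, BinOp.eval, Visible, hrem]; omega) ?_
    refine wp_set_le (v := σ.src) (by simpa [Ex.ev] using hsrc)
      (by simp [-Nat.one_lt_two_pow_iff, Ex.Safe, Visible, hsrc]; omega) ?_
    refine searchInv_le hc (hcore.again hrem2 (by simp) fun i h1 h2 => ?_) (by simp)
      (hreach _ hcore.src_mem) (by simpa using hB) hBT.le hBi hB0 ?_
    · rw [Function.update_of_ne h2, Function.update_of_ne h1]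
    · rw [hBe]
      exact hp.again σ u _ hu hrem2
  · have hrem1 : σ.rem = 1 := by
      have h1 : ¬ 1 < σ.rem := by simpa [Ex.ev, hrem] using hc1
      have := hcore.rem_pos
      dsimp only at this
      omega
    refine wp_ite_less_le (by simp [Ex.Safe, Visible]; omega) (by simp [Ex.Safe, Visible]; omega)
      (by omega) (fun hc2 => ?_) fun hc2 => ?_
    · have hlt : a rHead < a rTail := hc2
      obtain ⟨v, hv, hvi, hav⟩ := hcore.queue (a rHead) le_rfl hlt
      have hvlt := v.2
      have hdegv : x.graph.degree v < n := by simpa using x.graph.degree_lt_card_verts v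
      have hdivle : x.graph.degree v / p.d ≤ x.graph.degree v := Nat.div_le_self _ _
      have hkT : p.K * (x.graph.degree v / p.d + 1) ≤ p.T :=
        (Nat.mul_le_mul_left _ (by omega)).trans hf.K_le
      have hKlt := hf.K_lt
      refine wp_set_le (v := v) (by
          simp [queueStart, Ex.ev, BinOp.eval, hqq]
          exact hav)
        (by
          simp [-Nat.one_lt_two_pow_iff, queueStart, Ex.Safe, Ex.ev, BinOp.eval, Visible, hqq]
          omega) ?_
      refine wp_set_le (v := a rHead + 1) (by simp [Ex.ev, BinOp.eval])
        (by simp [-Nat.one_lt_two_pow_iff, Ex.Safe, Ex.ev, BinOp.eval, Visible]; omega) ?_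
      refine wp_set_le (v := p.K * (x.graph.degree v / p.d + 1))
        (by simp [Ex.ev, BinOp.eval, hKK, hdd, USTCON.degQuery_val])
        (by
          simp [-Nat.one_lt_two_pow_iff, Ex.Safe, Ex.ev, BinOp.eval, Visible, hKK, hdd,
            USTCON.degQuery_val]
          generalize x.graph.degree v / p.d = y at *
          generalize p.K * (y + 1) = z at *
          omega) ?_
      refine wp_set_le (v := v) (by simp [Ex.ev])
        (by simp [-Nat.one_lt_two_pow_iff, Ex.Safe, Visible]; omega) ?_
      refine searchInv_le hc (hcore.next hv hvi hlt hav
        (k := p.K * (x.graph.degree v / p.d + 1)) (Nat.mul_pos hf.K_pos (Nat.succ_pos _)) hkT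
        (by simp) (by simp) (by simp) fun i h1 h2 h3 h4 => ?_) (by simp)
        (hreach _ (hcore.seen_sub hv)) (by simpa using hB) hBT.le hBi hB0 ?_
      · rw [Function.update_of_ne h2, Function.update_of_ne h1, Function.update_of_ne h4,
          Function.update_of_ne h3]
      · rw [hBe]
        exact hp.next σ u v _ hu hrem1 hv hvi
    · have hle : ¬ a rHead < a rTail := hc2
      refine wp_set_le (v := 0) (by simp [Ex.ev])
        (by simp [-Nat.one_lt_two_pow_iff, Ex.Safe]) ?_
      have hans := hcore.ans
      have hround := hcore.rounds
      rw [searchInv, if_pos (by simp), roundPost, if_pos, if_pos (by simpa using hans)]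
      · apply ENNReal.ofReal_le_ofReal
        rcases hconn with rfl | hconn
        · simp
        refine le_mul_of_one_le_right hc (hp.finished σ u _ hu hut ?_ hts hrem1 ?_)
        · exact Search.mem_marks.2 ⟨mem_landmarks.2 (Or.inr (Or.inl rfl)), hconn⟩
        · refine Finset.Subset.antisymm (fun v hv => Finset.mem_sdiff.2
            ⟨hcore.idle_sub hv, fun hvs => ?_⟩) hcore.idle_sup
          obtain ⟨i, hi⟩ := hcore.queue_surj v hvs hv
          omega
      · refine ⟨hcore.base.congr fun i hi => ?_, fun _ => by simpa using hround⟩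
        rw [Function.update_of_ne (by omega)]

/-- The inspection of the node `u` to which the walk has moved. -/
theorem inspect_le (hf : Fits (n := n) w M p H) (hp : IsPotential x p hf.d_pos A P P')
    (hc : 0 ≤ c) (hconn : c = 0 ∨ x.Connected) {u : Fin n} (hcore : Core x p H A j σ a)
    (hcur : a rCur = u) (hreach : x.graph.Reachable x.s u) {B : ℕ} (hB : a rBudget = B)
    (hBT : B < p.T) {i : ℕ} (hBi : B ≤ i) :
    inspect.wp w M x (searchInv x p H A P j c i) a ≤
      ENNReal.ofReal (c * P' σ u (p.T - (B + 1))) := by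
  have hM : 64 ≤ M := by have := hf.cells; omega
  have h2 := hf.two_H_lt
  have h3 := hf.n_lt
  have h4 := hf.d_lt
  have h5 := hf.T_lt
  have hqn := hf.q_le
  have hult := u.2
  have htlt := x.t.2
  have hslt := x.s.2
  have htt := hcore.base.target
  have hss := hcore.base.source
  have hww := hcore.base.width
  have hqq := hcore.base.blocks
  have hdiv := hf.div_lt u
  have hgle := hf.g_le
  have harr := hcore.arr _ hdiv
  have harrlt := hcore.arr_lt _ hdiv
  have hmarklt := hcore.mark_lt _ hdiv
  have hcells := hf.cells
  unfold inspect
  refine wp_ite_equal_le (by simp [Ex.Safe, Visible, hcur]; omega)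
    (by simp [Ex.Safe, Visible, htt]; omega) (by omega) (fun hc1 => ?_) fun hc1 => ?_
  · have hut : u = x.t := by
      have : (u : ℕ) = x.t := by simpa [Ex.ev, hcur, htt] using hc1
      exact Fin.ext this
    have hx : x.Connected := by
      unfold USTCON.Connected
      rw [← hut]
      exact hreach
    have hM1 : Visible rAns := Or.inl rfl
    have key : (Cmd.seq (.set rBudget (.lit 0)) (.set rRounds (.lit 0))).wp w M x
        (searchInv x p H A P j c i) (Function.update a rAns 1) ≤
        ENNReal.ofReal (c * P' σ u (p.T - (B + 1))) := by
      refine wp_set_le (v := 0) (by simp [Ex.ev]) (by simp [-Nat.one_lt_two_pow_iff, Ex.Safe]) ?_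
      refine wp_set_le (v := 0) (by simp [Ex.ev]) (by simp [-Nat.one_lt_two_pow_iff, Ex.Safe]) ?_
      rw [searchInv, if_pos (by simp), roundPost, if_pos, if_neg (by simp)]
      · exact zero_le
      · refine ⟨?_, fun h => absurd h (by simp)⟩
        have hb := hcore.base
        constructor
        · simpa using hb.nodes
        · simpa using hb.source
        · simpa using hb.target
        · simpa using hb.blocks
        · simpa using hb.width
        · simpa using hb.deg
        · simpa using hb.mult
        · simpa using hb.time
        · exact fun _ => hx
        · simp
    rw [Cmd.wp, Cmd.wp, if_pos]
    · exact key
    · exact ⟨by decide, hM1, by omega, by simp [-Nat.one_lt_two_pow_iff, Ex.Safe]; omega⟩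
  have hut : u ≠ x.t := by
    have h1 : ¬ (u : ℕ) = x.t := by simpa [Ex.ev, hcur, htt] using hc1
    exact fun h => h1 (h ▸ rfl)
  refine wp_ite_equal_le (by simp [Ex.Safe, Visible, hcur]; omega)
    (by simp [Ex.Safe, Visible, hss]; omega) (by omega) (fun hc2 => ?_) fun hc2 => ?_
  · have hus : u = x.s := by
      have : (u : ℕ) = x.s := by simpa [Ex.ev, hcur, hss] using hc2
      exact Fin.ext this
    have hseen : u ∈ σ.seen := hus ▸ hcore.s_mem
    refine endExcursion_le hf hp hc hconn (hcore.seen_sub hseen) hut hcore.t_notMem ?_ hB hBT hBi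
    rw [Finset.insert_eq_of_mem hseen]
    exact hcore
  have hus : u ≠ x.s := by
    have h1 : ¬ (u : ℕ) = x.s := by simpa [Ex.ev, hcur, hss] using hc2
    exact fun h => h1 (h ▸ rfl)
  have hload : (Ex.ld landmarkAddr).ev w M x a = A (u / p.g) := by
    simp only [landmarkAddr, Ex.ev, BinOp.eval, hcur, hww]
    exact harr
  refine wp_ite_equal_le (by
    simp [-Nat.one_lt_two_pow_iff, landmarkAddr, Ex.Safe, Ex.ev, BinOp.eval, Visible, hcur, hww,
      harr]
    generalize (u : ℕ) / p.g = k at *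
    omega) (by simp [Ex.Safe, Visible, hcur]; omega) (by omega) (fun hc3 => ?_) fun hc3 => ?_
  · have hA : A (u / p.g) = u := by
      rw [hload] at hc3
      exact hc3.trans hcur
    have huΛ : u ∈ reached x p A :=
      Search.mem_marks.2 ⟨mem_landmarks.2 (Or.inr (Or.inr hA)), hreach⟩
    have hmark := hcore.mark u hus hA
    have hmarkev : (Ex.ld markAddr).ev w M x a = a (64 + p.q + u / p.g) := by
      simp only [markAddr, Ex.ev, BinOp.eval, hcur, hww, hqq]
    refine wp_ite_le (by
      simp [-Nat.one_lt_two_pow_iff, markAddr, Ex.Safe, Ex.ev, BinOp.eval, Visible, hcur, hww, hqq]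
      generalize (u : ℕ) / p.g = k at *
      omega) (fun hc4 => ?_) fun hc4 => ?_
    · rw [hmarkev, hmark] at hc4
      refine endExcursion_le hf hp hc hconn huΛ hut hcore.t_notMem ?_ hB hBT hBi
      rw [Finset.insert_eq_of_mem hc4]
      exact hcore
    · have hun : u ∉ σ.seen := by
        rw [hmarkev] at hc4
        exact fun h => hmark.2 h hc4
      have hcard := card_seen_le hf (Finset.insert_subset huΛ hcore.seen_sub) (by
        rw [Finset.mem_insert, not_or]
        exact ⟨hut.symm, hcore.t_notMem⟩)
      rw [Finset.card_insert_of_notMem hun, ← hcore.tail] at hcard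
      obtain ⟨k, hk⟩ : ∃ k, (u : ℕ) / p.g = k := ⟨_, rfl⟩
      have hkq : k < p.q := hk ▸ hdiv
      unfold push
      refine wp_put_le (r := 64 + p.q + k) (v := 1)
        (by simp [markAddr, Ex.ev, BinOp.eval, hcur, hww, hqq, hk]) (by simp [Ex.ev])
        (by
          simp [-Nat.one_lt_two_pow_iff, markAddr, Ex.Safe, Ex.ev, BinOp.eval, Visible, hcur, hww,
            hqq, hk]
          omega)
        (by simp [-Nat.one_lt_two_pow_iff, Ex.Safe]; omega) (by omega) (by omega) ?_
      have hlow : ∀ i < 64, Function.update a (64 + p.q + k) 1 i = a i := fun i hi => by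
        rw [Function.update_of_ne (by omega)]
      refine wp_put_le (r := 64 + p.q + p.q + a rTail) (v := u)
        (by
          simp only [queueStart, Ex.ev, BinOp.eval]
          rw [hlow _ (by omega), hlow _ (by omega), hqq])
        (by
          simp only [Ex.ev]
          rw [hlow _ (by omega), hcur])
        (by
          simp only [queueStart, Ex.Safe, Ex.ev, BinOp.eval, Visible]
          rw [hlow _ (by omega), hlow _ (by omega), hqq]
          omega)
        (by
          simp only [Ex.Safe, Visible]
          rw [hlow _ (by omega), hcur]
          omega) (by omega) (by omega) ?_
      have hlow' : ∀ i < 64, Function.update (Function.update a (64 + p.q + k) 1)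
          (64 + p.q + p.q + a rTail) (u : ℕ) i = a i := fun i hi => by
        rw [Function.update_of_ne (by omega), hlow i hi]
      refine wp_set_le (v := a rTail + 1)
        (by
          simp only [Ex.ev, BinOp.eval]
          rw [hlow' _ (by omega)])
        (by
          simp only [Ex.Safe, Ex.ev, BinOp.eval, Visible]
          rw [hlow' _ (by omega)]
          omega) ?_
      refine endExcursion_le hf hp hc hconn huΛ hut hcore.t_notMem
        (hcore.push hf hus hut hA huΛ hun ?_ ?_ (by simp) fun i h1 h2 h3 => ?_) ?_ hBT hBi
      · rw [hk, Function.update_of_ne (by omega), Function.update_of_ne (by omega),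
          Function.update_self]
      · rw [Function.update_of_ne (by omega), Function.update_self]
      · rw [hk] at h1
        rw [Function.update_of_ne h3, Function.update_of_ne h2, Function.update_of_ne h1]
      · rw [Function.update_of_ne (by omega), hlow' _ (by omega), hB]
  · have hA : A (u / p.g) ≠ u := by
      rw [hload] at hc3
      exact fun h => hc3 (h.trans hcur.symm)
    refine searchInv_le hc (hcore.setCur u) hcur hreach hB hBT.le hBi
      (fun h0 => hp.timeout _ _ _ (by omega)) ?_
    rw [show p.T - B = p.T - (B + 1) + 1 by omega]
    refine hp.interior σ u _ fun h => ?_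
    rcases Search.mem_boundary.1 h with h | h
    · rcases mem_landmarks.1 h with h | h | h
      exacts [hus h, hut h, hA h]
    · exact h hreach

end inspection

/-! ### The search of a round -/

section rounds

variable {n : ℕ} {x : USTCON n} {w M : ℕ} {p : Params} {H : ℕ}

variable (x p) in
/-- The parameters are large enough for a round to succeed with probability at least `1 / 2`. -/
structure Tuned : Prop where
  two_le : 2 ≤ p.l
  n_le : n ≤ 2 ^ p.l
  K_eq : p.K = 12 * p.l * (6 * (4 * p.l * p.g) + 10 * p.d)
  edges : 2 * x.numEdges ≤ p.d * n
  T_eq : p.T = 16 * p.K * n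

open Classical in
variable (x p) in
/-- The potential of a search with the array `A` of landmarks; the trivial one if the landmarks
miss a large ball. -/
noncomputable def roundPot (hd : 0 < p.d) (A : ℕ → ℕ) : Search (Fin n) → ℕ → ℝ :=
  if Search.Hits x.graph (landmarks x p A) (4 * p.l * p.g) then
    Search.pot (x.graph.metropolis p.d hd) (Search.boundary x.graph x.s (landmarks x p A))
      (reached x p A) x.t (fun v => p.K * (x.graph.degree v / p.d + 1)) p.T
  else fun _ _ => 1

theorem exists_isPotential (hf : Fits (n := n) w M p H) (A : ℕ → ℕ) :
    ∃ P', IsPotential x p hf.d_pos A (roundPot x p hf.d_pos A) P' := by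
  unfold roundPot
  split_ifs
  · exact ⟨_, isPotential_pot hf.d_pos (lt_of_lt_of_le hf.n_pos ((Nat.le_mul_of_pos_left _
      hf.K_pos).trans ((Nat.mul_le_mul_left _ (Nat.le_succ n)).trans hf.K_le))) hf.K_pos A⟩
  · exact ⟨_, isPotential_one hf.d_pos A⟩

/-- The search with the landmarks `A` fails with a probability of at most its potential. For
`c = 0` this says that it gives no wrong positive answer. -/
theorem tri_search (hf : Fits (n := n) w M p H) {c : ℝ} (hc : 0 ≤ c)
    (hconn : c = 0 ∨ x.Connected) (A : ℕ → ℕ) (j : ℕ) :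
    Tri w M x (.while rBudget (Cmd.code (.seq walkStep inspect)))
      (p.T * ((Cmd.seq walkStep inspect).cost + 1) + 1)
      (searchInv x p H A (roundPot x p hf.d_pos A) j c p.T) (roundPost x p j c) := by
  obtain ⟨P', hP⟩ := exists_isPotential (x := x) hf A
  refine Tri.while (Or.inr (by decide)) (searchInv x p H A (roundPot x p hf.d_pos A) j c)
    (fun i a h0 => ?_) (fun a h0 => ?_) (fun i => ?_) p.T
  · rw [searchInv, if_pos h0]
  · rw [searchInv, if_neg h0, iInf_eq_top]
    intro σ
    rw [if_neg]
    rintro ⟨_, _, _, _, h⟩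
    exact h0 (Nat.le_zero.1 h)
  · have hM : 16 ≤ M := by have := hf.cells; omega
    refine (Cmd.tri hM (.seq walkStep inspect) _).mono le_rfl (fun a => ?_) fun a => le_rfl
    split_ifs with h0
    · exact le_top
    rw [searchInv, if_neg h0]
    refine le_iInf fun σ => ?_
    split_ifs with h
    swap
    · exact le_top
    obtain ⟨hcore, hcur, hreach, hT, hi⟩ := h
    obtain ⟨B, hB⟩ := Nat.exists_eq_succ_of_ne_zero h0
    rw [hB]
    refine le_trans (Cmd.wp_mono walkStep (fun b => ?_) a)
      (walkStep_le hf hP hc hcore hcur hreach hB (by omega) (i := i) (by omega))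
    refine le_iInf fun z => ?_
    split_ifs with hz
    · exact inspect_le hf hP hc hconn hz.1 hz.2.1 hz.2.2.1 rfl hz.2.2.2.1 hz.2.2.2.2
    · exact le_top

theorem roundPot_start_le (hf : Fits (n := n) w M p H) (ht : Tuned x p) (A : ℕ → ℕ)
    (hA : Search.Hits x.graph (landmarks x p A) (4 * p.l * p.g)) :
    roundPot x p hf.d_pos A ⟨x.s, x.s, p.K * (x.graph.degree x.s / p.d + 1), {x.s},
      (reached x p A).erase x.s⟩ 0 ≤ 3 / 8 := by
  rw [roundPot, if_pos hA]
  exact Search.pot_start_le_of_hits (T := p.T) (K := fun v => p.K * (x.graph.degree v / p.d + 1))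
    hf.d_pos (mem_landmarks.2 (Or.inl rfl)) ht.two_le (by simpa using ht.n_le) hA ht.K_eq
    (by simpa [USTCON.numEdges] using ht.edges) (by simpa using ht.T_eq) fun v => rfl

open Classical in
variable (x p H) in
/-- The assertion when the landmarks of the blocks `rI, …, q - 1` have been chosen; the value is
`c * f`. -/
noncomputable def chosenInv (j : ℕ) (c : ℝ) (f : Mem → ℝ) (a : Mem) : ℝ≥0∞ :=
  if Base x p a ∧ a rAns = 0 ∧ a rRounds = j ∧ a rI ≤ p.q ∧
    ∀ b < p.q, a rI ≤ b → a (64 + b) < H ∧ a (64 + p.q + b) = 0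
  then ENNReal.ofReal (c * f a) else ⊤

theorem startSearch_le (hf : Fits (n := n) w M p H) {c : ℝ} (hst : x.s ≠ x.t) {j : ℕ}
    {a : Mem} (hb : Base x p a) (h0 : a rAns = 0) (hj : a rRounds = j)
    (harr : ∀ b < p.q, a (64 + b) < H ∧ a (64 + p.q + b) = 0) :
    startSearch.wp w M x (fun a => ⨅ A : ℕ → ℕ,
        searchInv x p H A (roundPot x p hf.d_pos A) j c p.T a) a ≤
      ENNReal.ofReal (c * roundPot x p hf.d_pos (fun b => a (64 + b))
        ⟨x.s, x.s, p.K * (x.graph.degree x.s / p.d + 1), {x.s},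
          (reached x p fun b => a (64 + b)).erase x.s⟩ 0) := by
  have hM : 64 ≤ M := by have := hf.cells; omega
  have h2 := hf.two_H_lt
  have h3 := hf.n_lt
  have h4 := hf.d_lt
  have h5 := hf.T_lt
  have hKlt := hf.K_lt
  have hslt := x.s.2
  have hdeg : x.graph.degree x.s < n := by simpa using x.graph.degree_lt_card_verts x.s
  have hdivle : x.graph.degree x.s / p.d ≤ x.graph.degree x.s := Nat.div_le_self _ _
  have hkT : p.K * (x.graph.degree x.s / p.d + 1) ≤ p.T :=
    (Nat.mul_le_mul_left _ (by omega)).trans hf.K_le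
  have hTpos : 0 < p.T := lt_of_lt_of_le (Nat.mul_pos hf.K_pos (Nat.succ_pos _)) hf.K_le
  have hss := hb.source
  have hdd := hb.deg
  have hKK := hb.mult
  have hTT := hb.time
  unfold startSearch
  refine wp_set_le (v := x.s) (by simpa [Ex.ev] using hss)
    (by simp [Ex.Safe, Visible, hss]; omega) ?_
  refine wp_set_le (v := x.s) (by simpa [Ex.ev] using hss)
    (by simp [Ex.Safe, Visible, hss]; omega) ?_
  refine wp_set_le (v := 0) (by simp [Ex.ev]) (by simp [Ex.Safe]) ?_
  refine wp_set_le (v := 0) (by simp [Ex.ev]) (by simp [Ex.Safe]) ?_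
  refine wp_set_le (v := p.K * (x.graph.degree x.s / p.d + 1))
    (by simp [Ex.ev, BinOp.eval, hss, hdd, hKK, USTCON.degQuery_val])
    (by
      simp [-Nat.one_lt_two_pow_iff, Ex.Safe, Ex.ev, BinOp.eval, Visible, hss, hdd, hKK,
        USTCON.degQuery_val]
      generalize x.graph.degree x.s / p.d = y at *
      generalize p.K * (y + 1) = z at *
      omega) ?_
  refine wp_set_le (v := p.T) (by simpa [Ex.ev] using hTT)
    (by simp [Ex.Safe, Visible, hTT]; omega) ?_
  refine (iInf_le _ fun b => a (64 + b)).trans ?_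
  set A : ℕ → ℕ := fun b => a (64 + b) with hA
  rw [searchInv, if_neg (by simpa using hTpos.ne')]
  refine (iInf_le _ ⟨x.s, x.s, p.K * (x.graph.degree x.s / p.d + 1), {x.s},
    (reached x p A).erase x.s⟩).trans ?_
  have hsm : x.s ∈ reached x p A := Search.mem_marks.2
    ⟨mem_landmarks.2 (Or.inl rfl), SimpleGraph.Reachable.refl _⟩
  have hhigh : ∀ (m : Mem) (i y v : ℕ), 64 ≤ i → y < 64 → Function.update m y v i = m i :=
    fun m i y v h1 h2 => Function.update_of_ne (by omega) _ _
  rw [if_pos]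
  · simp
  · refine ⟨?_, by simp, SimpleGraph.Reachable.refl _, by simp, by simp⟩
    constructor
    · refine hb.congr fun i hi => ?_
      simp only [Function.update_apply]
      repeat rw [if_neg (by omega)]
    · simpa using h0
    · simpa using hj
    · simp
    · simp
    · exact Nat.mul_pos hf.K_pos (Nat.succ_pos _)
    · exact hkT
    · exact hsm
    · intro b _
      rw [hhigh _ _ _ _ (by omega) (by omega), hhigh _ _ _ _ (by omega) (by omega),
        hhigh _ _ _ _ (by omega) (by omega), hhigh _ _ _ _ (by omega) (by omega),
        hhigh _ _ _ _ (by omega) (by omega), hhigh _ _ _ _ (by omega) (by omega)]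
    · exact fun b hb => (harr b hb).1
    · simpa using hsm
    · simp
    · simpa using hst.symm
    · intro v hv _
      have hk := hf.div_lt v
      generalize (v : ℕ) / p.g = b at hk
      rw [hhigh _ _ _ _ (by omega) (by omega), hhigh _ _ _ _ (by omega) (by omega),
        hhigh _ _ _ _ (by omega) (by omega), hhigh _ _ _ _ (by omega) (by omega),
        hhigh _ _ _ _ (by omega) (by omega), hhigh _ _ _ _ (by omega) (by omega), (harr b hk).2]
      simpa using hv
    · intro b hb
      rw [hhigh _ _ _ _ (by omega) (by omega), hhigh _ _ _ _ (by omega) (by omega),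
        hhigh _ _ _ _ (by omega) (by omega), hhigh _ _ _ _ (by omega) (by omega),
        hhigh _ _ _ _ (by omega) (by omega), hhigh _ _ _ _ (by omega) (by omega), (harr b hb).2]
      omega
    · exact Finset.erase_subset _ _
    · intro v hv
      rw [Finset.mem_sdiff, Finset.mem_singleton] at hv
      exact Finset.mem_erase.2 ⟨hv.2, hv.1⟩
    · simp
    · simp
    · intro i _ hi
      simp at hi
    · intro i i' _ hi
      simp at hi
    · intro v hv hvi
      rw [Finset.mem_singleton] at hv
      exact absurd hv (Finset.mem_erase.1 hvi).1

/-! ### Random landmarks -/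

variable (p) in
/-- The number of nodes of `N` in the block `b`. -/
def blockCount (N : Finset (Fin n)) (b : ℕ) : ℕ :=
  (N.filter fun v : Fin n => (v : ℕ) / p.g = b).card

open Classical in
variable (p) in
/-- The conditional probability that no landmark of a block falls into `N`, when the landmarks of the
blocks `b, b + 1, …` have been chosen. -/
noncomputable def missProb (N : Finset (Fin n)) (b : ℕ) (a : Mem) : ℝ :=
  if ∃ v ∈ N, b ≤ (v : ℕ) / p.g ∧ a (64 + v / p.g) = v then 0
  else ∏ k ∈ Finset.range b, (1 - (blockCount p N k : ℝ) / p.g)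

theorem blockCount_le (hg : 0 < p.g) (N : Finset (Fin n)) (b : ℕ) : blockCount p N b ≤ p.g := by
  have : (N.filter fun v : Fin n => (v : ℕ) / p.g = b).card ≤ (Finset.range p.g).card := by
    refine Finset.card_le_card_of_injOn (fun v : Fin n => (v : ℕ) % p.g) ?_ ?_
    · intro v _
      exact Finset.mem_coe.2 (Finset.mem_range.2 (Nat.mod_lt _ hg))
    · intro v hv u hu h
      have hv := (Finset.mem_filter.1 (Finset.mem_coe.1 hv)).2
      have hu := (Finset.mem_filter.1 (Finset.mem_coe.1 hu)).2
      apply Fin.ext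
      rw [← Nat.div_add_mod v p.g, ← Nat.div_add_mod u p.g, hv, hu]
      exact congrArg _ h
  rwa [Finset.card_range] at this

theorem missProb_nonneg (hg : 0 < p.g) (N : Finset (Fin n)) (b : ℕ) (a : Mem) :
    0 ≤ missProb p N b a := by
  unfold missProb
  split_ifs
  · exact le_rfl
  · refine Finset.prod_nonneg fun k _ => sub_nonneg.2 ?_
    rw [div_le_one (by exact_mod_cast hg)]
    exact_mod_cast blockCount_le hg N k

theorem sum_blockCount (hf : Fits (n := n) w M p H) (N : Finset (Fin n)) :
    ∑ k ∈ Finset.range p.q, blockCount p N k = N.card :=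
  (Finset.card_eq_sum_card_fiberwise fun v _ =>
    Finset.mem_coe.2 (Finset.mem_range.2 (hf.div_lt v))).symm

theorem missProb_start_le (hf : Fits (n := n) w M p H) (N : Finset (Fin n)) (a : Mem)
    (hN : 4 * p.l * p.g ≤ N.card) : missProb p N p.q a ≤ Real.exp (-(4 * p.l)) := by
  have hg : (0 : ℝ) < p.g := by exact_mod_cast hf.g_pos
  rw [missProb, if_neg]
  · calc ∏ k ∈ Finset.range p.q, (1 - (blockCount p N k : ℝ) / p.g)
        ≤ ∏ k ∈ Finset.range p.q, Real.exp (-((blockCount p N k : ℝ) / p.g)) := by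
          refine Finset.prod_le_prod (fun k _ => sub_nonneg.2 ?_) fun k _ => ?_
          · rw [div_le_one hg]
            exact_mod_cast blockCount_le hf.g_pos N k
          · linarith [Real.add_one_le_exp (-((blockCount p N k : ℝ) / p.g))]
      _ = Real.exp (-((N.card : ℝ) / p.g)) := by
          rw [← Real.exp_sum, Finset.sum_neg_distrib, ← Finset.sum_div, ← sum_blockCount hf N]
          push_cast
          rfl
      _ ≤ Real.exp (-(4 * p.l)) := by
          apply Real.exp_le_exp.2
          apply neg_le_neg
          rw [le_div_iff₀ hg]
          exact_mod_cast hN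
  · rintro ⟨v, _, h, _⟩
    have := hf.div_lt v
    omega

/-- A random landmark in block `b` falls into `N` with probability `blockCount p N b / g`. -/
theorem avg_missProb_le (hg : 0 < p.g) (N : Finset (Fin n)) (b : ℕ) (a : Mem) (a' : ℕ → Mem)
    (hb : ∀ k < p.g, a' k (64 + b) = b * p.g + k)
    (hab : ∀ k i, b < i → i < p.q → a' k (64 + i) = a (64 + i))
    (hdiv : ∀ v : Fin n, (v : ℕ) / p.g < p.q) :
    (∑ k ∈ Finset.range p.g, missProb p N b (a' k)) / p.g ≤ missProb p N (b + 1) a := by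
  have hg' : (0 : ℝ) < p.g := by exact_mod_cast hg
  by_cases hhit : ∃ v ∈ N, b + 1 ≤ (v : ℕ) / p.g ∧ a (64 + v / p.g) = v
  · obtain ⟨v, hv, hbv, hav⟩ := hhit
    have hz : ∀ k ∈ Finset.range p.g, missProb p N b (a' k) = 0 := by
      intro k _
      rw [missProb, if_pos]
      exact ⟨v, hv, by omega, by rw [hab k _ (by omega) (hdiv v)]; exact hav⟩
    rw [Finset.sum_eq_zero hz, zero_div]
    exact missProb_nonneg hg N _ a
  · rw [missProb, if_neg hhit, Finset.prod_range_succ]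
    set Q := ∏ k ∈ Finset.range b, (1 - (blockCount p N k : ℝ) / p.g) with hQ
    set S := (N.filter fun v : Fin n => (v : ℕ) / p.g = b).image
      fun v : Fin n => (v : ℕ) % p.g with hS
    have hScard : S.card = blockCount p N b := by
      rw [hS, Finset.card_image_of_injOn]
      · rfl
      intro v hv u hu h
      have hv := (Finset.mem_filter.1 (Finset.mem_coe.1 hv)).2
      have hu := (Finset.mem_filter.1 (Finset.mem_coe.1 hu)).2
      apply Fin.ext
      rw [← Nat.div_add_mod v p.g, ← Nat.div_add_mod u p.g, hv, hu]
      exact congrArg _ h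
    have hSsub : S ⊆ Finset.range p.g := by
      intro k hk
      obtain ⟨v, _, rfl⟩ := Finset.mem_image.1 hk
      exact Finset.mem_range.2 (Nat.mod_lt _ hg)
    have hval : ∀ k ∈ Finset.range p.g, missProb p N b (a' k) = if k ∈ S then 0 else Q := by
      intro k hk
      rw [Finset.mem_range] at hk
      rw [missProb]
      refine if_congr ⟨?_, ?_⟩ rfl rfl
      · rintro ⟨v, hv, hbv, hav⟩
        rcases Nat.eq_or_lt_of_le hbv with h | h
        · refine Finset.mem_image.2 ⟨v, Finset.mem_filter.2 ⟨hv, h.symm⟩, ?_⟩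
          rw [← h, hb k hk] at hav
          rw [← hav, Nat.mul_add_mod', Nat.mod_eq_of_lt hk]
        · rw [hab k _ h (hdiv v)] at hav
          exact absurd ⟨v, hv, h, hav⟩ hhit
      · intro hkS
        obtain ⟨v, hv, rfl⟩ := Finset.mem_image.1 hkS
        obtain ⟨hv, hvb⟩ := Finset.mem_filter.1 hv
        refine ⟨v, hv, hvb.ge, ?_⟩
        rw [hvb, hb _ hk, ← hvb, Nat.div_add_mod']
    rw [Finset.sum_congr rfl hval, Finset.sum_ite, Finset.sum_const_zero, zero_add,
      Finset.sum_const, nsmul_eq_mul, Finset.filter_not, Finset.filter_mem_eq_inter,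
      Finset.inter_eq_right.2 hSsub, Finset.card_sdiff_of_subset hSsub, Finset.card_range, hScard,
      Nat.cast_sub (blockCount_le hg N b)]
    apply le_of_eq
    field_simp

variable (x p) in
/-- The balls that the landmarks should meet, by their centres and radii: those of at least `4 l g`
nodes. -/
noncomputable def largeBalls : Finset (Fin n × ℕ) :=
  (Finset.univ ×ˢ Finset.range n).filter fun z =>
    4 * p.l * p.g ≤ (x.graph.distBall z.1 z.2).card

variable (x p) in
/-- The bound for the failure probability of a round while the landmarks are chosen. -/
noncomputable def choosePot (a : Mem) : ℝ :=
  3 / 8 + ∑ z ∈ largeBalls x p, missProb p (x.graph.distBall z.1 z.2) (a rI) a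

/-- There are at most `n ^ 2` balls, and each of the large ones is missed with probability at most
`exp (-4 l)`. -/
theorem choosePot_start_le (hf : Fits (n := n) w M p H) (ht : Tuned x p) {a : Mem}
    (ha : a rI = p.q) : choosePot x p a ≤ 1 / 2 := by
  have h1 : ∑ z ∈ largeBalls x p, missProb p (x.graph.distBall z.1 z.2) (a rI) a ≤
      ∑ z ∈ largeBalls x p, Real.exp (-(4 * p.l)) := by
    refine Finset.sum_le_sum fun z hz => ?_
    rw [ha]
    exact missProb_start_le hf _ a (Finset.mem_filter.1 hz).2
  rw [Finset.sum_const, nsmul_eq_mul] at h1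
  have h2 : (largeBalls x p).card ≤ n * n := by
    refine (Finset.card_filter_le _ _).trans ?_
    simp
  have h3 : ((largeBalls x p).card : ℝ) ≤ 4 ^ p.l := by
    calc ((largeBalls x p).card : ℝ) ≤ ((n * n : ℕ) : ℝ) := by exact_mod_cast h2
      _ ≤ ((2 ^ p.l * 2 ^ p.l : ℕ) : ℝ) := by
          exact_mod_cast Nat.mul_le_mul ht.n_le ht.n_le
      _ = 4 ^ p.l := by
          rw [← mul_pow]; norm_num
  have h4 : Real.exp (-(4 * p.l)) ≤ (1 / 16) ^ p.l := by
    have h5 : (2 : ℝ) ≤ Real.exp 1 := by linarith [Real.add_one_le_exp (1 : ℝ)]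
    have h6 : (16 : ℝ) ≤ Real.exp 4 := by
      have : Real.exp 4 = Real.exp 1 ^ 4 := by rw [← Real.exp_nat_mul]; norm_num
      rw [this]
      calc (16 : ℝ) = 2 ^ 4 := by norm_num
        _ ≤ _ := by gcongr
    have h7 : Real.exp (-(4 * p.l)) = (Real.exp (-4)) ^ p.l := by
      rw [← Real.exp_nat_mul]; congr 1; ring
    rw [h7]
    gcongr
    rw [Real.exp_neg, one_div]
    exact inv_anti₀ (by norm_num) h6
  have h8 : ((largeBalls x p).card : ℝ) * Real.exp (-(4 * p.l)) ≤ 1 / 16 := by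
    calc ((largeBalls x p).card : ℝ) * Real.exp (-(4 * p.l)) ≤ 4 ^ p.l * (1 / 16) ^ p.l := by
          gcongr
      _ = (1 / 4) ^ p.l := by rw [← mul_pow]; norm_num
      _ ≤ (1 / 4) ^ 2 := pow_le_pow_of_le_one (by norm_num) (by norm_num) ht.two_le
      _ = 1 / 16 := by norm_num
  unfold choosePot
  linarith

/-- When all landmarks have been chosen, either they meet all large balls, or one of the
probabilities `missProb` is `1`. -/
theorem roundPot_le_choosePot (hf : Fits (n := n) w M p H) (ht : Tuned x p) {a : Mem}
    (ha : a rI = 0) :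
    roundPot x p hf.d_pos (fun b => a (64 + b))
        ⟨x.s, x.s, p.K * (x.graph.degree x.s / p.d + 1), {x.s},
          (reached x p fun b => a (64 + b)).erase x.s⟩ 0 ≤ choosePot x p a := by
  have hnn : ∀ z ∈ largeBalls x p, 0 ≤ missProb p (x.graph.distBall z.1 z.2) (a rI) a :=
    fun z _ => missProb_nonneg hf.g_pos _ _ _
  by_cases hhits : Search.Hits x.graph (landmarks x p fun b => a (64 + b)) (4 * p.l * p.g)
  · refine (roundPot_start_le hf ht _ hhits).trans ?_
    unfold choosePot
    linarith [Finset.sum_nonneg hnn]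
  · rw [roundPot, if_neg hhits]
    unfold Search.Hits at hhits
    push Not at hhits
    obtain ⟨v, k, hk, hcard, hmiss⟩ := hhits
    rw [Fintype.card_fin] at hk
    have hz : (v, k) ∈ largeBalls x p := Finset.mem_filter.2
      ⟨Finset.mem_product.2 ⟨Finset.mem_univ _, Finset.mem_range.2 hk⟩, hcard⟩
    have h1 := Finset.single_le_sum hnn hz
    have h2 : missProb p (x.graph.distBall v k) (a rI) a = 1 := by
      rw [missProb, if_neg, ha, Finset.range_zero, Finset.prod_empty]
      rintro ⟨u, hu, _, hau⟩
      exact hmiss u hu (mem_landmarks.2 (Or.inr (Or.inr hau)))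
    dsimp only at h1
    rw [h2] at h1
    unfold choosePot
    linarith

/-- A random landmark is chosen for the block `i`. -/
theorem chooseLandmark_le (hf : Fits (n := n) w M p H) {c : ℝ} (hc : 0 ≤ c) {j : ℕ} {a : Mem}
    (hb : Base x p a) (h0 : a rAns = 0) (hj : a rRounds = j) {i : ℕ} (hi : a rI = i + 1)
    (hiq : i < p.q)
    (harr : ∀ b < p.q, i + 1 ≤ b → a (64 + b) < H ∧ a (64 + p.q + b) = 0) :
    chooseLandmark.wp w M x (fun a => if a rI ≤ i then chosenInv x p H j c (choosePot x p) a else ⊤)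
      a ≤ ENNReal.ofReal (c * choosePot x p a) := by
  have hM : 64 ≤ M := by have := hf.cells; omega
  have h2 := hf.two_H_lt
  have h3 := hf.n_lt
  have hqn := hf.q_le
  have hgn := hf.g_le
  have hgpos := hf.g_pos
  have hcells := hf.cells
  have hww := hb.width
  have hqq := hb.blocks
  have hval : ∀ k < p.g, i * p.g + k < H := by
    intro k hk
    have h1 := hf.qg_le
    have h4 : (i + 1) * p.g ≤ p.q * p.g := Nat.mul_le_mul_right _ hiq
    rw [Nat.succ_mul] at h4
    omega
  have hgr : p.g - 1 + 1 = p.g := by omega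
  set a' : ℕ → Mem := fun k => Function.update (Function.update (Function.update
    (Function.update a rI i) rJ k) (64 + i) (i * p.g + k)) (64 + p.q + i) 0 with ha'
  have hlow : ∀ k b, b < 36 → a' k b = a b := by
    intro k b hb
    simp only [ha', Function.update_apply]
    repeat rw [if_neg (by omega)]
  have hI : ∀ k, a' k rI = i := by
    intro k
    simp only [ha', Function.update_apply]
    rw [if_neg (by omega), if_neg (by omega), if_neg (by omega), if_pos trivial]
  have hnew : ∀ k, a' k (64 + i) = i * p.g + k := by
    intro k
    simp only [ha', Function.update_apply]
    rw [if_neg (by omega), if_pos trivial]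
  have hmark : ∀ k, a' k (64 + p.q + i) = 0 := fun k => Function.update_self _ _ _
  have hold : ∀ k b, i < b → b < p.q → a' k (64 + b) = a (64 + b) := by
    intro k b h1 h2
    simp only [ha', Function.update_apply]
    repeat rw [if_neg (by omega)]
  have hold' : ∀ k b, i < b → b < p.q → a' k (64 + p.q + b) = a (64 + p.q + b) := by
    intro k b h1 h2
    simp only [ha', Function.update_apply]
    repeat rw [if_neg (by omega)]
  unfold chooseLandmark
  refine wp_set_le (v := i) (by simp [Ex.ev, BinOp.eval, hi])
    (by simp [-Nat.one_lt_two_pow_iff, Ex.Safe, Ex.ev, BinOp.eval, Visible, hi]; omega) ?_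
  refine wp_rnd_le (k := p.g - 1)
    (W := fun k => ENNReal.ofReal (c * choosePot x p (a' k)))
    (by simp [Ex.ev, BinOp.eval, hww])
    (by simp [-Nat.one_lt_two_pow_iff, Ex.Safe, Ex.ev, BinOp.eval, Visible, hww]; omega) ?_ ?_
  · intro k hk
    have hvk := hval k (by omega)
    have hmul : i * p.g ≤ i * p.g + k := Nat.le_add_right _ _
    refine wp_put_le (r := 64 + i) (v := i * p.g + k)
      (by simp [Ex.ev, BinOp.eval]) (by simp [Ex.ev, BinOp.eval, hww])
      (by simp [-Nat.one_lt_two_pow_iff, Ex.Safe, Ex.ev, BinOp.eval, Visible]; omega)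
      (by
        simp [-Nat.one_lt_two_pow_iff, Ex.Safe, Ex.ev, BinOp.eval, Visible, hww]
        omega) (by omega) (by omega) ?_
    have hq1 : (20 : ℕ) ≠ 64 + i := by omega
    have hq2 : (36 : ℕ) ≠ 64 + i := by omega
    refine wp_put_le (r := 64 + p.q + i) (v := 0)
      (by simp [Ex.ev, BinOp.eval, hq1, hq2, hqq])
      (by simp [Ex.ev])
      (by
        simp [-Nat.one_lt_two_pow_iff, Ex.Safe, Ex.ev, BinOp.eval, Visible,
          hq1, hq2, hqq]
        omega)
      (by simp [-Nat.one_lt_two_pow_iff, Ex.Safe]) (by omega) (by omega) ?_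
    change (if a' k rI ≤ i then _ else _) ≤ _
    rw [if_pos (hI k).le]
    change chosenInv x p H j c (choosePot x p) (a' k) ≤ _
    rw [chosenInv, if_pos]
    refine ⟨hb.congr fun b hb => hlow k b (by omega), by rw [hlow k _ (by omega)]; exact h0,
      by rw [hlow k _ (by omega)]; exact hj, by rw [hI]; omega, ?_⟩
    intro b hbq hib
    rw [hI] at hib
    rcases Nat.eq_or_lt_of_le hib with rfl | hib
    · exact ⟨by rw [hnew]; exact hvk, hmark k⟩
    · rw [hold k b hib hbq, hold' k b hib hbq]
      exact harr b hbq hib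
  · rw [hgr]
    have hnn : ∀ m : Mem, 0 ≤ choosePot x p m := fun m => add_nonneg (by norm_num)
      (Finset.sum_nonneg fun z _ => missProb_nonneg hgpos _ _ _)
    rw [sum_ofReal_div hgpos fun k _ => mul_nonneg hc (hnn _), ← Finset.mul_sum, mul_div_assoc]
    apply ENNReal.ofReal_le_ofReal
    apply mul_le_mul_of_nonneg_left _ hc
    unfold choosePot
    rw [Finset.sum_add_distrib, Finset.sum_comm, add_div, Finset.sum_const, Finset.card_range,
      nsmul_eq_mul, mul_div_cancel_left₀ _ (by exact_mod_cast hgpos.ne'), Finset.sum_div]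
    refine add_le_add le_rfl (Finset.sum_le_sum fun z _ => ?_)
    simp only [hI, hi]
    exact avg_missProb_le hgpos _ i a a' (fun k _ => hnew k) (fun k b h1 h2 => hold k b h1 h2)
      hf.div_lt

end rounds

/-! ### The loop over the rounds -/

section loop

variable {n : ℕ} {x : USTCON n} {w M : ℕ} {p : Params} {H : ℕ}

/-- The number of steps of the first assignments of a round. -/
noncomputable abbrev initCost : ℕ :=
  (Cmd.seq (.set rRounds (.sub (.reg rRounds) (.lit 1))) (.set rI (.reg rBlocks))).cost

variable (p) in
/-- The number of steps of a round. -/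
noncomputable def roundCost : ℕ :=
  initCost + (p.q * (chooseLandmark.cost + 1) + 1 +
    (startSearch.cost + (p.T * ((Cmd.seq walkStep inspect).cost + 1) + 1) + 1) + 1) + 1

theorem _root_.WordRAM.Tri.iInf {ι : Sort*} {P : Program} {t : ℕ} {f : ι → Mem → ℝ≥0∞}
    {g : Mem → ℝ≥0∞} (h : ∀ i, Tri w M x P t (f i) g) : Tri w M x P t (fun a => ⨅ i, f i a) g :=
  fun k T F hk a m hm => le_iInf fun i => h i k T F hk a m hm

open Classical in
/-- A round fails with probability at most `1 / 2`. -/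
theorem tri_round (hf : Fits (n := n) w M p H) (ht : Tuned x p) {c : ℝ} (hc : 0 ≤ c)
    (hconn : c = 0 ∨ x.Connected) (hst : x.s ≠ x.t) {j : ℕ} (hj : j + 1 < H) :
    Tri w M x round (roundCost p)
      (fun a => if Base x p a ∧ a rAns = 0 ∧ a rRounds = j + 1 then ENNReal.ofReal (c / 2) else ⊤)
      (roundPost x p j c) := by
  have hM : 64 ≤ M := by have := hf.cells; omega
  have h2 := hf.two_H_lt
  have h3 := hf.n_lt
  have h4 := hf.q_le
  have hsearch := Tri.iInf fun A : ℕ → ℕ => tri_search (x := x) hf hc hconn A j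
  have hstart := Cmd.tri (w := w) (x := x) (M := M) (by omega) startSearch
    fun a => ⨅ A : ℕ → ℕ, searchInv x p H A (roundPot x p hf.d_pos A) j c p.T a
  have hloop := Tri.whileCounter (w := w) (M := M) (x := x) (r := rI) (Or.inr (by decide))
    (p := chooseLandmark.code) (t := chooseLandmark.cost)
    (g := startSearch.wp w M x fun a =>
      ⨅ A : ℕ → ℕ, searchInv x p H A (roundPot x p hf.d_pos A) j c p.T a)
    (chosenInv x p H j c (choosePot x p)) (fun a ha => by
      unfold chosenInv
      split_ifs with h
      · obtain ⟨hb, h0, hj, _, harr⟩ := h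
        refine (startSearch_le hf hst hb h0 hj fun b hbq => harr b hbq (by omega)).trans ?_
        exact ENNReal.ofReal_le_ofReal
          (mul_le_mul_of_nonneg_left (roundPot_le_choosePot hf ht ha) hc)
      · exact le_top) (fun i => by
      refine (Cmd.tri (by omega) chooseLandmark _).mono le_rfl (fun a => ?_) fun a => le_rfl
      split_ifs with hi
      · unfold chosenInv
        split_ifs with h
        · obtain ⟨hb, h0, hj, hq, harr⟩ := h
          exact chooseLandmark_le hf hc hb h0 hj hi (by omega)
            fun b hbq hib => harr b hbq (by omega)
        · exact le_top
      · exact le_top) p.q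
  refine (Tri.seq (Cmd.tri (by omega) _ _) (Tri.seq hloop (Tri.seq hstart hsearch))).mono le_rfl
    (fun a => ?_) fun a => le_rfl
  split_ifs with h
  swap
  · exact le_top
  obtain ⟨hb, h0, hr⟩ := h
  have hqq := hb.blocks
  refine wp_set_le (v := j) (by simp [Ex.ev, BinOp.eval, hr])
    (by simp [-Nat.one_lt_two_pow_iff, Ex.Safe, Ex.ev, BinOp.eval, Visible, hr]; omega) ?_
  refine wp_set_le (v := p.q) (by simp [Ex.ev, hqq])
    (by simp [-Nat.one_lt_two_pow_iff, Ex.Safe, Visible, hqq]; omega) ?_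
  rw [if_pos (by simp), chosenInv, if_pos]
  · apply ENNReal.ofReal_le_ofReal
    rw [div_eq_mul_one_div]
    exact mul_le_mul_of_nonneg_left (choosePot_start_le hf ht (by simp)) hc
  · refine ⟨?_, by simpa using h0, by simp, by simp, fun b hbq hqb => ?_⟩
    · constructor
      · simpa using hb.nodes
      · simpa using hb.source
      · simpa using hb.target
      · simpa using hb.blocks
      · simpa using hb.width
      · simpa using hb.deg
      · simpa using hb.mult
      · simpa using hb.time
      · simpa using hb.sound
      · simp [h0]
    · simp at hqb
      omega

open Classical in
variable (x p) in
/-- The invariant of the loop over the rounds: each of them fails with probability at most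
`1 / 2`. -/
noncomputable def roundsInv (c : ℝ) (a : Mem) : ℝ≥0∞ :=
  if Base x p a ∧ a rRounds ≤ p.l ∧ (a rRounds ≠ 0 → x.s ≠ x.t)
  then (if a rAns = 0 then ENNReal.ofReal (c * (1 / 2) ^ a rRounds) else 0) else ⊤

open Classical in
variable (x) in
/-- The value `c` for a negative answer; a positive one must be correct. -/
noncomputable def answerPost (c : ℝ) (a : Mem) : ℝ≥0∞ :=
  if a rAns ≠ 0 → x.Connected then (if a rAns = 0 then ENNReal.ofReal c else 0) else ⊤

theorem tri_rounds (hf : Fits (n := n) w M p H) (ht : Tuned x p) {c : ℝ} (hc : 0 ≤ c)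
    (hconn : c = 0 ∨ x.Connected) (hl : p.l < H) :
    Tri w M x (.while rRounds round) (p.l * (roundCost p + 1) + 1)
      (roundsInv x p c) (answerPost x c) := by
  refine (Tri.whileCounter (Or.inr (by decide)) (roundsInv x p c) (fun a ha => ?_) (fun j => ?_)
    p.l).mono le_rfl (fun a => ?_) fun a => le_rfl
  · unfold roundsInv
    split_ifs with h h0
    · rw [answerPost, if_pos h.1.sound, if_pos h0, ha, pow_zero, mul_one]
    · rw [answerPost, if_pos h.1.sound, if_neg h0]
    · exact le_top
  · by_cases hj : j + 1 ≤ p.l ∧ x.s ≠ x.t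
    · refine (tri_round hf ht (c := c * (1 / 2) ^ j) (by positivity)
        (hconn.imp_left fun h => by rw [h, zero_mul]) hj.2 (j := j) (by omega)).mono le_rfl
        (fun a => ?_) fun a => ?_
      · split_ifs with h1 h2
        · rw [roundsInv, if_pos ⟨h1.1, by omega, fun _ => hj.2⟩, if_pos h1.2.1, h2, pow_succ]
          exact (congrArg _ (by ring)).le
        · exact absurd h1.2.2 h2
        · rename_i h2
          rw [roundsInv, if_neg]
          rintro ⟨hb, h3, h4⟩
          refine h1 ⟨hb, ?_, h2⟩
          by_contra h0
          have := hb.rounds_eq h0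
          omega
        · exact le_rfl
      · by_cases h : Base x p a ∧ (a rAns = 0 → a rRounds = j)
        · rw [roundPost, if_pos h]
          have hle : a rRounds ≤ j := by
            by_cases h0 : a rAns = 0
            · exact (h.2 h0).le
            · rw [h.1.rounds_eq h0]
              exact Nat.zero_le _
          rw [if_pos hle, roundsInv, if_pos ⟨h.1, by omega, fun _ => hj.2⟩]
          split_ifs with h0
          · rw [h.2 h0]
          · exact le_rfl
        · rw [roundPost, if_neg h]
          exact le_top
    · intro k T F hk a m hm
      dsimp only
      split_ifs with h
      · rw [roundsInv, if_neg]
        · exact le_top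
        · rintro ⟨hb, h3, h4⟩
          exact hj ⟨by omega, h4 (by omega)⟩
      · exact le_top
  · split_ifs with h
    · exact le_rfl
    · rw [roundsInv, if_neg fun h' => h h'.2.1]

end loop

/-! ### The parameters of a run -/

section preamble

variable {n : ℕ} (x : USTCON n) (w M : ℕ)

/-- The number of blocks: a third of the memory, but not more than the number of nodes. -/
def numBlocks (n w M : ℕ) : ℕ :=
  if n < (min M (2 ^ w - 1) - 64) / 3 then n else (min M (2 ^ w - 1) - 64) / 3

/-- The parameters that the program computes. -/
def params : Params where
  l := Nat.size n
  q := numBlocks n w M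
  g := n / numBlocks n w M + 1
  d := 2 * x.numEdges / n + 1
  K := 12 * Nat.size n * (24 * (Nat.size n * (n / numBlocks n w M + 1)) +
    10 * (2 * x.numEdges / n + 1))
  T := 16 * (12 * Nat.size n * (24 * (Nat.size n * (n / numBlocks n w M + 1)) +
    10 * (2 * x.numEdges / n + 1))) * n

variable {x w M}

theorem two_mul_numEdges_le : 2 * x.numEdges ≤ n * (n - 1) := by
  have h := x.graph.card_edgeFinset_le_card_choose_two
  rw [Fintype.card_fin, Nat.choose_two_right] at h
  have := Nat.div_mul_le_self (n * (n - 1)) 2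
  unfold USTCON.numEdges
  omega

theorem two_le_size (hn : 2 ≤ n) : 2 ≤ Nat.size n := Nat.lt_size.2 (by simpa using hn)

theorem four_le_two_pow_size (hn : 2 ≤ n) : 4 ≤ 2 ^ Nat.size n :=
  (by norm_num : (4 : ℕ) = 2 ^ 2).le.trans (Nat.pow_le_pow_right (by norm_num) (two_le_size hn))

theorem numBlocks_le : numBlocks n w M ≤ n := by
  unfold numBlocks
  split_ifs <;> omega

theorem three_numBlocks_le : 3 * numBlocks n w M ≤ M - 64 := by
  unfold numBlocks
  split_ifs <;> omega

theorem numBlocks_pos (hn : 2 ≤ n) (hw : 7 ≤ w) (hM : 67 ≤ M) : 0 < numBlocks n w M := by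
  have : 2 ^ 7 ≤ 2 ^ w := Nat.pow_le_pow_right (by norm_num) hw
  unfold numBlocks
  split_ifs <;> omega

/-- The bound for the numbers in a computation: its square is the number of words. -/
abbrev numBound (n : ℕ) : ℕ := (2 ^ Nat.size n) ^ 20

theorem numBound_mul_self : numBound n * numBound n = 2 ^ (40 * Nat.size n) := by
  rw [numBound, ← pow_mul, ← pow_add]
  congr 1
  ring

theorem avg_degree_le (hn : 2 ≤ n) : 2 * x.numEdges / n + 1 ≤ n := by
  have h := two_mul_numEdges_le (x := x)
  have : 2 * x.numEdges / n ≤ n - 1 := Nat.div_le_of_le_mul h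
  omega

theorem lt_numBound (hn : 2 ≤ n) : 64 + 3 * n < numBound n := by
  have h4 := four_le_two_pow_size hn
  have h1 := Nat.lt_size_self n
  unfold numBound
  set N := 2 ^ Nat.size n
  calc 64 + 3 * n < 64 * N + 3 * N := by omega
    _ ≤ 4 ^ 19 * N := by omega
    _ ≤ N ^ 19 * N := by gcongr
    _ = N ^ 20 := by ring

theorem params_T_lt (hn : 2 ≤ n) : (params x w M).T < numBound n := by
  have h4 := four_le_two_pow_size hn
  have h1 := Nat.lt_size_self n
  have h2 : Nat.size n < 2 ^ Nat.size n := Nat.lt_two_pow_self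
  have h3 := avg_degree_le (x := x) hn
  have h5 : n / numBlocks n w M ≤ n := Nat.div_le_self _ _
  unfold numBound params
  dsimp only
  generalize n / numBlocks n w M = g at *
  generalize 2 * x.numEdges / n = d at *
  generalize Nat.size n = l at *
  set N := 2 ^ l
  calc 16 * (12 * l * (24 * (l * (g + 1)) + 10 * (d + 1))) * n
      ≤ 16 * (12 * N * (24 * (N * N) + 10 * N)) * N := by
        gcongr <;> omega
    _ ≤ 16 * (12 * N * (24 * (N * N) + 10 * (N * N))) * N := by
        gcongr
        nlinarith
    _ = 6528 * N ^ 4 := by ring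
    _ < 4 ^ 16 * N ^ 4 := by
        apply Nat.mul_lt_mul_of_pos_right (by norm_num)
        positivity
    _ ≤ N ^ 16 * N ^ 4 := by gcongr
    _ = N ^ 20 := by ring

theorem params_fits (hn : 2 ≤ n) (hM : 67 ≤ M) :
    Fits (n := n) (40 * Nat.size n) M (params x (40 * Nat.size n) M) (numBound n) := by
  have hl := two_le_size hn
  have hqpos := numBlocks_pos hn (w := 40 * Nat.size n) (by omega) hM
  have hqn : numBlocks n (40 * Nat.size n) M ≤ n := numBlocks_le
  have h3 := avg_degree_le (x := x) hn
  have h4 := lt_numBound hn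
  have hK : 0 < (params x (40 * Nat.size n) M).K := by unfold params; positivity
  constructor
  · omega
  · exact numBound_mul_self.le
  · exact params_T_lt hn
  · exact h4
  · exact hqn
  · exact Nat.succ_le_succ (Nat.div_le_self _ _)
  · exact Nat.succ_pos _
  · exact (Nat.lt_mul_div_succ n hqpos).le
  · change numBlocks n (40 * Nat.size n) M * (n / numBlocks n (40 * Nat.size n) M + 1) ≤ _
    have := Nat.mul_div_le n (numBlocks n (40 * Nat.size n) M)
    rw [Nat.mul_succ]
    omega
  · exact Nat.succ_pos _
  · change 2 * x.numEdges / n + 1 < _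
    omega
  · exact hK
  · change _ ≤ 16 * (params x (40 * Nat.size n) M).K * n
    nlinarith
  · have := three_numBlocks_le (n := n) (w := 40 * Nat.size n) (M := M)
    change 64 + 3 * numBlocks n (40 * Nat.size n) M ≤ M
    omega

theorem params_tuned (hn : 2 ≤ n) : Tuned x (params x w M) where
  two_le := two_le_size hn
  n_le := (Nat.lt_size_self n).le
  K_eq := by unfold params; ring
  edges := by
    have := (Nat.lt_mul_div_succ (2 * x.numEdges) (show 0 < n by omega)).le
    rw [mul_comm _ n]
    exact this
  T_eq := rfl

theorem sum_degQuery : ∑ v ∈ Finset.range n, x.degQuery v = 2 * x.numEdges := by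
  rw [Finset.sum_range]
  simp only [USTCON.degQuery_val]
  exact x.graph.sum_degrees_eq_twice_card_edges

/-! ### The preamble -/

variable (x) in
/-- The input has been read. -/
structure Started (a : Mem) : Prop where
  nodes : a rNodes = n
  source : a rSource = x.s
  target : a rTarget = x.t
  ans : a rAns = 0
  rounds : a rRounds = 0

theorem Started.congr {a b : Mem} (h : Started x a)
    (hab : ∀ i, i = 0 ∨ i = 16 ∨ i = 17 ∨ i = 18 ∨ i = 25 → b i = a i) : Started x b where
  nodes := by rw [hab _ (by decide)]; exact h.nodes
  source := by rw [hab _ (by decide)]; exact h.source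
  target := by rw [hab _ (by decide)]; exact h.target
  ans := by rw [hab _ (by decide)]; exact h.ans
  rounds := by rw [hab _ (by decide)]; exact h.rounds

open Classical in
variable (x) in
/-- The invariant while the length of `n` is computed. -/
noncomputable def sizeInv (V : ℝ≥0∞) (a : Mem) : ℝ≥0∞ :=
  if Started x a ∧ a rA ≤ n ∧ a rSize + Nat.size (a rA) = Nat.size n then V else ⊤

open Classical in
variable (x w M) in
/-- The invariant while the degrees are summed. -/
noncomputable def degreeInv (V : ℝ≥0∞) (a : Mem) : ℝ≥0∞ :=
  if Started x a ∧ a rSize = Nat.size n ∧ a rBlocks = (params x w M).q ∧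
    a rWidth = (params x w M).g ∧ a rI ≤ n ∧
    a rA + ∑ v ∈ Finset.range (a rI), x.degQuery v = 2 * x.numEdges then V else ⊤

theorem size_div_two {m : ℕ} (hm : m ≠ 0) : Nat.size (m / 2) + 1 = Nat.size m := by
  conv_rhs => rw [← Nat.bit_bodd_div2 m]
  rw [Nat.size_bit (by rwa [Nat.bit_bodd_div2]), Nat.div2_val]

open Classical in
theorem halveSize_le (hn : 2 ≤ n) (hM : 64 ≤ M) {V : ℝ≥0∞} {a : Mem} {j : ℕ} (hj : a rA = j + 1) :
    halveSize.wp (40 * Nat.size n) M x (fun a => if a rA ≤ j then sizeInv x V a else ⊤) a ≤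
      sizeInv x V a := by
  unfold sizeInv
  split_ifs with h
  swap
  · exact le_top
  obtain ⟨hs, hA, hl⟩ := h
  have hw := numBound_mul_self (n := n)
  have hH := lt_numBound hn
  have h2 : numBound n ≤ 2 ^ (40 * Nat.size n) := hw ▸ Nat.le_mul_self _
  have hls : Nat.size n ≤ n := Nat.size_le.2 Nat.lt_two_pow_self
  have hhalf := size_div_two (m := a rA) (by omega)
  have hd2 := Nat.div_le_self (a rA) 2
  unfold halveSize
  refine wp_set_le (v := a rA / 2) (by simp [Ex.ev, BinOp.eval])
    (by simp [-Nat.one_lt_two_pow_iff, Ex.Safe, Ex.ev, BinOp.eval, Visible]; omega) ?_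
  refine wp_set_le (v := a rSize + 1) (by simp [Ex.ev, BinOp.eval])
    (by simp [-Nat.one_lt_two_pow_iff, Ex.Safe, Ex.ev, BinOp.eval, Visible]; omega) ?_
  rw [if_pos (by simp; omega), if_pos]
  refine ⟨hs.congr fun i hi => ?_, by simp; omega, by simp; omega⟩
  simp only [Function.update_apply]
  repeat rw [if_neg (by omega)]

open Classical in
theorem sumDegree_le (hn : 2 ≤ n) (hM : 64 ≤ M) {V : ℝ≥0∞} {a : Mem} {j : ℕ} (hj : a rI = j + 1) :
    sumDegree.wp (40 * Nat.size n) M x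
      (fun a => if a rI ≤ j then degreeInv x (40 * Nat.size n) M V a else ⊤) a ≤
      degreeInv x (40 * Nat.size n) M V a := by
  unfold degreeInv
  split_ifs with h
  swap
  · exact le_top
  obtain ⟨hs, hl, hq, hg, hI, hsum⟩ := h
  have hw := numBound_mul_self (n := n)
  have hH := lt_numBound hn
  have hm : 2 * x.numEdges < 2 ^ (40 * Nat.size n) := by
    refine (two_mul_numEdges_le (x := x)).trans_lt ?_
    rw [← hw]
    exact Nat.mul_lt_mul'' (by omega) (by omega)
  have h2 : numBound n ≤ 2 ^ (40 * Nat.size n) := hw ▸ Nat.le_mul_self _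
  rw [hj, Finset.sum_range_succ] at hsum
  have hdq := x.degQuery_lt (by omega) j
  unfold sumDegree
  refine wp_set_le (v := j) (by simp [Ex.ev, BinOp.eval, hj])
    (by simp [-Nat.one_lt_two_pow_iff, Ex.Safe, Ex.ev, BinOp.eval, Visible, hj]; omega) ?_
  refine wp_set_le (v := a rA + x.degQuery j) (by simp [Ex.ev, BinOp.eval])
    (by simp [-Nat.one_lt_two_pow_iff, Ex.Safe, Ex.ev, BinOp.eval, Visible]; omega) ?_
  rw [if_pos (by simp), if_pos]
  refine ⟨hs.congr fun i hi => ?_, by simpa using hl, by simpa using hq, by simpa using hg,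
    by simp; omega, by simp; omega⟩
  simp only [Function.update_apply]
  repeat rw [if_neg (by omega)]

theorem computeBlocks_le (hn : 2 ≤ n) (hM : 67 ≤ M) {V : ℝ≥0∞} {a : Mem} (hA : a rA = 0) :
    computeBlocks.wp (40 * Nat.size n) M x
      (fun a => if a rI ≤ n then degreeInv x (40 * Nat.size n) M V a else ⊤) a ≤
      sizeInv x V a := by
  unfold sizeInv
  split_ifs with h
  swap
  · exact le_top
  obtain ⟨hs, _, hl⟩ := h
  rw [hA, Nat.size_zero, add_zero] at hl
  have hf := params_fits (x := x) hn hM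
  have h2 := hf.two_H_lt
  have hH := lt_numBound hn
  have hq := numBlocks_pos (w := 40 * Nat.size n) hn (by have := two_le_size hn; omega) hM
  have hqn := numBlocks_le (n := n) (w := 40 * Nat.size n) (M := M)
  have hg := hf.g_le
  have hnn := hs.nodes
  set w := 40 * Nat.size n with hwdef
  set q := numBlocks n w M with hqdef
  set Q := (min M (2 ^ w - 1) - 64) / 3 with hQ
  have hqQ : q = if n < Q then n else Q := rfl
  have hrest : ∀ b : Mem, Started x b → b rSize = Nat.size n → b rBlocks = q →
      (Cmd.seq (.set rWidth (.add (.div (.reg rNodes) (.reg rBlocks)) (.lit 1))) <|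
        .seq (.set rI (.reg rNodes)) <| .set rA (.lit 0)).wp w M x
        (fun a => if a rI ≤ n then degreeInv x w M V a else ⊤) b ≤ V := by
    intro b hb hbl hbq
    have hbn := hb.nodes
    have hdiv : n / q ≤ n := Nat.div_le_self _ _
    refine wp_set_le (v := n / q + 1) (by simp [Ex.ev, BinOp.eval, hbn, hbq])
      (by
        simp [-Nat.one_lt_two_pow_iff, Ex.Safe, Ex.ev, BinOp.eval, Visible, hbn, hbq]
        generalize n / q = y at *
        omega) ?_
    refine wp_set_le (v := n) (by simp [Ex.ev, hbn])
      (by simp [-Nat.one_lt_two_pow_iff, Ex.Safe, Visible, hbn]; omega) ?_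
    refine wp_set_le (v := 0) (by simp [Ex.ev]) (by simp [-Nat.one_lt_two_pow_iff, Ex.Safe]) ?_
    rw [if_pos (by simp), degreeInv, if_pos]
    refine ⟨hb.congr fun i hi => ?_, by simpa using hbl, by simpa [params, ← hqdef] using hbq,
      by simp [params, hqdef],
      by simp, by simpa using sum_degQuery⟩
    simp only [Function.update_apply]
    repeat rw [if_neg (by omega)]
  have hQlt : Q < 2 ^ w := by omega
  unfold computeBlocks
  refine wp_set_le (v := Q) (by simp [Ex.ev, BinOp.eval, Param.value, hQ])
    (by
      simp only [Ex.Safe, Ex.ev, BinOp.eval, Param.value]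
      omega) ?_
  refine wp_ite_less_le (by simp [-Nat.one_lt_two_pow_iff, Ex.Safe, Visible, hnn]; omega)
    (by simpa [-Nat.one_lt_two_pow_iff, Ex.Safe, Visible] using hQlt) (by omega)
    (fun h => ?_) fun h => ?_
  · have h : n < Q := by simpa [Ex.ev, hnn] using h
    refine wp_set_le (v := n) (by simp [Ex.ev, hnn])
      (by simp [-Nat.one_lt_two_pow_iff, Ex.Safe, Visible, hnn]; omega) ?_
    refine hrest _ (hs.congr fun i hi => ?_) (by simpa using hl) (by simp [hqQ, h])
    simp only [Function.update_apply]
    repeat rw [if_neg (by omega)]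
  · have h : ¬ n < Q := by simpa [Ex.ev, hnn] using h
    refine hrest _ (hs.congr fun i hi => ?_) (by simpa using hl) (by simp [hqQ, h])
    simp only [Function.update_apply]
    repeat rw [if_neg (by omega)]

open Classical in
theorem computeTimes_le (hn : 2 ≤ n) (hM : 67 ≤ M) {c : ℝ} {a : Mem} (hI : a rI = 0) :
    computeTimes.wp (40 * Nat.size n) M x (roundsInv x (params x (40 * Nat.size n) M) c) a ≤
      degreeInv x (40 * Nat.size n) M
        (if x.s = x.t then 0 else ENNReal.ofReal (c * (1 / 2) ^ Nat.size n)) a := by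
  unfold degreeInv
  by_cases h : Started x a ∧ a rSize = Nat.size n ∧
    a rBlocks = (params x (40 * Nat.size n) M).q ∧ a rWidth = (params x (40 * Nat.size n) M).g ∧
    a rI ≤ n ∧ a rA + ∑ v ∈ Finset.range (a rI), x.degQuery v = 2 * x.numEdges
  swap
  · rw [if_neg h]
    exact le_top
  rw [if_pos h]
  obtain ⟨hs, hl, hq, hg, _, hsum⟩ := h
  rw [hI, Finset.range_zero, Finset.sum_empty, add_zero] at hsum
  have hf := params_fits (x := x) hn hM
  have h2 := hf.two_H_lt
  have hH := lt_numBound hn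
  have hTlt := hf.T_lt
  have hKpos := hf.K_pos
  have hgpos := hf.g_pos
  have hlpos := two_le_size hn
  have hdn := avg_degree_le (x := x) hn
  have hm : 2 * x.numEdges < 2 ^ (40 * Nat.size n) := by
    refine (two_mul_numEdges_le (x := x)).trans_lt (lt_of_lt_of_le ?_ hf.word)
    exact Nat.mul_lt_mul'' (by omega) (by omega)
  have hnn := hs.nodes
  have hss := hs.source
  have htt := hs.target
  have hslt := x.s.2
  have htlt := x.t.2
  set w := 40 * Nat.size n with hwdef
  set d := 2 * x.numEdges / n + 1 with hd
  set g := n / numBlocks n w M + 1 with hgdef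
  set B := 24 * (Nat.size n * g) + 10 * d with hB
  have hg' : a rWidth = g := hg
  have hKdef : (params x w M).K = 12 * Nat.size n * B := rfl
  have hTdef : (params x w M).T = 16 * (params x w M).K * n := rfl
  have hggpos : 0 < g := hgpos
  have hgle : g ≤ n + 1 := hf.g_le
  have hlg : 0 < Nat.size n * g := Nat.mul_pos (by omega) hggpos
  have hB1 : B ≤ 12 * Nat.size n * B := Nat.le_mul_of_pos_left _ (by omega)
  have hB2 : 12 * Nat.size n ≤ 12 * Nat.size n * B := Nat.le_mul_of_pos_right _ (by omega)
  have hK1 : 16 * (params x w M).K ≤ (params x w M).T := by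
    rw [hTdef]
    exact Nat.le_mul_of_pos_right _ (by omega)
  rw [← hKdef] at hB1 hB2
  have hT' : 16 * (params x w M).K * n < 2 ^ w := by rw [← hTdef]; omega
  have hK' : 12 * Nat.size n * B < 2 ^ w := by rw [← hKdef]; omega
  unfold computeTimes
  refine wp_set_le (v := d) (by simp [Ex.ev, BinOp.eval, hnn, hsum, hd])
    (by
      simp [-Nat.one_lt_two_pow_iff, Ex.Safe, Ex.ev, BinOp.eval, Visible, hnn, hsum]
      omega) ?_
  refine wp_set_le (v := B) (by simp [Ex.ev, BinOp.eval, hl, hg', hB])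
    (by
      simp [-Nat.one_lt_two_pow_iff, Ex.Safe, Ex.ev, BinOp.eval, Visible, hl, hg']
      generalize Nat.size n * g = y at *
      omega) ?_
  refine wp_set_le (v := (params x w M).K) (by simp [Ex.ev, BinOp.eval, hl, hKdef])
    (by
      simp [-Nat.one_lt_two_pow_iff, Ex.Safe, Ex.ev, BinOp.eval, Visible, hl]
      omega) ?_
  refine wp_set_le (v := (params x w M).T) (by simp [Ex.ev, BinOp.eval, hnn, hTdef])
    (by
      simp [-Nat.one_lt_two_pow_iff, Ex.Safe, Ex.ev, BinOp.eval, Visible, hnn]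
      omega) ?_
  have hbase : ∀ b : Mem, (∀ i, i = 16 ∨ i = 17 ∨ i = 18 ∨ i = 20 ∨ i = 21 → b i = a i) →
      b rDeg = d → b rMult = (params x w M).K → b rTime = (params x w M).T →
      (b rAns ≠ 0 → x.Connected ∧ b rRounds = 0) → Base x (params x w M) b := by
    intro b hb hbd hbk hbt hans
    constructor
    · rw [hb _ (by decide), hnn]
    · rw [hb _ (by decide), hss]
    · rw [hb _ (by decide), htt]
    · rw [hb _ (by decide), hq]
    · rw [hb _ (by decide), hg]
    · exact hbd
    · exact hbk
    · exact hbt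
    · exact fun h => (hans h).1
    · exact fun h => (hans h).2
  refine wp_ite_equal_le (by simp [-Nat.one_lt_two_pow_iff, Ex.Safe, Visible, hss]; omega)
    (by simp [-Nat.one_lt_two_pow_iff, Ex.Safe, Visible, htt]; omega) (by omega)
    (fun h => ?_) fun h => ?_
  · have hst : x.s = x.t := Fin.ext (by simpa [Ex.ev, hss, htt] using h)
    rw [Cmd.wp, if_pos, roundsInv, if_pos, if_neg]
    · exact zero_le
    · simp [Ex.ev]
    · have hr := hs.rounds
      refine ⟨hbase _ (fun i hi => ?_) (by simp) (by simp) (by simp)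
        fun _ => ⟨?_, by simpa using hr⟩, by simp [hr], by simp [hr]⟩
      · simp only [Function.update_apply]
        repeat rw [if_neg (by omega)]
      · rw [USTCON.Connected, hst]
    · exact ⟨by decide, Or.inl rfl, by omega, by simp [-Nat.one_lt_two_pow_iff, Ex.Safe]; omega⟩
  · have hst : x.s ≠ x.t := fun hst => h (by simp [Ex.ev, hss, htt, hst])
    have h0 := hs.ans
    refine wp_set_le (v := Nat.size n) (by simp [Ex.ev, hl])
      (by simp [-Nat.one_lt_two_pow_iff, Ex.Safe, Visible, hl]; omega) ?_
    rw [roundsInv, if_pos, if_pos, if_neg hst]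
    · simp
    · simpa using h0
    · refine ⟨hbase _ (fun i hi => ?_) (by simp) (by simp) (by simp) fun hne => ?_,
        by simp [params], fun _ => hst⟩
      · simp only [Function.update_apply]
        repeat rw [if_neg (by omega)]
      · exact absurd (by simpa using h0) hne

theorem readInput_le (hn : 2 ≤ n) (hM : 67 ≤ M) {V : ℝ≥0∞} :
    readInput.wp (40 * Nat.size n) M x (fun a => if a rA ≤ n then sizeInv x V a else ⊤)
      (fun _ => 0) ≤ V := by
  have hf := params_fits (x := x) hn hM
  have h2 := hf.two_H_lt
  have hH := lt_numBound hn
  have hs := x.s.2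
  have ht := x.t.2
  unfold readInput
  refine wp_set_le (v := n) (by simp [Ex.ev, Param.value])
    (by simp [-Nat.one_lt_two_pow_iff, Ex.Safe, Param.value]; omega) ?_
  refine wp_set_le (v := x.s) (by simp [Ex.ev, Param.value])
    (by simp [-Nat.one_lt_two_pow_iff, Ex.Safe, Param.value]; omega) ?_
  refine wp_set_le (v := x.t) (by simp [Ex.ev, Param.value])
    (by simp [-Nat.one_lt_two_pow_iff, Ex.Safe, Param.value]; omega) ?_
  refine wp_set_le (v := n) (by simp [Ex.ev])
    (by simp [-Nat.one_lt_two_pow_iff, Ex.Safe, Visible]; omega) ?_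
  rw [if_pos (by simp), sizeInv, if_pos]
  refine ⟨⟨by simp, by simp, by simp, by simp, by simp⟩, by simp, by simp⟩

variable (x w M) in
/-- The number of steps of the program. -/
noncomputable def totalCost : ℕ :=
  readInput.cost + (n * (halveSize.cost + 1) + 1 + (computeBlocks.cost +
    (n * (sumDegree.cost + 1) + 1 + (computeTimes.cost +
      ((params x w M).l * (roundCost (params x w M) + 1) + 1) + 1) + 1) + 1) + 1) + 1

open Classical in
/-- The program, started with empty memory, halts, gives no wrong positive answer, and fails to
find a path with probability at most `2 ^ (-l)`. The choice `c = 0` is possible for all instances,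
and `c = 1` for those with connected `s` and `t`. -/
theorem val_prog_le (hn : 2 ≤ n) (hM : 67 ≤ M) {c : ℝ} (hc : 0 ≤ c) (hconn : c = 0 ∨ x.Connected) :
    val (40 * Nat.size n) M x (answerPost x c) (totalCost x (40 * Nat.size n) M)
      ([prog], fun _ => 0) ≤
      if x.s = x.t then 0 else ENNReal.ofReal (c * (1 / 2) ^ Nat.size n) := by
  set V : ℝ≥0∞ := if x.s = x.t then 0 else ENNReal.ofReal (c * (1 / 2) ^ Nat.size n) with hV
  have hf := params_fits (x := x) hn hM
  have ht := params_tuned (x := x) (w := 40 * Nat.size n) (M := M) hn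
  have hM16 : 16 ≤ M := by omega
  have hl : (params x (40 * Nat.size n) M).l < numBound n := by
    have : Nat.size n ≤ n := Nat.size_le.2 Nat.lt_two_pow_self
    have := lt_numBound hn
    change Nat.size n < _
    omega
  have hsize := Tri.whileCounter (w := 40 * Nat.size n) (M := M) (x := x) (r := rA)
    (Or.inr (by decide)) (p := halveSize.code) (t := halveSize.cost) (sizeInv x V)
    (fun a ha => computeBlocks_le hn hM ha)
    (fun j => (Cmd.tri hM16 halveSize _).mono le_rfl (fun a => by
      split_ifs with hj
      · exact halveSize_le hn (by omega) hj
      · exact le_top) fun a => le_rfl) n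
  have hdeg := Tri.whileCounter (w := 40 * Nat.size n) (M := M) (x := x) (r := rI)
    (Or.inr (by decide)) (p := sumDegree.code) (t := sumDegree.cost)
    (degreeInv x (40 * Nat.size n) M V)
    (fun a ha => computeTimes_le hn hM ha)
    (fun j => (Cmd.tri hM16 sumDegree _).mono le_rfl (fun a => by
      split_ifs with hj
      · exact sumDegree_le hn (by omega) hj
      · exact le_top) fun a => le_rfl) n
  have hall := Tri.seq (Cmd.tri hM16 readInput _) (Tri.seq hsize (Tri.seq
    (Cmd.tri hM16 computeBlocks _) (Tri.seq hdeg (Tri.seq (Cmd.tri hM16 computeTimes _)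
      (tri_rounds hf ht hc hconn hl)))))
  have := hall [] 0 (answerPost x c) (fun a m hm => ?_) (fun _ => 0) (fun _ => 0) fun _ _ => rfl
  · rw [zero_add] at this
    exact this.trans (readInput_le hn hM)
  · rw [val_nil]
    unfold answerPost
    rw [hm rAns (Or.inl rfl)]

end preamble

/-! ### Correctness and running time -/

section main

variable {n : ℕ} {x : USTCON n}

/-- A finite expectation of a function that is infinite at running configurations and at wrong
positive answers excludes both; the error probability is the value at `c = 1`. -/
theorem prog_solves (hn : 2 ≤ n) {S : ℕ} (hM : 67 ≤ S / (40 * Nat.size n)) :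
    prog.Solves (40 * Nat.size n) S (totalCost x (40 * Nat.size n) (S / (40 * Nat.size n))) x
      (n : ℝ≥0∞)⁻¹ := by
  classical
  set w := 40 * Nat.size n with hw
  set M := S / w with hMdef
  have hsound : ∀ z ∈ (prog.runOn w S (totalCost x w M) x).support,
      Halted z ∧ (Accepting z → x.Connected) := by
    have h := val_prog_le (x := x) hn hM (c := 0) le_rfl (Or.inl rfl)
    rw [val_eq_expect_run] at h
    have hne : expect (run w M x (totalCost x w M) ([prog], fun _ => 0))
        (fun z => if z.1 = [] then answerPost x 0 z.2 else ⊤) ≠ ⊤ := by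
      refine ne_top_of_le_ne_top ?_ h
      split_ifs <;> simp
    intro z hz
    have := expect_ne_top hne hz
    constructor
    · by_contra h1
      exact this (if_neg h1)
    · intro h2
      by_contra h3
      apply this
      split_ifs
      · rw [answerPost, if_neg fun h => h3 (h h2)]
      · rfl
  refine ⟨fun z hz => (hsound z hz).1, fun h z hz ha => h ((hsound z hz).2 ha), fun hc => ?_⟩
  have h := val_prog_le (x := x) hn hM (c := 1) zero_le_one (Or.inr hc)
  rw [val_eq_expect_run] at h
  set P := prog.runOn w S (totalCost x w M) x with hP
  have h1 : P.toOuterMeasure {z | Accepting z}ᶜ ≤ (n : ℝ≥0∞)⁻¹ := by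
    rw [← expect_indicator]
    refine le_trans (expect_mono _ fun z => ?_) (h.trans ?_)
    · by_cases hz : Accepting z
      · rw [if_neg (Set.notMem_compl_iff.2 hz)]
        exact zero_le
      · rw [if_pos (Set.mem_compl hz)]
        split_ifs
        · rw [answerPost, if_pos fun _ => hc, if_pos (not_not.1 hz), ENNReal.ofReal_one]
        · exact le_top
    · split_ifs
      · exact zero_le
      · rw [one_mul, one_div, inv_pow, ENNReal.ofReal_inv_of_pos (by positivity),
          ENNReal.inv_le_inv, ← ENNReal.ofReal_natCast]
        apply ENNReal.ofReal_le_ofReal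
        exact_mod_cast (Nat.lt_size_self n).le
  have h2 : 1 ≤ P.toOuterMeasure {z | Accepting z} + P.toOuterMeasure {z | Accepting z}ᶜ := by
    refine le_trans (le_of_eq ?_) (MeasureTheory.measure_union_le _ _)
    rw [Set.union_compl_self, PMF.toOuterMeasure_apply, Set.indicator_univ, PMF.tsum_coe]
  rw [tsub_le_iff_right]
  exact h2.trans (add_le_add le_rfl h1)

theorem size_le_log (hn : 2 ≤ n) : (Nat.size n : ℝ) ≤ 3 * Real.log n := by
  have hl := two_le_size hn
  obtain ⟨k, hk⟩ : ∃ k, Nat.size n = k + 1 := ⟨Nat.size n - 1, by omega⟩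
  have h1 : 2 ^ k ≤ n := Nat.lt_size.1 (by omega)
  have h2 : (k : ℝ) * Real.log 2 ≤ Real.log n := by
    rw [← Real.log_pow]
    exact Real.log_le_log (by positivity) (by exact_mod_cast h1)
  have h3 := Real.log_two_gt_d9
  have h4 : (1 : ℝ) ≤ k := by exact_mod_cast (by omega : 1 ≤ k)
  rw [hk]
  push_cast
  nlinarith

/-- Either every node is a block, or the blocks use a constant part of the memory. The cut-off of
the number of cells at the largest word matters only in the first case. -/
theorem numBlocks_eq_or (hn : 2 ≤ n) {S : ℕ} (hM : 132 ≤ S / (40 * Nat.size n)) :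
    numBlocks n (40 * Nat.size n) (S / (40 * Nat.size n)) = n ∨
      S ≤ 480 * Nat.size n * numBlocks n (40 * Nat.size n) (S / (40 * Nat.size n)) := by
  have hH := lt_numBound hn
  have h2 : 2 * numBound n ≤ 2 ^ (40 * Nat.size n) := by
    rw [← numBound_mul_self]
    exact Nat.mul_le_mul_right _ (by omega)
  have hl := two_le_size hn
  have hS := Nat.lt_mul_div_succ S (show 0 < 40 * Nat.size n by omega)
  unfold numBlocks
  split_ifs with h
  · exact Or.inl rfl
  · right
    set M := S / (40 * Nat.size n)
    have hmin : min M (2 ^ (40 * Nat.size n) - 1) = M := by omega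
    rw [hmin]
    have : M + 1 ≤ 12 * ((M - 64) / 3) := by omega
    nlinarith

/-- The number of steps, up to a constant that depends on the text of the program only. -/
theorem exists_totalCost_le : ∃ A : ℕ, ∀ (n : ℕ) (x : USTCON n) (w M : ℕ), 2 ≤ n →
    totalCost x w M ≤ A * (Nat.size n * (params x w M).T) := by
  refine ⟨readInput.cost + halveSize.cost + computeBlocks.cost + sumDegree.cost +
    computeTimes.cost + initCost + chooseLandmark.cost + startSearch.cost +
    (Cmd.seq walkStep inspect).cost + 20, fun n x w M hn => ?_⟩
  have hl := two_le_size hn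
  have hK : 0 < (params x w M).K := by
    unfold params
    positivity
  have hnT : n ≤ (params x w M).T := by
    change n ≤ 16 * (params x w M).K * n
    exact Nat.le_mul_of_pos_left _ (by omega)
  have hqT : (params x w M).q ≤ (params x w M).T := numBlocks_le.trans hnT
  have hpl : (params x w M).l = Nat.size n := rfl
  unfold totalCost roundCost
  rw [hpl]
  generalize readInput.cost = c₁
  generalize halveSize.cost = c₂
  generalize computeBlocks.cost = c₃
  generalize sumDegree.cost = c₄
  generalize computeTimes.cost = c₅
  generalize initCost = c₆
  generalize chooseLandmark.cost = c₇
  generalize startSearch.cost = c₈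
  generalize (Cmd.seq walkStep inspect).cost = c₉
  generalize (params x w M).T = T at *
  generalize (params x w M).q = q at *
  generalize Nat.size n = l at *
  have hTU : T ≤ l * T := Nat.le_mul_of_pos_left _ (by omega)
  have hlU : l ≤ l * T := Nat.le_mul_of_pos_right _ (by omega)
  have hqU : l * q ≤ l * T := Nat.mul_le_mul_left _ hqT
  have e : c₁ + (n * (c₂ + 1) + 1 + (c₃ + (n * (c₄ + 1) + 1 + (c₅ + (l * (c₆ + (q * (c₇ + 1) + 1 +
      (c₈ + (T * (c₉ + 1) + 1) + 1) + 1) + 1 + 1) + 1) + 1) + 1) + 1) + 1) + 1 =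
      1 * (c₁ + c₃ + c₅ + 8) + n * (c₂ + c₄ + 2) + l * (c₆ + c₈ + 6) + l * q * (c₇ + 1) +
        l * T * (c₉ + 1) := by ring
  rw [e]
  calc _ ≤ l * T * (c₁ + c₃ + c₅ + 8) + l * T * (c₂ + c₄ + 2) + l * T * (c₆ + c₈ + 6) +
        l * T * (c₇ + 1) + l * T * (c₉ + 1) := by
        gcongr <;> omega
    _ ≤ _ := by
        rw [← Nat.mul_add, ← Nat.mul_add, ← Nat.mul_add, ← Nat.mul_add, Nat.mul_comm]
        exact Nat.mul_le_mul_right _ (by omega)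

/-- The number of steps is at most of the order of `l ^ 3 * (n * g + n * d)`, where `n * g` is about
`n + n ^ 2 / q`, and `n * d` about `n + 2 m`. -/
theorem exists_time_le {α : ℝ} (hα : 0 < α) : ∃ C : ℝ, ∀ (n S : ℕ) (x : USTCON n), 2 ≤ n →
    132 ≤ S / (40 * Nat.size n) → α * n ≤ x.numEdges →
    (totalCost x (40 * Nat.size n) (S / (40 * Nat.size n)) : ℝ) ≤
      C * max ((n : ℝ) ^ 2 / S) x.numEdges * Real.log n ^ 4 := by
  obtain ⟨A, hA⟩ := exists_totalCost_le
  refine ⟨A * (81 * (192 * (24 * (2 / α + 480) + 10 * (2 + 1 / α)))), fun n S x hn hM hm => ?_⟩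
  have hT := hA n x (40 * Nat.size n) (S / (40 * Nat.size n)) hn
  have hq := numBlocks_eq_or hn hM
  have hqpos := numBlocks_pos (w := 40 * Nat.size n) (M := S / (40 * Nat.size n)) hn
    (by have := two_le_size hn; omega) (by omega)
  have hlog := size_le_log hn
  have hl2 := two_le_size hn
  have hTdef : (params x (40 * Nat.size n) (S / (40 * Nat.size n))).T =
    16 * (12 * Nat.size n * (24 * (Nat.size n *
      (n / numBlocks n (40 * Nat.size n) (S / (40 * Nat.size n)) + 1)) +
      10 * (2 * x.numEdges / n + 1))) * n := rfl
  rw [hTdef] at hT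
  have hSpos : 0 < S := by
    by_contra h0
    simp [Nat.eq_zero_of_not_pos h0] at hM
  set X := max ((n : ℝ) ^ 2 / S) x.numEdges with hX
  set q := numBlocks n (40 * Nat.size n) (S / (40 * Nat.size n))
  set l := Nat.size n
  have hl : (1 : ℝ) ≤ l := by exact_mod_cast (by omega : 1 ≤ l)
  have hnpos : (0 : ℝ) < n := by exact_mod_cast (by omega : 0 < n)
  have hXm : (x.numEdges : ℝ) ≤ X := le_max_right _ _
  have hX0 : 0 ≤ X := (Nat.cast_nonneg _).trans hXm
  have hXn : (n : ℝ) ≤ X / α := by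
    rw [le_div_iff₀ hα]
    linarith
  have hXα : 0 ≤ X / α := by positivity
  have hg : (n : ℝ) * ((n / q : ℕ) + 1 : ℝ) ≤ l * (X * (2 / α + 480)) := by
    have h1 : ((n / q : ℕ) : ℝ) ≤ n / q := Nat.cast_div_le
    have hq0 : (0 : ℝ) < q := by exact_mod_cast hqpos
    have h2 : (n : ℝ) * (n / q) ≤ X / α + l * (480 * X) := by
      rcases hq with hq | hq
      · rw [hq, div_self hnpos.ne', mul_one]
        exact hXn.trans (le_add_of_nonneg_right (by positivity))
      · have h3 : (S : ℝ) ≤ 480 * l * q := by exact_mod_cast hq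
        have h4 : (n : ℝ) ^ 2 / S ≤ X := le_max_left _ _
        rw [div_le_iff₀ (by exact_mod_cast hSpos)] at h4
        have h5 : (n : ℝ) * (n / q) ≤ l * (480 * X) := by
          rw [← mul_div_assoc, div_le_iff₀ hq0]
          calc (n : ℝ) * n = n ^ 2 := by ring
            _ ≤ X * S := h4
            _ ≤ X * (480 * l * q) := by gcongr
            _ = l * (480 * X) * q := by ring
        linarith
    calc (n : ℝ) * ((n / q : ℕ) + 1 : ℝ) ≤ n * (n / q + 1) := by gcongr
      _ = n * (n / q) + n := by ring
      _ ≤ X / α + l * (480 * X) + X / α := add_le_add h2 hXn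
      _ = 1 * (2 * (X / α)) + l * (480 * X) := by ring
      _ ≤ l * (2 * (X / α)) + l * (480 * X) := by gcongr
      _ = l * (X * (2 / α + 480)) := by ring
  have hd : (n : ℝ) * ((2 * x.numEdges / n : ℕ) + 1 : ℝ) ≤ X * (2 + 1 / α) := by
    have h1 : ((2 * x.numEdges / n : ℕ) : ℝ) ≤ (2 * x.numEdges : ℕ) / n := Nat.cast_div_le
    rw [le_div_iff₀ hnpos] at h1
    push_cast at h1
    have h2 : X * (2 + 1 / α) = 2 * X + X / α := by ring
    rw [h2]
    linarith
  have hT' : (totalCost x (40 * l) (S / (40 * l)) : ℝ) ≤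
      A * (l * (16 * (12 * l * (24 * (l * ((n / q : ℕ) + 1)) +
        10 * ((2 * x.numEdges / n : ℕ) + 1))) * n)) := by exact_mod_cast hT
  refine hT'.trans ?_
  calc (A : ℝ) * (l * (16 * (12 * l * (24 * (l * ((n / q : ℕ) + 1)) +
        10 * ((2 * x.numEdges / n : ℕ) + 1))) * n))
      = A * (192 * l ^ 2 * (24 * (l * (n * ((n / q : ℕ) + 1 : ℝ))) +
          10 * (n * ((2 * x.numEdges / n : ℕ) + 1 : ℝ)))) := by ring
    _ ≤ A * (192 * l ^ 2 * (24 * (l * (l * (X * (2 / α + 480)))) +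
          10 * (1 * (1 * (X * (2 + 1 / α)))))) := by
        rw [one_mul, one_mul]
        gcongr
    _ ≤ A * (192 * l ^ 2 * (24 * (l * (l * (X * (2 / α + 480)))) +
          10 * (l * (l * (X * (2 + 1 / α)))))) := by gcongr
    _ = A * (192 * (24 * (2 / α + 480) + 10 * (2 + 1 / α))) * X * (l : ℝ) ^ 4 := by ring
    _ ≤ A * (192 * (24 * (2 / α + 480) + 10 * (2 + 1 / α))) * X * (3 * Real.log n) ^ 4 := by gcongr
    _ = _ := by ring

end main

end Connectivity

theorem theorem1 :
    ∃ (P : WordRAM.Program) (κ : ℕ) (c : ℝ) (k : ℕ), 0 < c ∧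
      ∀ α : ℝ, 0 < α → ∃ C : ℝ,
        ∀ (n : ℕ) (S : ℕ) (x : USTCON n), 2 ≤ n → c * Real.log n ≤ S → α * n ≤ x.numEdges →
          ∃ T : ℕ,
            (T : ℝ) ≤ C * max ((n : ℝ) ^ 2 / S) (x.numEdges : ℝ) * Real.log n ^ k ∧
            P.Solves (κ * Nat.size n) S T x (n : ENNReal)⁻¹ := by
  refine ⟨Connectivity.prog, 40, 15840, 4, by norm_num, fun α hα => ?_⟩
  obtain ⟨C, hC⟩ := Connectivity.exists_time_le hα
  refine ⟨C, fun n S x hn hS hm => ?_⟩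
  have hM : 132 ≤ S / (40 * Nat.size n) := by
    have hl := Connectivity.two_le_size hn
    rw [Nat.le_div_iff_mul_le (by omega)]
    have h := Connectivity.size_le_log hn
    have : ((132 * (40 * Nat.size n) : ℕ) : ℝ) ≤ S := by
      push_cast
      linarith
    exact_mod_cast this
  exact ⟨_, hC n S x hn hM hm, Connectivity.prog_solves hn (by omega)⟩
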